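/- **Setting.** We work in one of the following categories: real-analytic manifolds, complex-analytic manifolds, or smooth algebraic varieties over a field $K$ of characteristic zero. Let $\sigma: X\to M_0$ be a morphism between smooth varieties, $n=\dim X$, $N=\dim M_0$. Suppose that the critical locus $\{b\in X:\ \mathrm{rk}_b\,\sigma<n\}$ is the support of a simple normal crossings divisor $E$ on $X$, i.e. $E$ is a locally finite union of closed smooth hypersurfaces (its components) which, at every point, are coordinate hyperplanes in suitable local coordinates. Let $a\in X$ (a closed point, in the algebraic case). **Conventions.** Local coordinates at $a$ vanish at $a$. They are analytic coordinates or, in the algebraic case, étale coordinates, i.e. functions on an étale neighbourhood $(U,b)$ of $(X,a)$ that vanish at $b$ and whose differentials form a basis of $\Omega^1_{U,b}$; in the latter case $\mathcal O_{X,a}$, $\Omega^1_{X,a}$ and $\sigma$ are replaced in (2) by $\mathcal O_{U,b}$, $\Omega^1_{U,b}$ and the composite $U\to X\to M_0$. Coordinates $(u,v)=(u_1,\dots,u_s,v_1,\dots,v_{n-s})$ of $X$ at $a$ are *adapted* to $E$ if $(u_1=0),\dots,(u_s=0)$ are exactly the components of $E$ at $a$ ($s=0$ if $a\notin E$). If $\sigma=(\sigma_1,\dots,\sigma_N)$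 with respect to coordinates of $M_0$ at $\sigma(a)$, the *logarithmic Jacobian matrix* of $\sigma$ is the matrix with rows $$\Big(u_1\frac{\partial\sigma_m}{\partial u_1},\dots,u_s\frac{\partial\sigma_m}{\partial u_s},\frac{\partial\sigma_m}{\partial v_1},\dots,\frac{\partial\sigma_m}{\partial v_{n-s}}\Big),\qquad m=1,\dots,N,$$ and the *logarithmic Fitting ideal* $\mathcal F_k(\sigma)_a\subset\mathcal O_{X,a}$, $0\le k\le n-1$, is the ideal generated by its minors of order $n-k$ (it does not depend on the coordinates). An ideal of $\mathcal O_{X,a}$ is a *principal $E$-monomial ideal* if it is generated by a single monomial $u^{\gamma}=u_1^{\gamma_1}\cdots u_s^{\gamma_s}$, $\gamma\in\mathbb N^s$, where $(u,v)$ are adapted coordinates at $a$. **Lemma.** For each $k=1,\dots,n$, the following are equivalent. 1. The logarithmic Fitting ideals $\mathcal F_{n-1}(\sigma)_a,\dots,\mathcal F_{n-k}(\sigma)_a$ are all principal $E$-monomial ideals. 2. There are coordinates $(u,v)$ of $X$ at $a$ adapted to $E$, and coordinates $z=(z_1,\dots,z_N)$ of $M_0$ at $\sigma(a)$, such that, writing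 $\sigma=(\sigma_1,\dots,\sigma_N)$ with respect to $z$: (a) the submodule $\mathcal M_k$ of $\Omega^1_{X,a}$ generated by $d\sigma_1,\dots,d\sigma_k$ is also generated by differential monomials $d(u^{\alpha_i})$, $i=1,\dots,l_k$, and $d(u^{\beta_j}v_j)$, $j=1,\dots,k-l_k$, for some $l_k$ with $0\le l_k\le k$ and $k-l_k\le n-s$, where $\alpha_i,\beta_j\in\mathbb N^s$, the $\alpha_1,\dots,\alpha_{l_k}$ are linearly independent over $\mathbb Q$, and the set $\{\alpha_i,\beta_j\}$ is totally ordered by the componentwise order of $\mathbb N^s$; (b) for each $m>k$, $\sigma_m=g_m+S_m$ with $g_m,S_m\in\mathcal O_{X,a}$, where $dg_m\in\mathcal M_k$ and $S_m$ is divisible by $u^{\mu}$, $\mu$ being the largest element of $\{\alpha_i,\beta_j\}$. -/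

import Mathlib

open scoped Manifold ContDiff Topology
open CategoryTheory

universe u w₁ w₂ w₃ w₄ w₅

/-! ## Coordinates, log Jacobian, log Fitting ideals and Hsiang-Pati form at a point

Throughout this part `O` is the local ring of `X` at a point, `d : O → Ω` the exterior derivative
with values in a module of 1-forms, `P` the local ring of `M₀` at the image point with
`dP : P → Θ`, and `φ : P → O` is the pull-back of functions by `σ`. A divisor is given at the point
by the relation `eqn i t`: "`t` is a local equation of the component `E_i`", where `i` runs over the
components through the point. These data are instantiated below, by germs of analytic functions
on a manifold and by the local rings of a scheme. -/

namespace HsiangPati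

variable {O Ω P Θ ι κ : Type*} [CommRing O] [AddCommGroup Ω] [Module O Ω]
  [CommRing P] [AddCommGroup Θ] [Module P Θ]

/-- Local coordinates at a point: functions vanishing at the point (non-units of the local ring)
whose differentials form a basis of the module of 1-forms, which is generated by all `d f`. -/
structure IsCoordinateSystem (d : O → Ω) (x : κ → O) : Prop where
  vanish : ∀ i, x i ∈ nonunits O
  linearIndependent : LinearIndependent O fun i => d (x i)
  span : ∀ f : O, d f ∈ Submodule.span O (Set.range fun i => d (x i))

/-- Coordinates `(u, v)` adapted to the divisor: `(u_1 = 0), …, (u_s = 0)` are exactly the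
components of the divisor at the point. -/
structure IsAdapted (d : O → Ω) (eqn : ι → O → Prop) {s r : ℕ} (u : Fin s → O) (v : Fin r → O) :
    Prop where
  coordinates : IsCoordinateSystem d (Sum.elim u v)
  components : ∃ e : Fin s ≃ ι, ∀ i, eqn (e i) (u i)

/-- The monomial `u ^ α`. -/
def monomial {s : ℕ} (u : Fin s → O) (α : Fin s → ℕ) : O := ∏ i, u i ^ α i

/-- `J` is the logarithmic Jacobian matrix of `f = (f_1, …, f_N)` in the coordinates `(u, v)`: its
`m`-th row is `(u_i ∂f_m/∂u_i, ∂f_m/∂v_j)`, where the partial derivatives are the coefficients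
of `d f_m` in the basis `(d u_i, d v_j)`. -/
def IsLogJacobian (d : O → Ω) {s r N : ℕ} (u : Fin s → O) (v : Fin r → O) (f : Fin N → O)
    (J : Matrix (Fin N) (Fin s ⊕ Fin r) O) : Prop :=
  ∃ (fu : Fin N → Fin s → O) (fv : Fin N → Fin r → O),
    (∀ m, d (f m) = ∑ i, fu m i • d (u i) + ∑ j, fv m j • d (v j)) ∧
    J = Matrix.of fun m => Sum.elim (fun i => u i * fu m i) (fun j => fv m j)

/-- The stalk of the logarithmic Fitting ideal `F_k(σ)`, where `n = dim X` and `N = dim M₀`: the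
ideal generated by the minors of order `n - k` of the log Jacobian matrices of `σ` (the minors in
different adapted coordinates of `X` and coordinates of `M₀` generate the same ideal, and all of
them are put in here so that no choice is needed). -/
def logFittingIdeal (d : O → Ω) (eqn : ι → O → Prop) (dP : P → Θ) (φ : P → O) (N n k : ℕ) :
    Ideal O :=
  Ideal.span {x | ∃ (s r : ℕ) (u : Fin s → O) (v : Fin r → O) (z : Fin N → P)
    (J : Matrix (Fin N) (Fin s ⊕ Fin r) O)
    (row : Fin (n - k) → Fin N) (col : Fin (n - k) → Fin s ⊕ Fin r),
    IsAdapted d eqn u v ∧ IsCoordinateSystem dP z ∧ IsLogJacobian d u v (fun m => φ (z m)) J ∧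
    x = (J.submatrix row col).det}

/-- `F` is a principal monomial ideal, generated by a monomial in local equations of the components
of the divisor. -/
def IsPrincipalMonomial (d : O → Ω) (eqn : ι → O → Prop) (F : Ideal O) : Prop :=
  ∃ (s r : ℕ) (u : Fin s → O) (v : Fin r → O) (γ : Fin s → ℕ),
    IsAdapted d eqn u v ∧ F = Ideal.span {monomial u γ}

/-- Partial Hsiang-Pati coordinates of order `k` at the point. Here `l` is the number of
differential monomials `d(u^α_i)` and `l'` is the number of those of the form `d(u^β_j v_j)`. -/
def HasHsiangPatiForm (d : O → Ω) (eqn : ι → O → Prop) (dP : P → Θ) (φ : P → O) (N k : ℕ) : Prop :=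
  ∃ (s r : ℕ) (u : Fin s → O) (v : Fin r → O) (z : Fin N → P),
    IsAdapted d eqn u v ∧ IsCoordinateSystem dP z ∧
    ∃ (l l' : ℕ) (_ : l + l' = k) (hr : l' ≤ r)
      (α : Fin l → Fin s → ℕ) (β : Fin l' → Fin s → ℕ) (μ : Fin s → ℕ) (M : Submodule O Ω),
      -- `M` is the module generated by `dσ_1, …, dσ_k`
      M = Submodule.span O {η | ∃ m : Fin N, (m : ℕ) < k ∧ η = d (φ (z m))} ∧
      -- it is also generated by the differential monomials
      M = Submodule.span O
        (Set.range (fun i => d (monomial u (α i))) ∪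
          Set.range (fun j => d (monomial u (β j) * v (Fin.castLE hr j)))) ∧
      LinearIndependent ℚ (fun (i : Fin l) (h : Fin s) => (α i h : ℚ)) ∧
      IsChain (· ≤ ·) (Set.range α ∪ Set.range β) ∧
      -- `μ` is the largest exponent, and the remaining components of `σ` split
      IsGreatest (Set.range α ∪ Set.range β) μ ∧
      ∀ m : Fin N, k ≤ (m : ℕ) →
        ∃ g S : O, φ (z m) = g + S ∧ d g ∈ M ∧ monomial u μ ∣ S

end HsiangPati

/-! ## Analytic manifolds over `𝕜 = ℝ` or `ℂ` -/

namespace HsiangPati.Analytic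

section Germs

variable (𝕜 : Type*) [RCLike 𝕜] (n : ℕ) {X : Type*} [TopologicalSpace X]
  [ChartedSpace (EuclideanSpace 𝕜 (Fin n)) X]

/-- The local ring of germs at `a` of analytic functions on `X`. -/
def germRing (a : X) : Subring (Filter.Germ (𝓝 a) 𝕜) where
  carrier := {g | ∃ f : X → 𝕜,
    ContMDiffAt 𝓘(𝕜, EuclideanSpace 𝕜 (Fin n)) 𝓘(𝕜, 𝕜) ω f a ∧ (f : Filter.Germ (𝓝 a) 𝕜) = g}
  mul_mem' := by
    rintro _ _ ⟨f, hf, rfl⟩ ⟨g, hg, rfl⟩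
    exact ⟨f * g, hf.mul hg, rfl⟩
  one_mem' := ⟨fun _ => 1, contMDiffAt_const, rfl⟩
  add_mem' := by
    rintro _ _ ⟨f, hf, rfl⟩ ⟨g, hg, rfl⟩
    exact ⟨f + g, hf.add hg, rfl⟩
  zero_mem' := ⟨fun _ => 0, contMDiffAt_const, rfl⟩
  neg_mem' := by
    rintro _ ⟨f, hf, rfl⟩
    exact ⟨-f, hf.neg, rfl⟩

/-- The differential of a germ of functions: the germ of the section
`y ↦ (d f)_y ∈ T_y^* X` of the cotangent bundle. -/
noncomputable def germD (a : X) (g : germRing 𝕜 n a) :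
    Filter.Germ (𝓝 a) (EuclideanSpace 𝕜 (Fin n) →L[𝕜] 𝕜) :=
  Filter.Germ.map' (lc := 𝓝 a)
    (fun (f : X → 𝕜) (y : X) => mfderiv 𝓘(𝕜, EuclideanSpace 𝕜 (Fin n)) 𝓘(𝕜, 𝕜) f y)
    (fun _ _ h => (eventually_eventually_nhds.2 h).mono fun _ hy =>
      Filter.EventuallyEq.mfderiv_eq hy) g.1

/-- `t` is a local equation at `a` of the subset `Z`. -/
def IsLocalEquation (a : X) (Z : Set X) (t : germRing 𝕜 n a) : Prop :=
  ∃ f : X → 𝕜, (f : Filter.Germ (𝓝 a) 𝕜) = t.1 ∧ ∀ᶠ y in 𝓝 a, y ∈ Z ↔ f y = 0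

/-- The local equations at `a` of the components of `E` through `a`. (They are used only for
functions that are part of a coordinate system, so the equations are reduced.) -/
def componentEqn {ι : Type*} (E : ι → Set X) (a : X) (i : {i // a ∈ E i})
    (t : germRing 𝕜 n a) : Prop :=
  IsLocalEquation 𝕜 n a (E i) t

/-- The family of subsets `E_i` is the family of components of a simple normal crossings divisor:
a locally finite family of closed smooth hypersurfaces, which are coordinate hyperplanes in
suitable coordinates at every point. -/
structure IsSNCDivisor {ι : Type*} (E : ι → Set X) : Prop where
  isClosed : ∀ i, IsClosed (E i)
  locallyFinite : LocallyFinite E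
  adapted : ∀ a : X, ∃ (s r : ℕ) (u : Fin s → germRing 𝕜 n a) (v : Fin r → germRing 𝕜 n a),
    IsAdapted (germD 𝕜 n a) (componentEqn 𝕜 n E a) u v

end Germs

variable {𝕜 : Type*} [RCLike 𝕜] {n N : ℕ} {X M₀ : Type*} [TopologicalSpace X]
  [ChartedSpace (EuclideanSpace 𝕜 (Fin n)) X] [TopologicalSpace M₀]
  [ChartedSpace (EuclideanSpace 𝕜 (Fin N)) M₀] {σ : X → M₀}

/-- Pull-back of germs of analytic functions by an analytic mapping. -/
def pullback
    (hσ : ContMDiff 𝓘(𝕜, EuclideanSpace 𝕜 (Fin n)) 𝓘(𝕜, EuclideanSpace 𝕜 (Fin N)) ω σ)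
    (a : X) (g : germRing 𝕜 N (σ a)) : germRing 𝕜 n a :=
  ⟨g.1.compTendsto σ hσ.continuous.continuousAt, by
    obtain ⟨_, f, hf, rfl⟩ := g
    exact ⟨f ∘ σ, ContMDiffAt.comp a hf (hσ a), rfl⟩⟩

variable (𝕜 n N σ) in
/-- The critical locus `{a : rk_a σ < n}`. -/
def criticalLocus : Set X :=
  {a | Module.finrank 𝕜 (LinearMap.range (mfderiv 𝓘(𝕜, EuclideanSpace 𝕜 (Fin n))
    𝓘(𝕜, EuclideanSpace 𝕜 (Fin N)) σ a).toLinearMap) < n}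

end HsiangPati.Analytic

/-! ## Smooth schemes over a field -/

namespace HsiangPati.Algebraic

open AlgebraicGeometry



variable {K : Type u} [Field K]

/-- The local ring of the `K`-scheme `X` at `a`. -/
def LocalRing {X : Scheme.{u}} (_p : X ⟶ Spec (.of K)) (a : X) : Type u := X.presheaf.stalk a

noncomputable instance {X : Scheme.{u}} (p : X ⟶ Spec (.of K)) (a : X) :
    CommRing (LocalRing p a) :=
  inferInstanceAs (CommRing (X.presheaf.stalk a))

instance {X : Scheme.{u}} (p : X ⟶ Spec (.of K)) (a : X) : IsLocalRing (LocalRing p a) :=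
  inferInstanceAs (IsLocalRing (X.presheaf.stalk a))

/-- The `K`-algebra structure of the local ring, given by the structure morphism
`p : X ⟶ Spec K`. -/
noncomputable instance {X : Scheme.{u}} (p : X ⟶ Spec (.of K)) (a : X) :
    Algebra K (LocalRing p a) :=
  RingHom.toAlgebra
    ((X.presheaf.germ ⊤ a trivial).hom.comp
      (p.appTop.hom.comp (Scheme.ΓSpecIso (.of K)).inv.hom) : K →+* X.presheaf.stalk a)

/-- `t` is a (reduced) local equation at `a` of the closed subset `Z`: it generates the ideal of
the local ring at `a` of the functions vanishing on `Z`. -/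
def IsLocalEquation {X : Scheme.{u}} (p : X ⟶ Spec (.of K)) (a : X) (Z : Set X)
    (t : LocalRing p a) : Prop :=
  (Ideal.span {t} : Ideal (X.presheaf.stalk a)) =
    PrimeSpectrum.vanishingIdeal (X.fromSpecStalk a ⁻¹' Z)

/-- The local equations at `a` of the components of `E` through `a`. -/
def componentEqn {X : Scheme.{u}} (p : X ⟶ Spec (.of K)) {ι : Type*} (E : ι → Set X) (a : X)
    (i : {i // a ∈ E i}) (t : LocalRing p a) : Prop :=
  IsLocalEquation p a (E i) t

/-- The family of subsets `E_i` is the family of components of a simple normal crossings divisor: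
a locally finite family of closed smooth hypersurfaces, which are coordinate hyperplanes in
suitable coordinates at every closed point. -/
structure IsSNCDivisor {X : Scheme.{u}} (p : X ⟶ Spec (.of K)) {ι : Type*} (E : ι → Set X) :
    Prop where
  isClosed : ∀ i, IsClosed (E i)
  locallyFinite : LocallyFinite E
  adapted : ∀ a : X, IsClosed {a} →
    ∃ (s r : ℕ) (u : Fin s → LocalRing p a) (v : Fin r → LocalRing p a),
      IsAdapted (KaehlerDifferential.D K (LocalRing p a)) (componentEqn p E a) u v

variable {X M₀ : Scheme.{u}}

/-- Pull-back of germs of functions by `σ`. -/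
noncomputable def pullback (p : X ⟶ Spec (.of K)) (q : M₀ ⟶ Spec (.of K)) (σ : X ⟶ M₀) (a : X) :
    LocalRing q (σ a) →+* LocalRing p a :=
  (σ.stalkMap a).hom

/-- The rank of `σ` at `a`: the rank of the linear mapping induced by `σ` from the fibre at `σ(a)`
of the cotangent sheaf of `M₀` to the fibre at `a` of that of `X`. -/
noncomputable def rankAt (p : X ⟶ Spec (.of K)) (q : M₀ ⟶ Spec (.of K)) (σ : X ⟶ M₀) (a : X) : ℕ :=
  Module.finrank (IsLocalRing.ResidueField (LocalRing p a))
    (Submodule.span (IsLocalRing.ResidueField (LocalRing p a))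
      (Set.range fun f : LocalRing q (σ a) =>
        (1 : IsLocalRing.ResidueField (LocalRing p a)) ⊗ₜ[LocalRing p a]
          KaehlerDifferential.D K (LocalRing p a) (pullback p q σ a f)))

/-- The critical locus `{a : rk_a σ < n}`. -/
def criticalLocus (p : X ⟶ Spec (.of K)) (q : M₀ ⟶ Spec (.of K)) (σ : X ⟶ M₀) (n : ℕ) : Set X :=
  {a | rankAt p q σ a < n}

end HsiangPati.Algebraic

/-!
The proof is an induction on `k`, carried out once for an abstract local ring with an exterior
derivative and a divisor (`IsLogModel`), of which germs of analytic functions and local rings of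
smooth schemes are instances.

A log minor of `σ` is a determinant of pairings of the gradients of the `σ_m` with the logarithmic
vector fields `u_i ∂/∂u_i`, `∂/∂v_j`; the ideal of these minors depends only on the modules
generated by the two sets of vectors (`minorIdeal_eq_of_span_eq`), which is why it does not depend
on the coordinates (`IsLogModel.logFittingIdeal_eq`). Suppose that `σ_m = g_m + u^μ T_m` is in
Hsiang-Pati form of order `k`, with differential monomials of exponents `α_i`, `β_j`. There are
logarithmic vector fields dual to the differential monomials, namely Euler fields `∑ λ_h u_h
∂/∂u_h` (corrected in the `v_j`) dual to the `u^α_i`, and `∂/∂v_j`. With the fields that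
annihilate all the differential monomials, they generate the logarithmic fields. In this basis the
log Jacobian matrix is block diagonal: one block is diagonal with entries `u^α_i`, `u^β_j`, the
other consists of the derivatives of the remainders `u^μ T_m` along the annihilating fields, which
are divisible by `u^μ` (`IsDecomposition.exists_isDiagonalForm`). Since the exponents are totally
ordered, the minors of order `j ≤ k` generate the monomial whose exponent is the sum of the `j`
smallest exponents. This is the implication from Hsiang-Pati form to monomial Fitting ideals.

For the converse, monomiality of the minors of order `k + 1` means that the second block generates
a monomial ideal `(u^δ)` (`IsDecomposition.exists_exponent`). One may then assume that `μ = δ`: as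
long as `μ_i < δ_i`, the part of `u^μ T_m` given by the restriction of `T_m` to `(u_i = 0)` is
annihilated by the annihilating fields, hence its differential is a combination of the
differential monomials, and it can be moved into `g_m` (`IsClosedFamily.exists_isPartialForm`).
Now some derivative of some `u^δ T_m` along an annihilating field is `u^δ` times a unit. If the
field is an Euler field, then `T_m` is a unit and `δ` is not in the span of the `α_i`. Whenever
these two conditions hold, `T_m` is absorbed in `u^δ` by multiplying the `u_i` by powers of a root
of `T_m` (up to a constant), and the new differential monomial is `d(u^δ)`. Otherwise the field is
`∂/∂v_j`, and `T_m`, minus its value at the point, can be taken as the coordinate `v_j`: the new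
differential monomial is `d(u^δ v_j)` (`IsClosedFamily.hasPartialForm_succ`).

The construction uses three operations on functions, axiomatized in `LogModel.IsClosedFamily`:
restriction to a coordinate hyperplane, extended independently of the transverse coordinate; the
value at the point, as a function with zero differential; and roots of units. For analytic germs
they exist in the local ring itself. In the algebraic case each of them is available after passing
to an étale neighbourhood: coordinates define an étale map to affine space, whose fibre product
with its composite with the projection to the hyperplane is the neighbourhood on which the
restriction is defined (`exists_restriction`). Conversely, monomiality of the Fitting ideals
descends from étale neighbourhoods by faithful flatness (`comap_map_pullback`).
-/


namespace HsiangPati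

/-! ### Ideals of minors of a set of vectors -/

section Minors

variable {R κ : Type*} [CommRing R] [Fintype κ]

/-- The ideal generated by the minors of order `j` of the pairing `⬝ᵥ` between a set `S` of row
vectors and a set `T` of column vectors. With this definition a change of rows or columns needs
only multilinearity of the determinant. -/
def minorIdeal (S T : Set (κ → R)) (j : ℕ) : Ideal R :=
  Ideal.span {x | ∃ a b : Fin j → κ → R, (∀ i, a i ∈ S) ∧ (∀ i, b i ∈ T) ∧
    x = (Matrix.of fun i i' => a i ⬝ᵥ b i').det}

theorem multilinear_mem_of_mem_span {M N : Type*} [AddCommGroup M] [Module R M] [AddCommGroup N]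
    [Module R N] {j : ℕ} (f : MultilinearMap R (fun _ : Fin j => M) N) (I : Submodule R N)
    (S : Set M) (h : ∀ a : Fin j → M, (∀ i, a i ∈ S) → f a ∈ I) (a : Fin j → M)
    (ha : ∀ i, a i ∈ Submodule.span R S) : f a ∈ I := by
  classical
  suffices H : ∀ (t : Finset (Fin j)) (a : Fin j → M), (∀ i ∈ t, a i ∈ Submodule.span R S) →
      (∀ i ∉ t, a i ∈ S) → f a ∈ I from H Finset.univ a (fun i _ => ha i) (by simp)
  intro t
  induction t using Finset.induction_on with
  | empty => intro a _ h2; exact h a (fun i => h2 i (by simp))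
  | insert i t hit ih =>
    intro a h1 h2
    have key : ∀ y ∈ Submodule.span R S, f (Function.update a i y) ∈ I := by
      intro y hy
      induction hy using Submodule.span_induction with
      | mem y hy =>
        refine ih _ (fun i' hi' => ?_) (fun i' hi' => ?_)
        · have : i' ≠ i := by rintro rfl; exact hit hi'
          rw [Function.update_of_ne this]
          exact h1 i' (Finset.mem_insert_of_mem hi')
        · by_cases hii : i' = i
          · subst hii; simpa using hy
          · rw [Function.update_of_ne hii]
            exact h2 i' (by simp [hii, hi'])
      | zero => rw [f.map_update_zero]; exact I.zero_mem
      | add y z _ _ hy hz => rw [f.map_update_add]; exact I.add_mem hy hz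
      | smul c y _ hy => rw [f.map_update_smul]; exact I.smul_mem c hy
    have := key (a i) (h1 i (Finset.mem_insert_self _ _))
    rwa [Function.update_eq_self] at this

theorem det_mem_minorIdeal {S T : Set (κ → R)} {j : ℕ} {n : Type*} [Fintype n] [DecidableEq n]
    (hn : Fintype.card n = j) (a b : n → κ → R) (ha : ∀ i, a i ∈ S) (hb : ∀ i, b i ∈ T) :
    (Matrix.of fun i i' => a i ⬝ᵥ b i').det ∈ minorIdeal S T j := by
  let e : Fin j ≃ n := (Fintype.equivFinOfCardEq hn).symm
  rw [← Matrix.det_submatrix_equiv_self e]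
  exact Ideal.subset_span ⟨a ∘ e, b ∘ e, fun i => ha _, fun i => hb _, rfl⟩

theorem minorIdeal_le_of_subset_span {S S' T T' : Set (κ → R)} (hS : S ⊆ Submodule.span R S')
    (hT : T ⊆ Submodule.span R T') (j : ℕ) : minorIdeal S T j ≤ minorIdeal S' T' j := by
  rw [minorIdeal, Ideal.span_le]
  rintro _ ⟨a, b, ha, hb, rfl⟩
  let rowMap (b : Fin j → κ → R) : (κ → R) →ₗ[R] (Fin j → R) :=
    { toFun := fun w i' => w ⬝ᵥ b i'
      map_add' := fun x y => funext fun i' => add_dotProduct _ _ _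
      map_smul' := fun c x => funext fun i' => by simp [smul_dotProduct] }
  have h1 : ∀ b : Fin j → κ → R, (∀ i, b i ∈ T') →
      (Matrix.of fun i i' => a i ⬝ᵥ b i').det ∈ minorIdeal S' T' j := by
    intro b hb
    let f := (Matrix.detRowAlternating (R := R) (n := Fin j)).toMultilinearMap.compLinearMap
      (fun _ => rowMap b)
    have := multilinear_mem_of_mem_span f (minorIdeal S' T' j) S'
      (fun a ha => Ideal.subset_span ⟨a, b, ha, hb, rfl⟩) a (fun i => hS (ha i))
    exact this
  let f := (Matrix.detRowAlternating (R := R) (n := Fin j)).toMultilinearMap.compLinearMap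
      (fun _ => rowMap a)
  have h2 : ∀ b : Fin j → κ → R, f b = (Matrix.of fun i i' => a i ⬝ᵥ b i').det := by
    intro b
    rw [← Matrix.det_transpose]
    change Matrix.det _ = Matrix.det _
    congr 1
    ext i i'
    exact dotProduct_comm _ _
  have := multilinear_mem_of_mem_span f (minorIdeal S' T' j) T'
      (fun b hb => by rw [h2]; exact h1 b hb) b (fun i => hT (hb i))
  rw [h2] at this
  exact this

theorem minorIdeal_eq_of_span_eq {S S' T T' : Set (κ → R)}
    (hS : Submodule.span R S = Submodule.span R S')
    (hT : Submodule.span R T = Submodule.span R T') (j : ℕ) :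
    minorIdeal S T j = minorIdeal S' T' j :=
  le_antisymm
    (minorIdeal_le_of_subset_span (hS ▸ Submodule.subset_span) (hT ▸ Submodule.subset_span) j)
    (minorIdeal_le_of_subset_span (hS.symm ▸ Submodule.subset_span)
      (hT.symm ▸ Submodule.subset_span) j)

theorem minorIdeal_map {R' : Type*} [CommRing R'] (ψ : R →+* R') (S T : Set (κ → R)) (j : ℕ) :
    (minorIdeal S T j).map ψ =
      minorIdeal ((fun w i => ψ (w i)) '' S) ((fun w i => ψ (w i)) '' T) j := by
  have hdet : ∀ a b : Fin j → κ → R, ψ (Matrix.of fun i i' => a i ⬝ᵥ b i').det =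
      (Matrix.of fun i i' => (fun k => ψ (a i k)) ⬝ᵥ (fun k => ψ (b i' k))).det := by
    intro a b
    rw [RingHom.map_det]
    congr 1
    ext i i'
    simp [RingHom.map_dotProduct, Function.comp_def]
  rw [minorIdeal, Ideal.map_span]
  refine le_antisymm (Ideal.span_le.2 ?_) (Ideal.span_le.2 ?_)
  · rintro _ ⟨_, ⟨a, b, ha, hb, rfl⟩, rfl⟩
    rw [hdet]
    exact Ideal.subset_span ⟨_, _, fun i => ⟨_, ha i, rfl⟩, fun i => ⟨_, hb i, rfl⟩, rfl⟩
  · rintro _ ⟨a, b, ha, hb, rfl⟩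
    choose a' ha' ha'' using ha
    choose b' hb' hb'' using hb
    refine Ideal.subset_span ⟨_, ⟨a', b', ha', hb', rfl⟩, ?_⟩
    rw [hdet]
    simp only [← ha'', ← hb'']

end Minors

/-! ### Partial derivatives in a coordinate system -/

/-- The rules that make an additive map `d` into a module of 1-forms a derivation. -/
structure IsExteriorDerivative {O Ω : Type*} [CommRing O] [AddCommGroup Ω] [Module O Ω]
    (d : O → Ω) : Prop where
  map_add : ∀ f g, d (f + g) = d f + d g
  leibniz : ∀ f g, d (f * g) = f • d g + g • d f

section Coordinates

variable {O Ω κ : Type*} [CommRing O] [AddCommGroup Ω] [Module O Ω] {d : O → Ω}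

namespace IsExteriorDerivative

variable (hd : IsExteriorDerivative d)
include hd

theorem map_zero : d 0 = 0 := by
  have := hd.map_add 0 0
  simpa using this

theorem map_one : d 1 = 0 := by
  have := hd.leibniz 1 1
  simpa using this

theorem map_neg (f : O) : d (-f) = -d f := by
  have := hd.map_add f (-f)
  rw [add_neg_cancel, hd.map_zero] at this
  exact (neg_eq_of_add_eq_zero_right this.symm).symm

theorem map_sub (f g : O) : d (f - g) = d f - d g := by
  rw [sub_eq_add_neg, hd.map_add, hd.map_neg, sub_eq_add_neg]

theorem map_const_mul {c : O} (hc : d c = 0) (f : O) : d (c * f) = c • d f := by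
  rw [hd.leibniz, hc, smul_zero, add_zero]

end IsExteriorDerivative

variable [Algebra ℚ O] {x : κ → O}

/-- The partial derivative `∂/∂x_i` of a coordinate system: the coefficient of `d x_i`. -/
noncomputable def IsCoordinateSystem.partialDeriv (hx : IsCoordinateSystem d x)
    (hd : IsExteriorDerivative d) (i : κ) : Derivation ℚ O O :=
  Derivation.mk' (AddMonoidHom.toRatLinearMap
    { toFun := fun f => hx.linearIndependent.repr ⟨d f, hx.span f⟩ i
      map_zero' := by
        have : (⟨d 0, hx.span 0⟩ : Submodule.span O (Set.range fun i => d (x i))) = 0 :=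
          Subtype.ext hd.map_zero
        rw [this]; simp
      map_add' := fun f g => by
        have : (⟨d (f + g), hx.span _⟩ : Submodule.span O (Set.range fun i => d (x i))) =
            ⟨d f, hx.span f⟩ + ⟨d g, hx.span g⟩ := Subtype.ext (hd.map_add f g)
        rw [this, _root_.map_add, Finsupp.add_apply] }) (fun f g => by
        have : (⟨d (f * g), hx.span _⟩ : Submodule.span O (Set.range fun i => d (x i))) =
            f • ⟨d g, hx.span g⟩ + g • ⟨d f, hx.span f⟩ := Subtype.ext (hd.leibniz f g)
        change hx.linearIndependent.repr _ i = f • hx.linearIndependent.repr _ i +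
          g • hx.linearIndependent.repr _ i
        rw [this, _root_.map_add, _root_.map_smul, _root_.map_smul]
        rfl)

variable (hx : IsCoordinateSystem d x) (hd : IsExteriorDerivative d)

variable [Fintype κ]

theorem IsCoordinateSystem.d_eq_sum (f : O) :
    d f = ∑ i, hx.partialDeriv hd i f • d (x i) := by
  have := hx.linearIndependent.linearCombination_repr ⟨d f, hx.span f⟩
  rw [Finsupp.linearCombination_apply, Finsupp.sum_fintype _ _ (by simp)] at this
  exact this.symm

theorem IsCoordinateSystem.partialDeriv_eq {f : O} {c : κ → O}
    (h : d f = ∑ i, c i • d (x i)) (i : κ) : hx.partialDeriv hd i f = c i := by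
  rw [hx.d_eq_sum hd f] at h
  have h2 : ∑ i, (hx.partialDeriv hd i f - c i) • d (x i) = 0 := by
    simp only [sub_smul, Finset.sum_sub_distrib]
    rw [h, sub_self]
  exact sub_eq_zero.1 (Fintype.linearIndependent_iff.1 hx.linearIndependent _ h2 i)

theorem IsCoordinateSystem.partialDeriv_coord [DecidableEq κ] (i j : κ) :
    hx.partialDeriv hd i (x j) = if i = j then 1 else 0 := by
  refine hx.partialDeriv_eq hd (c := fun i => if i = j then 1 else 0) ?_ i
  simp

theorem IsCoordinateSystem.d_eq_zero_iff {f : O} :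
    d f = 0 ↔ ∀ i, hx.partialDeriv hd i f = 0 := by
  constructor
  · intro h i
    exact hx.partialDeriv_eq hd (c := fun _ => 0) (by simp [h]) i
  · intro h
    rw [hx.d_eq_sum hd]
    simp [h]

/-- Linear relations between differentials are linear relations between partial derivatives. -/
theorem IsCoordinateSystem.d_eq_sum_iff {P : Type*} [Fintype P] {f : O} {a h : P → O} :
    d f = ∑ p, a p • d (h p) ↔
      ∀ i, hx.partialDeriv hd i f = ∑ p, a p * hx.partialDeriv hd i (h p) := by
  have : ∑ p, a p • d (h p) = ∑ i, (∑ p, a p * hx.partialDeriv hd i (h p)) • d (x i) := by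
    simp only [Finset.sum_smul, mul_smul]
    rw [Finset.sum_comm]
    refine Finset.sum_congr rfl fun p _ => ?_
    rw [← Finset.smul_sum, ← hx.d_eq_sum hd]
  rw [this]
  constructor
  · intro h i
    exact hx.partialDeriv_eq hd h i
  · intro h
    rw [hx.d_eq_sum hd]
    simp only [h]

/-- The chain rule for a change of coordinates. -/
theorem IsCoordinateSystem.partialDeriv_eq_sum {κ' : Type*} [Fintype κ'] {x' : κ' → O}
    (hx' : IsCoordinateSystem d x') (i : κ') (f : O) :
    hx'.partialDeriv hd i f = ∑ l, hx.partialDeriv hd l f * hx'.partialDeriv hd i (x l) :=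
  (hx'.d_eq_sum_iff hd).1 (hx.d_eq_sum hd f) i

/-- The vector of partial derivatives. -/
noncomputable def IsCoordinateSystem.grad (f : O) : κ → O := fun i => hx.partialDeriv hd i f

/-- The derivation `∑ c_i ∂/∂x_i`. -/
noncomputable def IsCoordinateSystem.vectorField (c : κ → O) : Derivation ℚ O O :=
  ∑ i, c i • hx.partialDeriv hd i

theorem IsCoordinateSystem.vectorField_apply (c : κ → O) (f : O) :
    hx.vectorField hd c f = ∑ i, c i * hx.partialDeriv hd i f := by
  simp only [IsCoordinateSystem.vectorField]
  rw [← Derivation.coeFnAddMonoidHom_apply, _root_.map_sum, Finset.sum_apply]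
  simp [Derivation.coeFnAddMonoidHom_apply]

theorem IsCoordinateSystem.grad_dotProduct (c : κ → O) (f : O) :
    hx.grad hd f ⬝ᵥ c = hx.vectorField hd c f := by
  rw [hx.vectorField_apply hd, dotProduct]
  exact Finset.sum_congr rfl fun i _ => mul_comm _ _

theorem IsCoordinateSystem.vectorField_coord (c : κ → O) (j : κ) :
    hx.vectorField hd c (x j) = c j := by
  classical
  rw [hx.vectorField_apply hd]
  simp [hx.partialDeriv_coord hd]

end Coordinates

end HsiangPati

namespace HsiangPati

/-! ### Local models of a manifold with a simple normal crossings divisor -/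

section Model

variable {O Ω ι : Type*} [CommRing O] [AddCommGroup Ω] [Module O Ω]

/-- The coefficients in `∂/∂u_i, ∂/∂v_j` of the logarithmic vector fields
`u_i ∂/∂u_i, ∂/∂v_j`. -/
def logCol {s r : ℕ} (u : Fin s → O) : Fin s ⊕ Fin r → Fin s ⊕ Fin r → O :=
  Sum.elim (fun i => Pi.single (.inl i) (u i)) (fun j => Pi.single (.inr j) 1)

theorem mem_span_logCol {s r : ℕ} {u : Fin s → O} (w : Fin s ⊕ Fin r → O)
    (h : ∀ i, u i ∣ w (.inl i)) : w ∈ Submodule.span O (Set.range (logCol (r := r) u)) := by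
  rw [Submodule.mem_span_range_iff_exists_fun]
  choose c hc using h
  refine ⟨Sum.elim c fun j => w (.inr j), ?_⟩
  ext (i | j)
  · simp [logCol, Finset.sum_apply, Pi.single_apply, hc, mul_comm]
  · simp [logCol, Finset.sum_apply, Pi.single_apply]

theorem dvd_of_mem_span_logCol {s r : ℕ} {u : Fin s → O} {w : Fin s ⊕ Fin r → O}
    (h : w ∈ Submodule.span O (Set.range (logCol (r := r) u))) (i : Fin s) : u i ∣ w (.inl i) := by
  rw [Submodule.mem_span_range_iff_exists_fun] at h
  obtain ⟨c, rfl⟩ := h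
  refine ⟨c (.inl i), ?_⟩
  simp [logCol, Finset.sum_apply, Pi.single_apply, mul_comm]

section Monomial

variable {s : ℕ} (u : Fin s → O)

theorem monomial_add (α β : Fin s → ℕ) : monomial u (α + β) = monomial u α * monomial u β := by
  simp [monomial, pow_add, Finset.prod_mul_distrib]

theorem monomial_zero : monomial u 0 = 1 := by simp [monomial]

theorem monomial_single (h : Fin s) : monomial u (Pi.single h 1) = u h := by
  classical
  rw [monomial, Finset.prod_eq_single h] <;> simp +contextual

theorem monomial_sum {A : Type*} (t : Finset A) (α : A → Fin s → ℕ) :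
    monomial u (∑ a ∈ t, α a) = ∏ a ∈ t, monomial u (α a) := by
  classical
  induction t using Finset.induction_on with
  | empty => simp [monomial_zero]
  | insert a t ha ih => rw [Finset.sum_insert ha, Finset.prod_insert ha, monomial_add, ih]

theorem monomial_dvd_monomial {α β : Fin s → ℕ} (h : α ≤ β) : monomial u α ∣ monomial u β := by
  obtain ⟨γ, rfl⟩ := exists_add_of_le h
  exact ⟨_, monomial_add u α γ⟩

end Monomial

variable [Algebra ℚ O]

/-- The properties of the local ring `O` of a manifold or smooth variety at a point, with its
exterior derivative `d` and the local equations `eqn` of the components of a divisor, on which the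
equivalence depends. Both the germs of analytic functions and the local rings of smooth schemes in
characteristic zero have them. -/
structure IsLogModel (d : O → Ω) (eqn : ι → O → Prop) : Prop where
  isExteriorDerivative : IsExteriorDerivative d
  mul_eq_zero : ∀ {κ : Type} [Fintype κ] {x : κ → O}, IsCoordinateSystem d x →
    ∀ i y, x i * y = 0 → y = 0
  dvd_of_dvd_mul : ∀ {κ : Type} [Fintype κ] {x : κ → O}, IsCoordinateSystem d x →
    ∀ i j y, i ≠ j → x i ∣ x j * y → x i ∣ y
  eq_zero_of_dvd : ∀ {κ : Type} [Fintype κ] {x : κ → O} (hx : IsCoordinateSystem d x),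
    ∀ i h, x i ∣ h → hx.partialDeriv isExteriorDerivative i h = 0 → h = 0
  partialDeriv_comm : ∀ {κ : Type} [Fintype κ] {x : κ → O} (hx : IsCoordinateSystem d x),
    ∀ i j f, hx.partialDeriv isExteriorDerivative i (hx.partialDeriv isExteriorDerivative j f) =
      hx.partialDeriv isExteriorDerivative j (hx.partialDeriv isExteriorDerivative i f)
  eqn_mul : ∀ i t ξ, eqn i t → IsUnit ξ → eqn i (t * ξ)
  eqn_dvd : ∀ {κ : Type} [Fintype κ] {x : κ → O}, IsCoordinateSystem d x →
    ∀ i l t, eqn i (x l) → eqn i t → x l ∣ t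

variable {d : O → Ω} {eqn : ι → O → Prop}

theorem IsLogJacobian.apply_eq {s r N : ℕ} {u : Fin s → O} {v : Fin r → O}
    (hx : IsCoordinateSystem d (Sum.elim u v)) (hd : IsExteriorDerivative d) {f : Fin N → O}
    {J : Matrix (Fin N) (Fin s ⊕ Fin r) O} (hJ : IsLogJacobian d u v f J) (m : Fin N)
    (c : Fin s ⊕ Fin r) : J m c = hx.grad hd (f m) ⬝ᵥ logCol u c := by
  obtain ⟨fu, fv, h, rfl⟩ := hJ
  have h' : ∀ i, hx.partialDeriv hd i (f m) = Sum.elim (fu m) (fv m) i :=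
    hx.partialDeriv_eq hd (by simp [h m])
  rcases c with i | j
  · simp [logCol, IsCoordinateSystem.grad, h', mul_comm]
  · simp [logCol, IsCoordinateSystem.grad, h']

theorem isLogJacobian_grad {s r N : ℕ} {u : Fin s → O} {v : Fin r → O}
    (hx : IsCoordinateSystem d (Sum.elim u v)) (hd : IsExteriorDerivative d) (f : Fin N → O) :
    IsLogJacobian d u v f (Matrix.of fun m c => hx.grad hd (f m) ⬝ᵥ logCol u c) := by
  refine ⟨fun m i => hx.partialDeriv hd (.inl i) (f m), fun m j => hx.partialDeriv hd (.inr j) (f m),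
    fun m => ?_, ?_⟩
  · have := hx.d_eq_sum hd (f m)
    simpa using this
  · ext m (i | j)
    · simp [logCol, IsCoordinateSystem.grad, mul_comm]
    · simp [logCol, IsCoordinateSystem.grad]

/-- Logarithmic vector fields of one adapted coordinate system are logarithmic in any other. -/
theorem IsLogModel.exists_logCol (hM : IsLogModel d eqn) {s r s' r' : ℕ} {u : Fin s → O}
    {v : Fin r → O} {u' : Fin s' → O} {v' : Fin r' → O} (huv : IsAdapted d eqn u v)
    (huv' : IsAdapted d eqn u' v') (c : Fin s' ⊕ Fin r') :
    ∃ w ∈ Submodule.span O (Set.range (logCol (r := r) u)), ∀ f,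
      huv'.coordinates.grad hM.isExteriorDerivative f ⬝ᵥ logCol u' c =
        huv.coordinates.grad hM.isExteriorDerivative f ⬝ᵥ w := by
  have hd := hM.isExteriorDerivative
  set D := huv'.coordinates.vectorField hd (logCol u' c) with hD
  refine ⟨fun l => D (Sum.elim u v l), mem_span_logCol _ fun i => ?_, fun f => ?_⟩
  · obtain ⟨e, he⟩ := huv.components
    obtain ⟨e', he'⟩ := huv'.components
    set i' := e'.symm (e i) with hi'
    have h1 : eqn (e i) (u' i') := by simpa [hi'] using he' i'
    obtain ⟨a, ha⟩ : u i ∣ u' i' := hM.eqn_dvd huv.coordinates (e i) (.inl i) _ (he i) h1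
    obtain ⟨b, hb⟩ : u' i' ∣ u i := hM.eqn_dvd huv'.coordinates (e i) (.inl i') _ h1 (he i)
    have h2 : u' i' ∣ D (u' i') := by
      have : D (u' i') = logCol u' c (.inl i') :=
        huv'.coordinates.vectorField_coord hd _ (.inl i')
      rw [this]
      exact dvd_of_mem_span_logCol (Submodule.subset_span ⟨c, rfl⟩) i'
    change u i ∣ D (u i)
    rw [hb, D.leibniz, smul_eq_mul, smul_eq_mul, ← hb]
    have h3 : u i ∣ u' i' := ⟨a, ha⟩
    exact dvd_add (h3.mul_right _) ((h3.trans h2).mul_left _)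
  · rw [huv'.coordinates.grad_dotProduct, ← hD, dotProduct, hD,
      huv'.coordinates.vectorField_apply]
    simp only [huv'.coordinates.vectorField_apply, IsCoordinateSystem.grad, Finset.mul_sum]
    rw [Finset.sum_comm]
    refine Finset.sum_congr rfl fun i _ => ?_
    rw [huv.coordinates.partialDeriv_eq_sum hd huv'.coordinates i f, Finset.mul_sum]
    refine Finset.sum_congr rfl fun l _ => ?_
    ring

/-- The ideal of log minors of order `j` of functions `f_m` in adapted coordinates `(u, v)`. -/
noncomputable def logMinors (hd : IsExteriorDerivative d) {s r : ℕ} {u : Fin s → O} {v : Fin r → O}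
    (hx : IsCoordinateSystem d (Sum.elim u v)) {N : ℕ} (f : Fin N → O) (j : ℕ) : Ideal O :=
  minorIdeal (Set.range fun m => hx.grad hd (f m)) (Set.range (logCol u)) j

theorem IsLogModel.logMinors_le (hM : IsLogModel d eqn) {s r s' r' : ℕ} {u : Fin s → O}
    {v : Fin r → O} {u' : Fin s' → O} {v' : Fin r' → O} (huv : IsAdapted d eqn u v)
    (huv' : IsAdapted d eqn u' v') {N : ℕ} (f : Fin N → O) (j : ℕ) :
    logMinors hM.isExteriorDerivative huv'.coordinates f j ≤
      logMinors hM.isExteriorDerivative huv.coordinates f j := by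
  rw [logMinors, minorIdeal, Ideal.span_le]
  rintro _ ⟨a, b, ha, hb, rfl⟩
  choose a' ha' using ha
  choose b' hb' using hb
  choose w hw hw' using fun i => hM.exists_logCol huv huv' (b' i)
  have : (Matrix.of fun i i' => a i ⬝ᵥ b i') = Matrix.of fun i i' =>
      huv.coordinates.grad hM.isExteriorDerivative (f (a' i)) ⬝ᵥ w i' := by
    ext i i'
    simp only [Matrix.of_apply, ← ha', ← hb', hw']
  rw [this]
  refine minorIdeal_le_of_subset_span (S := Set.range fun m => huv.coordinates.grad _ (f m))
    (T := Set.range w) Submodule.subset_span ?_ j (det_mem_minorIdeal (by simp) _ _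
      (fun i => ⟨_, rfl⟩) (fun i => ⟨_, rfl⟩))
  rintro _ ⟨i, rfl⟩
  exact hw i

theorem IsLogModel.logMinors_eq (hM : IsLogModel d eqn) {s r s' r' : ℕ} {u : Fin s → O}
    {v : Fin r → O} {u' : Fin s' → O} {v' : Fin r' → O} (huv : IsAdapted d eqn u v)
    (huv' : IsAdapted d eqn u' v') {N : ℕ} (f : Fin N → O) (j : ℕ) :
    logMinors hM.isExteriorDerivative huv'.coordinates f j =
      logMinors hM.isExteriorDerivative huv.coordinates f j :=
  le_antisymm (hM.logMinors_le huv huv' f j) (hM.logMinors_le huv' huv f j)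

theorem IsCoordinateSystem.grad_mem_span {κ P : Type*} [Fintype κ] [Fintype P] {x : κ → O}
    (hx : IsCoordinateSystem d x) (hd : IsExteriorDerivative d) {f : O} {h : P → O}
    (hf : d f ∈ Submodule.span O (Set.range fun p => d (h p))) :
    hx.grad hd f ∈ Submodule.span O (Set.range fun p => hx.grad hd (h p)) := by
  rw [Submodule.mem_span_range_iff_exists_fun] at hf ⊢
  obtain ⟨c, hc⟩ := hf
  refine ⟨c, ?_⟩
  ext i
  have := (hx.d_eq_sum_iff hd).1 hc.symm i
  simp [IsCoordinateSystem.grad, Finset.sum_apply, this]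

/-- The ideal of log minors depends only on the module generated by the differentials. -/
theorem logMinors_le_of_span (hd : IsExteriorDerivative d) {s r : ℕ} {u : Fin s → O}
    {v : Fin r → O} (hx : IsCoordinateSystem d (Sum.elim u v)) {N N' : ℕ} {f : Fin N → O}
    {f' : Fin N' → O}
    (h : ∀ m, d (f m) ∈ Submodule.span O (Set.range fun m => d (f' m))) (j : ℕ) :
    logMinors hd hx f j ≤ logMinors hd hx f' j := by
  refine minorIdeal_le_of_subset_span ?_ Submodule.subset_span j
  rintro _ ⟨m, rfl⟩
  exact hx.grad_mem_span hd (h m)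

/-- The pull-back of 1-forms is well defined on linear combinations of differentials. -/
def IsPullback {P Θ : Type*} [CommRing P] [AddCommGroup Θ] [Module P Θ] (d : O → Ω) (dP : P → Θ)
    (φ : P → O) (N : ℕ) : Prop :=
  ∀ (f : P) (c z : Fin N → P), dP f = ∑ l, c l • dP (z l) →
    d (φ f) = ∑ l, φ (c l) • d (φ (z l))

/-- The logarithmic Fitting ideal can be computed in any adapted coordinates. -/
theorem IsLogModel.logFittingIdeal_eq {P Θ : Type*} [CommRing P] [AddCommGroup Θ] [Module P Θ]
    {dP : P → Θ} {φ : P → O} (hM : IsLogModel d eqn) {s r N n j : ℕ} {u : Fin s → O}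
    {v : Fin r → O} (huv : IsAdapted d eqn u v) (hφ : IsPullback d dP φ N) {z : Fin N → P}
    (hz : IsCoordinateSystem dP z) (hj : j ≤ n) :
    logFittingIdeal d eqn dP φ N n (n - j) =
      logMinors hM.isExteriorDerivative huv.coordinates (fun m => φ (z m)) j := by
  obtain ⟨k, hk⟩ : ∃ k, n - j = k := ⟨_, rfl⟩
  obtain rfl : j = n - k := by omega
  rw [hk]
  have hd := hM.isExteriorDerivative
  refine le_antisymm ?_ ?_
  · rw [logFittingIdeal, Ideal.span_le]
    rintro _ ⟨s', r', u', v', z', J, row, col, huv', hz', hJ, rfl⟩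
    refine logMinors_le_of_span (f := fun m => φ (z' m)) hd huv.coordinates (fun m => ?_) _
      (hM.logMinors_le huv huv' _ _ ?_)
    · obtain ⟨c, hc⟩ := Submodule.mem_span_range_iff_exists_fun _ |>.1 (hz.span (z' m))
      rw [hφ _ _ _ hc.symm]
      exact Submodule.sum_mem _ fun l _ => Submodule.smul_mem _ _ (Submodule.subset_span ⟨l, rfl⟩)
    · have : J.submatrix row col = Matrix.of fun i i' =>
          huv'.coordinates.grad hd (φ (z' (row i))) ⬝ᵥ logCol u' (col i') := by
        ext i i'
        exact hJ.apply_eq huv'.coordinates hd _ _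
      rw [this]
      exact det_mem_minorIdeal (by simp) _ _ (fun i => ⟨_, rfl⟩) (fun i => ⟨_, rfl⟩)
  · rw [logMinors, minorIdeal, Ideal.span_le]
    rintro _ ⟨a, b, ha, hb, rfl⟩
    choose a' ha' using ha
    choose b' hb' using hb
    refine Ideal.subset_span ⟨s, r, u, v, z, _, a', b', huv, hz,
      isLogJacobian_grad huv.coordinates hd _, ?_⟩
    congr 1
    ext i i'
    simp [← ha', ← hb']

/-! ### Monomials -/

section Monomial

variable {s : ℕ} (u : Fin s → O)

theorem Derivation.map_monomial (D : Derivation ℚ O O) {w : Fin s → O}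
    (hw : ∀ i, D (u i) = w i * u i) (α : Fin s → ℕ) :
    D (monomial u α) = (∑ i, α i * w i) * monomial u α := by
  classical
  have h1 : ∀ (i : Fin s) (n : ℕ), D (u i ^ n) = n * w i * u i ^ n := by
    intro i n
    rw [D.leibniz_pow, hw]
    rcases n with _ | n
    · simp
    · simp only [Nat.add_sub_cancel, smul_eq_mul, nsmul_eq_mul]
      ring
  simp only [monomial]
  induction (Finset.univ : Finset (Fin s)) using Finset.induction_on with
  | empty => simp
  | insert i t hi ih =>
    rw [Finset.prod_insert hi, D.leibniz, ih, h1, Finset.sum_insert hi]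
    simp only [smul_eq_mul]
    ring

variable {u} {r : ℕ} {v : Fin r → O} (hM : IsLogModel d eqn)
  (hx : IsCoordinateSystem d (Sum.elim u v))
include hM hx

/-- Coordinates are nonzerodivisors, and so are monomials. -/
theorem IsLogModel.monomial_mul_cancel (α : Fin s → ℕ) {a b : O}
    (h : monomial u α * a = monomial u α * b) : a = b := by
  classical
  have key : ∀ (t : Finset (Fin s)) (y : O), (∏ i ∈ t, u i ^ α i) * y = 0 → y = 0 := by
    intro t
    induction t using Finset.induction_on with
    | empty => simp
    | insert i t hi ih =>
      intro y hy
      rw [Finset.prod_insert hi, mul_assoc] at hy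
      refine ih y ?_
      generalize α i = n at hy
      induction n with
      | zero => simpa using hy
      | succ n ihn =>
        rw [pow_succ', mul_assoc] at hy
        exact ihn (hM.mul_eq_zero hx (.inl i) _ hy)
  exact sub_eq_zero.1 (key Finset.univ _ (by rw [mul_sub, sub_eq_zero]; exact h))

theorem IsLogModel.le_of_monomial_dvd_monomial [Nontrivial O] {α β : Fin s → ℕ}
    (h : monomial u α ∣ monomial u β) : α ≤ β := by
  classical
  rw [Pi.le_def]
  intro i
  by_contra! hlt
  obtain ⟨c, hc⟩ := h
  have h1 : monomial u β = u i ^ β i * ∏ l ∈ Finset.univ.erase i, u l ^ β l :=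
    (Finset.mul_prod_erase _ _ (Finset.mem_univ i)).symm
  obtain ⟨e, he⟩ : ∃ e, α i = β i + 1 + e := ⟨α i - (β i + 1), by omega⟩
  have h2 : monomial u α = u i ^ β i * (u i * (u i ^ e * ∏ l ∈ Finset.univ.erase i, u l ^ α l)) := by
    rw [monomial, ← Finset.mul_prod_erase _ _ (Finset.mem_univ i), he]
    ring
  have h3 : u i ∣ ∏ l ∈ Finset.univ.erase i, u l ^ β l := by
    have hpow : u i ^ β i = monomial u (Pi.single i (β i)) := by
      rw [monomial, Finset.prod_eq_single i] <;> simp +contextual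
    rw [h1, h2, hpow, mul_assoc] at hc
    exact ⟨_, (hM.monomial_mul_cancel hx _ hc).trans (mul_assoc _ _ _)⟩
  -- `u_i` does not divide a product of powers of the other coordinates
  have key : ∀ t : Finset (Fin s), i ∉ t → ¬ u i ∣ ∏ l ∈ t, u l ^ β l := by
    intro t
    induction t using Finset.induction_on with
    | empty =>
      intro _ h
      exact hx.vanish (.inl i) (isUnit_of_dvd_one (by simpa using h))
    | insert l t hl ih =>
      intro hi h
      rw [Finset.prod_insert hl] at h
      simp only [Finset.mem_insert, not_or] at hi
      refine ih hi.2 ?_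
      generalize β l = n at h
      induction n with
      | zero => simpa using h
      | succ n ihn =>
        rw [pow_succ', mul_assoc] at h
        exact ihn (hM.dvd_of_dvd_mul hx (.inl i) (.inl l) _ (by simpa using hi.1) h)
  exact key _ (by simp) h3

end Monomial

end Model

end HsiangPati

namespace HsiangPati

/-! ### Minors of a matrix in diagonal normal form -/

section DiagonalMinors

variable {R κ P : Type*} [CommRing R] [Fintype κ]

/-- If `J` indexes the smallest of the elements `t_p`, then the product over `J` divides every
product of as many factors which are distinct `t_p`'s or the common multiple `t` of all `t_p`. -/
theorem prod_dvd_prod_of_smallest {m : Type*} [Fintype m] {t : P → R} {t₀ : R}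
    (ht : ∀ p, t p ∣ t₀) (J : Finset P) (hJ : ∀ p ∈ J, ∀ q ∉ J, t p ∣ t q)
    (hm : Fintype.card m = J.card) (o : m → Option P)
    (ho : ∀ i i' p, o i = some p → o i' = some p → i = i') :
    ∏ p ∈ J, t p ∣ ∏ i, (o i).elim t₀ t := by
  classical
  -- match the factors with the elements of `J`, those indexed by elements of `J` with themselves
  let J' : Finset (Option P) := J.map Function.Embedding.some
  obtain ⟨g, hg⟩ := Finset.exists_equiv_extend_of_card_eq (t := J')
    (s := Finset.univ.filter fun i => o i ∈ J') (f := o) (by simp [J', hm])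
    (by intro x; simp only [Finset.mem_image, Finset.mem_filter]; rintro ⟨i, hi, rfl⟩; exact hi.2)
    (by
      intro i hi i' hi' h
      have : o i ∈ J' := by simpa using hi
      obtain ⟨p, _, hp⟩ := Finset.mem_map.1 this
      exact ho i i' p hp.symm (h ▸ hp.symm))
  have h1 : ∏ p ∈ J, t p = ∏ i, ((g i : J') : Option P).elim t₀ t := by
    rw [Equiv.prod_comp g (fun x : J' => (x : Option P).elim t₀ t),
      Finset.prod_coe_sort J' (fun x => x.elim t₀ t), Finset.prod_map]
    rfl
  rw [h1]
  refine Finset.prod_dvd_prod_of_dvd _ _ fun i _ => ?_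
  by_cases hi : o i ∈ J'
  · rw [hg i (by simpa using hi)]
  · obtain ⟨p, hp, hp'⟩ := Finset.mem_map.1 (g i).2
    rw [← hp']
    rcases hoi : o i with _ | q
    · exact ht p
    · refine hJ p hp q fun hq => hi ?_
      rw [hoi]
      exact Finset.mem_map.2 ⟨q, hq, rfl⟩

variable [DecidableEq P]

/-- Row vectors `W_p` and column vectors `D_p` with a diagonal pairing, together with further rows
`ρ ∈ S` and columns `F ∈ C` in the complementary block, where all entries are divisible by the
common multiple `t₀` of the diagonal entries `t_p`. -/
structure IsDiagonalForm (W D : P → κ → R) (S C : Set (κ → R)) (t : P → R) (t₀ : R) : Prop where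
  diag : ∀ p q, W p ⬝ᵥ D q = if p = q then t p else 0
  row : ∀ p, ∀ F ∈ C, W p ⬝ᵥ F = 0
  col : ∀ ρ ∈ S, ∀ q, ρ ⬝ᵥ D q = 0
  dvd : ∀ ρ ∈ S, ∀ F ∈ C, t₀ ∣ ρ ⬝ᵥ F
  dvd_max : ∀ p, t p ∣ t₀

variable {W D : P → κ → R} {S C : Set (κ → R)} {t : P → R} {t₀ : R}

/-- A choice of rows amounts to a choice of diagonal entries, or of `none` for rows in the
complementary block; the entry divides the whole row of any submatrix. -/
theorem IsDiagonalForm.exists_option (h : IsDiagonalForm W D S C t t₀) {j : ℕ}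
    (a b : Fin j → κ → R) (ha : ∀ i, a i ∈ Set.range W ∪ S)
    (hb : ∀ i, b i ∈ Set.range D ∪ C) :
    ∃ o : Fin j → Option P, (∀ i p, o i = some p → a i = W p) ∧ (∀ i, o i = none → a i ∈ S) ∧
      ∀ i i', (o i).elim t₀ t ∣ a i ⬝ᵥ b i' := by
  classical
  have : ∀ i, ∃ o : Option P, (∀ p, o = some p → a i = W p) ∧ (o = none → a i ∈ S) ∧
      ∀ i', o.elim t₀ t ∣ a i ⬝ᵥ b i' := by
    intro i
    rcases ha i with ⟨p, hp⟩ | hS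
    · refine ⟨some p, by rintro _ ⟨⟩; exact hp.symm, by simp, fun i' => ?_⟩
      rcases hb i' with ⟨q, hq⟩ | hC
      · rw [← hp, ← hq, h.diag]
        split_ifs <;> simp
      · rw [← hp, h.row p _ hC]
        exact dvd_zero _
    · refine ⟨none, by simp, fun _ => hS, fun i' => ?_⟩
      rcases hb i' with ⟨q, hq⟩ | hC
      · rw [← hq, h.col _ hS]
        exact dvd_zero _
      · exact h.dvd _ hS _ hC
  choose o ho using this
  exact ⟨o, fun i => (ho i).1, fun i => (ho i).2.1, fun i => (ho i).2.2⟩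

/-- The ideal of minors of order `j` of a diagonal form is generated by the product of the `j`
smallest diagonal entries. -/
theorem IsDiagonalForm.minorIdeal_eq (h : IsDiagonalForm W D S C t t₀) (J : Finset P)
    (hJ : ∀ p ∈ J, ∀ q ∉ J, t p ∣ t q) :
    minorIdeal (Set.range W ∪ S) (Set.range D ∪ C) J.card = Ideal.span {∏ p ∈ J, t p} := by
  classical
  refine le_antisymm ?_ ?_
  · rw [minorIdeal, Ideal.span_le]
    rintro _ ⟨a, b, ha, hb, rfl⟩
    obtain ⟨o, ho, -, hdvd⟩ := h.exists_option a b ha hb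
    rw [SetLike.mem_coe, Ideal.mem_span_singleton]
    by_cases hinj : ∀ i i' p, o i = some p → o i' = some p → i = i'
    · refine (prod_dvd_prod_of_smallest h.dvd_max J hJ (by simp) o hinj).trans ?_
      choose c hc using hdvd
      have : (Matrix.of fun i i' => a i ⬝ᵥ b i') =
          Matrix.of fun i i' => (o i).elim t₀ t * (Matrix.of c) i i' := by
        ext i i'
        exact hc i i'
      rw [this, Matrix.det_mul_column]
      exact dvd_mul_right _ _
    · -- two equal rows
      push Not at hinj
      obtain ⟨i, i', p, h1, h2, hne⟩ := hinj
      rw [Matrix.det_zero_of_row_eq hne]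
      · exact dvd_zero _
      · ext c
        simp [ho i p h1, ho i' p h2]
  · rw [Ideal.span_singleton_le_iff_mem]
    have : (∏ p ∈ J, t p) = (Matrix.of fun i i' : J => W i ⬝ᵥ D i').det := by
      have : (Matrix.of fun i i' : J => W i ⬝ᵥ D i') = Matrix.diagonal fun p : J => t p := by
        ext i i'
        rw [Matrix.of_apply, h.diag, Matrix.diagonal_apply]
        exact if_congr Subtype.ext_iff.symm rfl rfl
      rw [this, Matrix.det_diagonal, Finset.prod_coe_sort]
    rw [this]
    exact det_mem_minorIdeal (by simp) _ _ (fun i => .inl ⟨_, rfl⟩) (fun i => .inl ⟨_, rfl⟩)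

variable [Fintype P]

/-- The ideal of minors of order one more than the number of diagonal entries is the product of all
diagonal entries and of the ideal of entries of the complementary block. -/
theorem IsDiagonalForm.minorIdeal_succ_eq (h : IsDiagonalForm W D S C t t₀) :
    minorIdeal (Set.range W ∪ S) (Set.range D ∪ C) (Fintype.card P + 1) =
      Ideal.span {∏ p, t p} * Ideal.span {x | ∃ ρ ∈ S, ∃ F ∈ C, x = ρ ⬝ᵥ F} := by
  classical
  refine le_antisymm ?_ ?_
  · rw [minorIdeal, Ideal.span_le]
    rintro _ ⟨a, b, ha, hb, rfl⟩
    obtain ⟨o, ho, ho', hdvd⟩ := h.exists_option a b ha hb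
    rw [SetLike.mem_coe]
    by_cases hinj : ∀ i i' p, o i = some p → o i' = some p → i = i'
    · -- by the pigeonhole principle, some row is in the complementary block
      obtain ⟨i₀, hi₀⟩ : ∃ i, o i = none := by
        by_contra! hne
        have hsome : ∀ i, ∃ p, o i = some p := fun i => Option.ne_none_iff_exists'.1 (hne i)
        choose p hp using hsome
        have := Fintype.card_le_of_injective p
          (fun i i' hii => hinj i i' (p i) (hp i) (by rw [hii]; exact hp i'))
        simp at this
      -- extract the diagonal entries from all rows but `i₀`, whose entries lie in the block
      choose c hc using hdvd
      have hM : (Matrix.of fun i i' => a i ⬝ᵥ b i') =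
          Matrix.of fun i i' => (if i = i₀ then 1 else (o i).elim t₀ t) *
            (Matrix.of fun i i' => if i = i₀ then a i ⬝ᵥ b i' else c i i') i i' := by
        ext i i'
        by_cases hi : i = i₀
        · simp [hi]
        · simp [hi, hc i i']
      rw [hM, Matrix.det_mul_column]
      refine Ideal.mul_mem_mul (Ideal.mem_span_singleton.2 ?_) ?_
      · have h1 : ∏ i, (if i = i₀ then 1 else (o i).elim t₀ t) =
            ∏ i : {i // i ≠ i₀}, (o i).elim t₀ t := by
          rw [← Fintype.prod_subtype_mul_prod_subtype (fun i => i ≠ i₀)]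
          rw [Finset.prod_congr rfl (fun i _ => if_neg i.2),
            Finset.prod_eq_one (s := (Finset.univ : Finset {i // ¬ i ≠ i₀}))
              (fun i _ => if_pos (not_not.1 i.2)), mul_one]
        rw [h1]
        exact prod_dvd_prod_of_smallest h.dvd_max Finset.univ (by simp)
          (by simp [Fintype.card_subtype_compl]) (fun i : {i // i ≠ i₀} => o i)
          (fun i i' p h1 h2 => Subtype.ext (hinj _ _ p h1 h2))
      · rw [Matrix.det_apply]
        refine Ideal.sum_mem _ fun σ _ => ?_
        rw [Units.smul_def, zsmul_eq_mul]
        refine Ideal.mul_mem_left _ _ ?_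
        rw [← Finset.mul_prod_erase _ _ (Finset.mem_univ (σ⁻¹ i₀))]
        refine Ideal.mul_mem_right _ _ ?_
        have hσ : σ (σ⁻¹ i₀) = i₀ := σ.apply_symm_apply i₀
        simp only [hσ, Matrix.of_apply, if_true]
        rcases hb (σ⁻¹ i₀) with ⟨q, hq⟩ | hC
        · rw [← hq, h.col _ (ho' _ hi₀)]
          exact Ideal.zero_mem _
        · exact Ideal.subset_span ⟨_, ho' _ hi₀, _, hC, rfl⟩
    · push Not at hinj
      obtain ⟨i, i', p, h1, h2, hne⟩ := hinj
      rw [Matrix.det_zero_of_row_eq hne]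
      · exact Ideal.zero_mem _
      · ext c
        simp [ho i p h1, ho i' p h2]
  · rw [Ideal.span_mul_span', Ideal.span_le]
    rintro _ ⟨_, hx, _, ⟨ρ, hρ, F, hF, rfl⟩, rfl⟩
    rw [Set.mem_singleton_iff] at hx
    subst hx
    have : (∏ p, t p) * ρ ⬝ᵥ F = (Matrix.of fun i i' : P ⊕ Unit =>
        Sum.elim W (fun _ => ρ) i ⬝ᵥ Sum.elim D (fun _ => F) i').det := by
      have : (Matrix.of fun i i' : P ⊕ Unit =>
        Sum.elim W (fun _ => ρ) i ⬝ᵥ Sum.elim D (fun _ => F) i') =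
          Matrix.fromBlocks (Matrix.diagonal t) 0 0 (Matrix.of fun _ _ : Unit => ρ ⬝ᵥ F) := by
        ext (i | i) (i' | i')
        · simp [h.diag, Matrix.diagonal_apply]
        · simp [h.row _ _ hF]
        · simp [h.col _ hρ]
        · simp
      rw [this, Matrix.det_fromBlocks_zero₂₁, Matrix.det_diagonal]
      simp
    change (∏ p, t p) * ρ ⬝ᵥ F ∈ _
    rw [this]
    refine det_mem_minorIdeal (by simp) _ _ ?_ ?_
    · rintro (i | i)
      · exact .inl ⟨_, rfl⟩
      · exact .inr hρ
    · rintro (i | i)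
      · exact .inl ⟨_, rfl⟩
      · exact .inr hF

end DiagonalMinors

end HsiangPati

namespace HsiangPati

/-! ### Differential monomials and the vector fields dual to them -/

/-- The exponents of a family of monomials `u^α_i`, `u^β_j v_{idx j}`, with `α_i` linearly
independent over `ℚ` and distinct `idx j`. -/
structure MonomialExponents (s r l l' : ℕ) where
  α : Fin l → Fin s → ℕ
  β : Fin l' → Fin s → ℕ
  idx : Fin l' → Fin r
  idx_injective : Function.Injective idx
  linearIndependent : LinearIndependent ℚ (fun (i : Fin l) (h : Fin s) => (α i h : ℚ))

namespace MonomialExponents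

variable {s r l l' : ℕ} (A : MonomialExponents s r l l')

/-- The exponents `α_i` and `β_j`. -/
def exp : Fin l ⊕ Fin l' → Fin s → ℕ := Sum.elim A.α A.β

/-- The monomials `u^α_i` and `u^β_j v_{idx j}`. -/
def fn {O : Type*} [CommRing O] (u : Fin s → O) (v : Fin r → O) : Fin l ⊕ Fin l' → O :=
  Sum.elim (fun i => monomial u (A.α i)) (fun j => monomial u (A.β j) * v (A.idx j))

/-- Weights of the coordinates `(u, v)` which extend given weights of `u` and for which all
`u^β_j v_{idx j}` have weight zero; the other `v_j` have weight zero. -/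
def weight (w : Fin s → ℚ) : Fin s ⊕ Fin r → ℚ :=
  Sum.elim w fun j => -∑ j', if A.idx j' = j then ∑ h, A.β j' h * w h else 0

theorem weight_idx (w : Fin s → ℚ) (j : Fin l') :
    A.weight w (.inr (A.idx j)) = -∑ h, A.β j h * w h := by
  rw [weight, Sum.elim_inr, Finset.sum_eq_single j]
  · simp
  · intro j' _ hj
    rw [if_neg fun h => hj (A.idx_injective h)]
  · simp

/-- A basis of weights of `u` dual to the exponents `α_i`. -/
theorem exists_dual : ∃ lam : Fin l → Fin s → ℚ, ∀ i i',
    ∑ h, A.α i' h * lam i h = if i = i' then 1 else 0 := by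
  classical
  have : ∀ i, ∃ w : Fin s → ℚ, ∀ i', ∑ h, A.α i' h * w h = if i = i' then 1 else 0 := by
    intro i
    obtain ⟨f, hf⟩ := LinearMap.exists_extend
      ((Finsupp.lapply i).comp A.linearIndependent.repr)
    refine ⟨fun h => f (Pi.single h 1), fun i' => ?_⟩
    have h1 := LinearMap.pi_apply_eq_sum_univ f (fun h => (A.α i' h : ℚ))
    have h2 : f (fun h => (A.α i' h : ℚ)) = if i = i' then 1 else 0 := by
      have := LinearMap.congr_fun hf
        ⟨fun h => (A.α i' h : ℚ), Submodule.subset_span ⟨i', rfl⟩⟩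
      rw [LinearMap.comp_apply, Submodule.subtype_apply] at this
      rw [this, LinearMap.comp_apply,
        A.linearIndependent.repr_eq_single i' _ rfl]
      simp [Finsupp.single_apply, eq_comm]
    rw [← h2, h1]
    refine Finset.sum_congr rfl fun h _ => ?_
    have h3 : (Pi.single h 1 : Fin s → ℚ) = fun j => if h = j then 1 else 0 := by
      ext h'
      simp [Pi.single_apply, eq_comm]
    rw [smul_eq_mul, ← h3]
  choose lam hlam using this
  exact ⟨lam, hlam⟩

end MonomialExponents

section EulerFields

variable {O Ω : Type*} [CommRing O] [AddCommGroup Ω] [Module O Ω] [Algebra ℚ O] {d : O → Ω}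

/-- The coefficients of the Euler vector field `∑ w_i x_i ∂/∂x_i` with rational weights `w_i`. -/
def euler {κ : Type*} (x : κ → O) (w : κ → ℚ) : κ → O := fun i => w i • x i

section

variable {κ : Type*} [Fintype κ] {x : κ → O} (hx : IsCoordinateSystem d x)
  (hd : IsExteriorDerivative d)

theorem IsCoordinateSystem.vectorField_single [DecidableEq κ] (i : κ) (a : O) (f : O) :
    hx.vectorField hd (Pi.single i a) f = a * hx.partialDeriv hd i f := by
  rw [hx.vectorField_apply hd, Finset.sum_eq_single i] <;> simp +contextual

end

variable {s r : ℕ} {u : Fin s → O} {v : Fin r → O}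
  (hx : IsCoordinateSystem d (Sum.elim u v)) (hd : IsExteriorDerivative d)

theorem IsCoordinateSystem.euler_monomial (w : Fin s ⊕ Fin r → ℚ) (γ : Fin s → ℕ) :
    hx.vectorField hd (euler (Sum.elim u v) w) (monomial u γ) =
      (∑ h, γ h * w (.inl h)) • monomial u γ := by
  rw [Derivation.map_monomial (w := fun h => algebraMap ℚ O (w (.inl h)))]
  · rw [Algebra.smul_def]
    simp [_root_.map_sum]
  · intro i
    have := hx.vectorField_coord hd (euler (Sum.elim u v) w) (.inl i)
    rw [Sum.elim_inl] at this
    rw [this, euler, Algebra.smul_def, Sum.elim_inl]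

theorem IsCoordinateSystem.partialDeriv_inr_monomial (j : Fin r) (γ : Fin s → ℕ) :
    hx.partialDeriv hd (.inr j) (monomial u γ) = 0 := by
  rw [Derivation.map_monomial (w := fun h => 0)]
  · simp
  · intro i
    have := hx.partialDeriv_coord hd (.inr j) (.inl i)
    simpa using this

theorem IsCoordinateSystem.partialDeriv_inr_inr (j j' : Fin r) :
    hx.partialDeriv hd (.inr j) (v j') = if j = j' then 1 else 0 := by
  have := hx.partialDeriv_coord hd (.inr j) (.inr j')
  simpa using this

/-- Logarithmic vector fields preserve the ideals generated by monomials. -/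
theorem IsCoordinateSystem.monomial_dvd_vectorField {c : Fin s ⊕ Fin r → O}
    (hc : ∀ h, u h ∣ c (.inl h)) {γ : Fin s → ℕ} {f : O} (hf : monomial u γ ∣ f) :
    monomial u γ ∣ hx.vectorField hd c f := by
  obtain ⟨y, rfl⟩ := hf
  choose w hw using hc
  rw [Derivation.leibniz, Derivation.map_monomial (w := w)]
  · simp only [smul_eq_mul]
    exact dvd_add (dvd_mul_right _ _) ((dvd_mul_left _ _).mul_left _)
  · intro i
    have := hx.vectorField_coord hd c (.inl i)
    rw [Sum.elim_inl] at this
    rw [this, hw, mul_comm]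

omit [Algebra ℚ O] in
theorem dvd_single_inr (j : Fin r) (h : Fin s) :
    u h ∣ (Pi.single (.inr j) 1 : Fin s ⊕ Fin r → O) (.inl h) := by
  simp

theorem dvd_euler (w : Fin s ⊕ Fin r → ℚ) (h : Fin s) :
    u h ∣ euler (Sum.elim u v) w (.inl h) := by
  rw [euler, Sum.elim_inl, Algebra.smul_def]
  exact dvd_mul_left _ _

namespace MonomialExponents

variable {l l' : ℕ} (A : MonomialExponents s r l l')

theorem euler_fn_inl (w : Fin s → ℚ) (i : Fin l) :
    hx.vectorField hd (euler (Sum.elim u v) (A.weight w)) (A.fn u v (.inl i)) =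
      (∑ h, A.α i h * w h) • monomial u (A.α i) := by
  simp [fn, hx.euler_monomial hd, weight]

theorem euler_fn_inr (w : Fin s → ℚ) (j : Fin l') :
    hx.vectorField hd (euler (Sum.elim u v) (A.weight w)) (A.fn u v (.inr j)) = 0 := by
  have h1 := hx.vectorField_coord hd (euler (Sum.elim u v) (A.weight w)) (.inr (A.idx j))
  rw [Sum.elim_inr, euler, Sum.elim_inr, weight_idx] at h1
  rw [fn, Sum.elim_inr, Derivation.leibniz, hx.euler_monomial hd, h1]
  simp only [Algebra.smul_def, weight, Sum.elim_inl, map_neg, Algebra.algebraMap_self,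
    RingHom.id_apply]
  ring

theorem partialDeriv_fn_inr (j : Fin r) (j' : Fin l') :
    hx.partialDeriv hd (.inr j) (A.fn u v (.inr j')) =
      if A.idx j' = j then monomial u (A.β j') else 0 := by
  rw [fn, Sum.elim_inr, Derivation.leibniz, hx.partialDeriv_inr_monomial hd,
    hx.partialDeriv_inr_inr hd]
  by_cases h : j = A.idx j'
  · simp [h]
  · simp [h, Ne.symm h]

/-- The coefficients of the vector fields dual to the differential monomials, for weights `lam`
dual to the exponents `α_i`. -/
def dualCol (u : Fin s → O) (v : Fin r → O) (lam : Fin l → Fin s → ℚ) :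
    Fin l ⊕ Fin l' → Fin s ⊕ Fin r → O :=
  Sum.elim (fun i => euler (Sum.elim u v) (A.weight (lam i)))
    (fun j => Pi.single (.inr (A.idx j)) 1)

/-- The coefficients of the logarithmic vector fields which annihilate the differential
monomials: Euler fields for weights orthogonal to all `α_i`, and `∂/∂v_j` for the remaining `j`. -/
def annCol (u : Fin s → O) (v : Fin r → O) : Set (Fin s ⊕ Fin r → O) :=
  {c | ∃ w : Fin s → ℚ, (∀ i, ∑ h, A.α i h * w h = 0) ∧
    c = euler (Sum.elim u v) (A.weight w)} ∪
  {c | ∃ j, j ∉ Set.range A.idx ∧ c = Pi.single (.inr j) 1}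

theorem dvd_dualCol (lam : Fin l → Fin s → ℚ) (p : Fin l ⊕ Fin l') (h : Fin s) :
    u h ∣ A.dualCol u v lam p (.inl h) := by
  rcases p with i | j
  · exact dvd_euler _ h
  · exact dvd_single_inr (A.idx j) h

theorem dvd_of_mem_annCol {c : Fin s ⊕ Fin r → O} (hc : c ∈ A.annCol u v) (h : Fin s) :
    u h ∣ c (.inl h) := by
  rcases hc with ⟨w, -, rfl⟩ | ⟨j, -, rfl⟩
  · exact dvd_euler _ h
  · exact dvd_single_inr _ h

theorem dualCol_fn {lam : Fin l → Fin s → ℚ}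
    (hlam : ∀ i i', ∑ h, A.α i' h * lam i h = if i = i' then 1 else 0) (p q : Fin l ⊕ Fin l') :
    hx.vectorField hd (A.dualCol u v lam q) (A.fn u v p) =
      if p = q then monomial u (A.exp p) else 0 := by
  rcases q with i | j <;> rcases p with i' | j'
  · rw [dualCol, Sum.elim_inl, A.euler_fn_inl hx hd, hlam]
    by_cases h : i = i'
    · subst h; simp [exp]
    · simp [h, Ne.symm h]
  · rw [dualCol, Sum.elim_inl, A.euler_fn_inr hx hd]
    simp
  · rw [dualCol, Sum.elim_inr, hx.vectorField_single hd, fn, Sum.elim_inl,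
      hx.partialDeriv_inr_monomial hd]
    simp
  · rw [dualCol, Sum.elim_inr, hx.vectorField_single hd, A.partialDeriv_fn_inr hx hd, one_mul]
    simp [A.idx_injective.eq_iff, exp]

theorem annCol_fn {c : Fin s ⊕ Fin r → O} (hc : c ∈ A.annCol u v) (p : Fin l ⊕ Fin l') :
    hx.vectorField hd c (A.fn u v p) = 0 := by
  rcases hc with ⟨w, hw, rfl⟩ | ⟨j, hj, rfl⟩ <;> rcases p with i' | j'
  · rw [A.euler_fn_inl hx hd, hw, zero_smul]
  · exact A.euler_fn_inr hx hd w j'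
  · rw [hx.vectorField_single hd, fn, Sum.elim_inl, hx.partialDeriv_inr_monomial hd, mul_zero]
  · rw [hx.vectorField_single hd, A.partialDeriv_fn_inr hx hd, if_neg fun h => hj ⟨j', h⟩, mul_zero]

/-- The Euler fields dual to the monomials `u^α_i`, the fields `∂/∂v_{idx j}`, and the fields
annihilating the differential monomials together generate all logarithmic vector fields. -/
theorem span_cols {lam : Fin l → Fin s → ℚ}
    (hlam : ∀ i i', ∑ h, A.α i' h * lam i h = if i = i' then 1 else 0) :
    Submodule.span O (Set.range (A.dualCol u v lam) ∪ A.annCol u v) =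
      Submodule.span O (Set.range (logCol u)) := by
  classical
  refine le_antisymm (Submodule.span_le.2 ?_) (Submodule.span_le.2 ?_)
  · rintro c (⟨p, rfl⟩ | hc)
    · exact mem_span_logCol _ (A.dvd_dualCol lam p)
    · exact mem_span_logCol _ (A.dvd_of_mem_annCol hc)
  · set L := Submodule.span O (Set.range (A.dualCol u v lam) ∪ A.annCol u v) with hL
    have hv : ∀ j, (Pi.single (.inr j) 1 : Fin s ⊕ Fin r → O) ∈ L := by
      intro j
      by_cases hj : j ∈ Set.range A.idx
      · obtain ⟨j', rfl⟩ := hj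
        exact Submodule.subset_span (.inl ⟨.inr j', rfl⟩)
      · exact Submodule.subset_span (.inr (.inr ⟨j, hj, rfl⟩))
    rintro _ ⟨h | j, rfl⟩
    · -- subtract from the weight `e_h` its component along the weights `lam`
      let w : Fin s → ℚ := Pi.single h 1 - ∑ i, (A.α i h : ℚ) • lam i
      have hw : ∀ i, ∑ h, A.α i h * w h = 0 := by
        intro i
        have h1 : ∑ h', (A.α i h' : ℚ) * ∑ i', (A.α i' h : ℚ) * lam i' h' = A.α i h := by
          simp only [Finset.mul_sum]
          rw [Finset.sum_comm]
          have : ∀ i', ∑ h', (A.α i h' : ℚ) * ((A.α i' h : ℚ) * lam i' h') =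
              A.α i' h * if i' = i then 1 else 0 := by
            intro i'
            rw [← hlam i' i, Finset.mul_sum]
            exact Finset.sum_congr rfl fun _ _ => by ring
          simp [this]
        simp only [w, Pi.sub_apply, Finset.sum_apply, Pi.smul_apply, smul_eq_mul, mul_sub,
          Finset.sum_sub_distrib, h1]
        simp [Pi.single_apply]
      have h1 : euler (Sum.elim u v) (A.weight w) ∈ L :=
        Submodule.subset_span (.inr (.inl ⟨w, hw, rfl⟩))
      have h2 : ∑ i, (A.α i h : O) • euler (Sum.elim u v) (A.weight (lam i)) ∈ L :=
        Submodule.sum_mem _ fun i _ => Submodule.smul_mem _ _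
          (Submodule.subset_span (.inl ⟨.inl i, rfl⟩))
      set y := logCol u (.inl h) - (euler (Sum.elim u v) (A.weight w) +
        ∑ i, (A.α i h : O) • euler (Sum.elim u v) (A.weight (lam i))) with hy
      -- what remains is a combination of the `∂/∂v_j`
      have h3 : y ∈ L := by
        have h4 : ∀ h', y (.inl h') = 0 := by
          intro h'
          have h5 : algebraMap ℚ O (w h') = (if h' = h then 1 else 0) -
              ∑ i, (A.α i h : O) * algebraMap ℚ O (lam i h') := by
            simp only [w, Pi.sub_apply, Finset.sum_apply, Pi.smul_apply, smul_eq_mul, map_sub,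
              _root_.map_sum, _root_.map_mul, map_natCast, Pi.single_apply]
            split_ifs <;> simp
          have he : ∀ w', euler (Sum.elim u v) (A.weight w') (.inl h') =
              algebraMap ℚ O (w' h') * u h' := fun w' => by
            rw [euler, Algebra.smul_def]; rfl
          simp only [hy, Pi.sub_apply, Pi.add_apply, Finset.sum_apply, Pi.smul_apply, he, h5,
            logCol, smul_eq_mul, Sum.elim_inl, Pi.single_apply, Sum.inl.injEq, sub_mul,
            Finset.sum_mul, mul_assoc]
          split_ifs with hh
          · subst hh; simp
          · simp
        have h5 : y = ∑ j, y (.inr j) • (Pi.single (.inr j) 1 : Fin s ⊕ Fin r → O) := by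
          ext (h' | j)
          · simp [h4, Finset.sum_apply]
          · simp [Finset.sum_apply, Pi.single_apply]
        rw [h5]
        exact Submodule.sum_mem _ fun j _ => Submodule.smul_mem _ _ (hv j)
      have := L.add_mem h3 (L.add_mem h1 h2)
      rwa [hy, sub_add_cancel] at this
    · exact hv j

end MonomialExponents

end EulerFields

end HsiangPati

namespace HsiangPati

/-! ### Log minors of functions in Hsiang-Pati form -/

section Decomposition

variable {O Ω ι : Type*} [CommRing O] [AddCommGroup Ω] [Module O Ω]

/-- The functions `f_m` are in Hsiang-Pati form with respect to the coordinates `(u, v)` and the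
differential monomials with exponents `A`: `f_m = g_m + u^μ T_m` where `d g_m` is a combination of
the differential monomials, which are themselves combinations of the `d f_m`. -/
structure IsDecomposition (d : O → Ω) {s r l l' N : ℕ} (A : MonomialExponents s r l l')
    (u : Fin s → O) (v : Fin r → O) (μ : Fin s → ℕ) (f g T : Fin N → O) : Prop where
  exp_le : ∀ p, A.exp p ≤ μ
  d_g : ∀ m, d (g m) ∈ Submodule.span O (Set.range fun p => d (A.fn u v p))
  d_fn : ∀ p, d (A.fn u v p) ∈ Submodule.span O (Set.range fun m => d (f m))
  eq : ∀ m, f m = g m + monomial u μ * T m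

variable [Algebra ℚ O] {d : O → Ω} {eqn : ι → O → Prop} {s r l l' N : ℕ}
  {A : MonomialExponents s r l l'} {u : Fin s → O} {v : Fin r → O} {μ : Fin s → ℕ}
  {f g T : Fin N → O}

/-- The gradients of functions in Hsiang-Pati form, paired with the logarithmic vector fields, have
a diagonal form whose diagonal entries are the monomials `u^α_i`, `u^β_j`. The complementary block
consists of the derivatives of the remainders along the fields annihilating the differential
monomials. -/
theorem IsDecomposition.exists_isDiagonalForm (h : IsDecomposition d A u v μ f g T)
    (hx : IsCoordinateSystem d (Sum.elim u v)) (hd : IsExteriorDerivative d) :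
    ∃ (W D : Fin l ⊕ Fin l' → Fin s ⊕ Fin r → O) (S : Set (Fin s ⊕ Fin r → O)),
      IsDiagonalForm W D S (A.annCol u v) (fun p => monomial u (A.exp p)) (monomial u μ) ∧
      (∀ j, logMinors hd hx f j =
        minorIdeal (Set.range W ∪ S) (Set.range D ∪ A.annCol u v) j) ∧
      {x | ∃ ρ ∈ S, ∃ F ∈ A.annCol u v, x = ρ ⬝ᵥ F} =
        {x | ∃ m, ∃ F ∈ A.annCol u v, x = hx.vectorField hd F (monomial u μ * T m)} := by
  obtain ⟨lam, hlam⟩ := A.exists_dual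
  let W : Fin l ⊕ Fin l' → Fin s ⊕ Fin r → O := fun p => hx.grad hd (A.fn u v p)
  let D := A.dualCol u v lam
  have hdvd : ∀ m p, monomial u (A.exp p) ∣ hx.vectorField hd (D p) (monomial u μ * T m) :=
    fun m p => (monomial_dvd_monomial u (h.exp_le p)).trans
      (hx.monomial_dvd_vectorField hd (A.dvd_dualCol lam p) (dvd_mul_right _ _))
  -- the gradients of the remainders, made orthogonal to the dual vector fields
  choose a ha using hdvd
  let ρ : Fin N → Fin s ⊕ Fin r → O := fun m =>
    hx.grad hd (monomial u μ * T m) - ∑ p, a m p • W p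
  have hρ : ∀ m c, ρ m ⬝ᵥ c = hx.vectorField hd c (monomial u μ * T m) -
      ∑ p, a m p * hx.vectorField hd c (A.fn u v p) := by
    intro m c
    simp only [ρ, W, sub_dotProduct, sum_dotProduct, smul_dotProduct, hx.grad_dotProduct,
      smul_eq_mul]
  have hann : ∀ m, ∀ F ∈ A.annCol u v,
      ρ m ⬝ᵥ F = hx.vectorField hd F (monomial u μ * T m) := by
    intro m F hF
    rw [hρ]
    simp [A.annCol_fn hx hd hF]
  refine ⟨W, D, Set.range ρ, ⟨fun p q => ?_, fun p F hF => ?_, ?_, ?_, fun p => ?_⟩,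
    fun j => ?_, ?_⟩
  · rw [hx.grad_dotProduct]
    exact A.dualCol_fn hx hd hlam p q
  · rw [hx.grad_dotProduct]
    exact A.annCol_fn hx hd hF p
  · rintro _ ⟨m, rfl⟩ q
    rw [hρ, ha]
    simp [D, A.dualCol_fn hx hd hlam, mul_comm]
  · rintro _ ⟨m, rfl⟩ F hF
    rw [hann m F hF]
    exact hx.monomial_dvd_vectorField hd (A.dvd_of_mem_annCol hF) (dvd_mul_right _ _)
  · exact monomial_dvd_monomial u (h.exp_le p)
  · refine minorIdeal_eq_of_span_eq ?_ (A.span_cols hlam).symm j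
    have hW : ∀ p, W p ∈ Submodule.span O (Set.range W ∪ Set.range ρ) := fun p =>
      Submodule.subset_span (.inl ⟨p, rfl⟩)
    have hg : ∀ m, hx.grad hd (g m) ∈ Submodule.span O (Set.range W) := fun m =>
      hx.grad_mem_span hd (h.d_g m)
    have hf : ∀ m, hx.grad hd (f m) = hx.grad hd (g m) + (ρ m + ∑ p, a m p • W p) := by
      intro m
      rw [sub_add_cancel, h.eq m]
      ext i
      simp [IsCoordinateSystem.grad]
    refine le_antisymm (Submodule.span_le.2 ?_) (Submodule.span_le.2 (Set.union_subset ?_ ?_))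
    · rintro _ ⟨m, rfl⟩
      dsimp only
      rw [hf]
      exact Submodule.add_mem _ (Submodule.span_mono Set.subset_union_left (hg m))
        (Submodule.add_mem _ (Submodule.subset_span (.inr ⟨m, rfl⟩))
          (Submodule.sum_mem _ fun p _ => Submodule.smul_mem _ _ (hW p)))
    · rintro _ ⟨p, rfl⟩
      exact hx.grad_mem_span hd (h.d_fn p)
    · have hWf : Submodule.span O (Set.range W) ≤
          Submodule.span O (Set.range fun m => hx.grad hd (f m)) := by
        rw [Submodule.span_le]
        rintro _ ⟨p, rfl⟩
        exact hx.grad_mem_span hd (h.d_fn p)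
      rintro _ ⟨m, rfl⟩
      have : ρ m = hx.grad hd (f m) - hx.grad hd (g m) - ∑ p, a m p • W p := by
        rw [hf]; abel
      rw [this]
      exact Submodule.sub_mem _ (Submodule.sub_mem _ (Submodule.subset_span ⟨m, rfl⟩)
        (hWf (hg m))) (Submodule.sum_mem _ fun p _ => Submodule.smul_mem _ _
          (hWf (Submodule.subset_span ⟨p, rfl⟩)))
  · ext x
    constructor
    · rintro ⟨_, ⟨m, rfl⟩, F, hF, rfl⟩
      exact ⟨m, F, hF, hann m F hF⟩
    · rintro ⟨m, F, hF, rfl⟩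
      exact ⟨_, ⟨m, rfl⟩, F, hF, (hann m F hF).symm⟩

/-- In a totally ordered family of exponents there are subfamilies of any size which consist of the
smallest exponents. -/
theorem exists_smallest {P : Type*} [Fintype P] (ε : P → Fin s → ℕ)
    (hε : ∀ p q, ε p ≤ ε q ∨ ε q ≤ ε p) (j : ℕ) (hj : j ≤ Fintype.card P) :
    ∃ J : Finset P, J.card = j ∧ ∀ p ∈ J, ∀ q ∉ J, ε p ≤ ε q := by
  classical
  induction j with
  | zero => exact ⟨∅, rfl, by simp⟩
  | succ j ih =>
    obtain ⟨J, hJ, hJ'⟩ := ih (by omega)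
    have hne : (Jᶜ).Nonempty := by
      rw [← Finset.card_pos, Finset.card_compl]
      omega
    obtain ⟨q, hq, hmin⟩ := Finset.exists_min_image Jᶜ (fun p => ∑ h, ε p h) hne
    rw [Finset.mem_compl] at hq
    refine ⟨insert q J, by rw [Finset.card_insert_of_notMem hq, hJ], fun p hp q' hq' => ?_⟩
    rw [Finset.mem_insert, not_or] at hq'
    rcases Finset.mem_insert.1 hp with rfl | hp
    · have h1 := hmin q' (Finset.mem_compl.2 hq'.2)
      rcases hε p q' with h2 | h2
      · exact h2
      · have h3 : ∀ h, ε q' h ≤ ε p h := h2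
        intro h
        exact ((Finset.sum_eq_sum_iff_of_le fun h _ => h3 h).1
          (le_antisymm (Finset.sum_le_sum fun h _ => h3 h) h1) h (Finset.mem_univ h)).ge
    · exact hJ' p hp q' hq'.2

/-- The ideal of log minors of order `j` of functions in Hsiang-Pati form is generated by a
monomial, whose exponent is the sum of the `j` smallest exponents. -/
theorem IsDecomposition.exists_logMinors_eq (h : IsDecomposition d A u v μ f g T)
    (hx : IsCoordinateSystem d (Sum.elim u v)) (hd : IsExteriorDerivative d)
    (hA : ∀ p q, A.exp p ≤ A.exp q ∨ A.exp q ≤ A.exp p) {j : ℕ} (hj : j ≤ l + l') :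
    ∃ γ, logMinors hd hx f j = Ideal.span {monomial u γ} := by
  obtain ⟨J, rfl, hJ⟩ := exists_smallest A.exp hA j (by simpa using hj)
  obtain ⟨W, D, S, hdiag, hminors, -⟩ := h.exists_isDiagonalForm hx hd
  refine ⟨∑ p ∈ J, A.exp p, ?_⟩
  rw [hminors, monomial_sum]
  exact hdiag.minorIdeal_eq J fun p hp q hq => monomial_dvd_monomial u (hJ p hp q hq)

/-- If the log minors of order one more than the number of differential monomials generate a
monomial ideal, then the derivatives of the remainders `u^μ T_m` along the vector fields annihilating
the differential monomials generate a monomial ideal `(u^δ)`. -/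
theorem IsDecomposition.exists_exponent [IsLocalRing O] (h : IsDecomposition d A u v μ f g T)
    (hM : IsLogModel d eqn) (hx : IsCoordinateSystem d (Sum.elim u v)) {γ : Fin s → ℕ}
    (hγ : logMinors hM.isExteriorDerivative hx f (l + l' + 1) = Ideal.span {monomial u γ}) :
    ∃ δ, μ ≤ δ ∧ (∀ m, ∀ F ∈ A.annCol u v, monomial u δ ∣
        hx.vectorField hM.isExteriorDerivative F (monomial u μ * T m)) ∧
      ∃ m, ∃ F ∈ A.annCol u v, ∃ ξ, IsUnit ξ ∧
        hx.vectorField hM.isExteriorDerivative F (monomial u μ * T m) = monomial u δ * ξ := by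
  obtain ⟨W, D, S, hdiag, hminors, hset⟩ := h.exists_isDiagonalForm hx hM.isExteriorDerivative
  have h1 := hdiag.minorIdeal_succ_eq
  rw [show Fintype.card (Fin l ⊕ Fin l') = l + l' by simp, ← hminors, hγ, ← monomial_sum, hset]
    at h1
  set ε₀ := ∑ p, A.exp p with hε
  set Y := {x | ∃ m, ∃ F ∈ A.annCol u v,
    x = hx.vectorField hM.isExteriorDerivative F (monomial u μ * T m)} with hY
  -- `(u^γ) = (u^ε₀) · (Y)`, hence `Y` generates `u^δ` with `γ = ε₀ + δ`
  obtain ⟨y, hy, hy'⟩ : ∃ y ∈ Ideal.span Y, monomial u ε₀ * y = monomial u γ := by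
    have : monomial u γ ∈ Ideal.span {monomial u ε₀} * Ideal.span Y :=
      h1 ▸ Ideal.mem_span_singleton_self _
    exact Ideal.mem_span_singleton_mul.1 this
  have hle : ε₀ ≤ γ := hM.le_of_monomial_dvd_monomial hx ⟨y, hy'.symm⟩
  obtain ⟨δ, rfl⟩ := exists_add_of_le hle
  have hyδ : y = monomial u δ := hM.monomial_mul_cancel hx ε₀ (by rw [hy', monomial_add])
  have hdvd : ∀ x ∈ Y, monomial u δ ∣ x := by
    intro x hx'
    have : monomial u ε₀ * x ∈ Ideal.span {monomial u (ε₀ + δ)} := by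
      rw [h1]
      exact Ideal.mul_mem_mul (Ideal.mem_span_singleton_self _) (Ideal.subset_span hx')
    obtain ⟨c, hc⟩ := Ideal.mem_span_singleton.1 this
    rw [monomial_add, mul_assoc] at hc
    exact ⟨c, hM.monomial_mul_cancel hx ε₀ hc⟩
  refine ⟨δ, ?_, fun m F hF => hdvd _ ⟨m, F, hF, rfl⟩, ?_⟩
  · refine hM.le_of_monomial_dvd_monomial hx (Ideal.mem_span_singleton.1 ?_)
    rw [← hyδ]
    refine Ideal.span_le.2 ?_ hy
    rintro _ ⟨m, F, hF, rfl⟩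
    exact Ideal.mem_span_singleton.2
      (hx.monomial_dvd_vectorField _ (A.dvd_of_mem_annCol hF) (dvd_mul_right _ _))
  · by_contra! hno
    -- otherwise all the derivatives lie in `u^δ` times the maximal ideal
    have : Ideal.span Y ≤ Ideal.span {monomial u δ} * IsLocalRing.maximalIdeal O := by
      rw [Ideal.span_le]
      rintro _ ⟨m, F, hF, rfl⟩
      obtain ⟨ξ, hξ⟩ := hdvd _ ⟨m, F, hF, rfl⟩
      rw [hξ]
      refine Ideal.mul_mem_mul (Ideal.mem_span_singleton_self _) ?_
      rw [IsLocalRing.mem_maximalIdeal]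
      exact fun hu => hno m F hF ξ hu hξ
    obtain ⟨z, hz, hz'⟩ := Ideal.mem_span_singleton_mul.1 (this hy)
    have h2 : z = 1 := hM.monomial_mul_cancel hx δ (by rw [hz', hyδ, mul_one])
    rw [IsLocalRing.mem_maximalIdeal, h2] at hz
    exact hz isUnit_one

end Decomposition

end HsiangPati

namespace HsiangPati

/-! ### Hsiang-Pati form of order `k` and its extension to order `k + 1` -/

section PartialForm

theorem IsCoordinateSystem.comp_equiv {O Ω κ κ' : Type*} [CommRing O] [AddCommGroup Ω] [Module O Ω]
    {d : O → Ω} {x : κ → O} (hx : IsCoordinateSystem d x) (e : κ' ≃ κ) :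
    IsCoordinateSystem d (x ∘ e) where
  vanish i := hx.vanish _
  linearIndependent := hx.linearIndependent.comp e e.injective
  span f := by
    have : Set.range (fun i => d ((x ∘ e) i)) = Set.range fun i => d (x i) :=
      e.surjective.range_comp fun i => d (x i)
    rw [this]
    exact hx.span f

variable {O Ω ι : Type*} [CommRing O] [AddCommGroup Ω] [Module O Ω] {d : O → Ω}

/-- The functions `f_m` are in Hsiang-Pati form of order `k` with respect to the coordinates `(u, v)`
and the differential monomials with exponents `A`, up to a permutation of the `f_m` and of the `v_j`,
and without the requirement that the bound `μ` of the exponents be attained. The differential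
monomials generate the same module as `d f_{τ 1}, …, d f_{τ k}`. -/
structure IsPartialForm (d : O → Ω) {s r l l' N k : ℕ} (A : MonomialExponents s r l l')
    (u : Fin s → O) (v : Fin r → O) (μ : Fin s → ℕ) (f g T : Fin N → O) (τ : Fin k → Fin N) :
    Prop where
  exp_le : ∀ p, A.exp p ≤ μ
  d_g : ∀ m, d (g m) ∈ Submodule.span O (Set.range fun p => d (A.fn u v p))
  eq : ∀ m, f m = g m + monomial u μ * T m
  card : l + l' = k
  total : ∀ p q, A.exp p ≤ A.exp q ∨ A.exp q ≤ A.exp p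
  injective : Function.Injective τ
  span_rows : Submodule.span O (Set.range fun i => d (f (τ i))) =
    Submodule.span O (Set.range fun p => d (A.fn u v p))

variable {s r l l' N k : ℕ} {A : MonomialExponents s r l l'} {u : Fin s → O} {v : Fin r → O}
  {μ : Fin s → ℕ} {f g T : Fin N → O} {τ : Fin k → Fin N}

theorem IsPartialForm.isDecomposition (h : IsPartialForm d A u v μ f g T τ) :
    IsDecomposition d A u v μ f g T where
  exp_le := h.exp_le
  d_g := h.d_g
  eq := h.eq
  d_fn p := by
    have : d (A.fn u v p) ∈ Submodule.span O (Set.range fun i => d (f (τ i))) := by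
      rw [h.span_rows]
      exact Submodule.subset_span ⟨p, rfl⟩
    refine Submodule.span_mono ?_ this
    rintro _ ⟨i, rfl⟩
    exact ⟨τ i, rfl⟩

theorem exists_equiv_extend {k N : ℕ} (τ : Fin k → Fin N) (hτ : Function.Injective τ)
    (hk : k ≤ N) : ∃ π : Fin N ≃ Fin N, ∀ i, π (Fin.castLE hk i) = τ i := by
  let e : Set.range (Fin.castLE hk) ≃ Set.range τ :=
    (Equiv.ofInjective _ (Fin.castLE_injective hk)).symm.trans (Equiv.ofInjective _ hτ)
  refine ⟨e.extendSubtype, fun i => ?_⟩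
  rw [Equiv.extendSubtype_apply_of_mem _ _ ⟨i, rfl⟩]
  simp [e, Equiv.ofInjective_symm_apply]

/-- Renumbering the functions and the coordinates turns a partial form into coordinates as
required. -/
theorem IsPartialForm.hasHsiangPatiForm {P Θ : Type*} [CommRing P] [AddCommGroup Θ] [Module P Θ]
    {dP : P → Θ} {φ : P → O} {eqn : ι → O → Prop} {z : Fin N → P} (hz : IsCoordinateSystem dP z)
    (huv : IsAdapted d eqn u v) (h : IsPartialForm d A u v μ (fun m => φ (z m)) g T τ)
    (hμ : μ ∈ Set.range A.exp) : HasHsiangPatiForm d eqn dP φ N k := by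
  have hr : l' ≤ r := by simpa using Fintype.card_le_of_injective _ A.idx_injective
  have hN : k ≤ N := by simpa using Fintype.card_le_of_injective _ h.injective
  obtain ⟨π, hπ⟩ := exists_equiv_extend A.idx A.idx_injective hr
  obtain ⟨ρ, hρ⟩ := exists_equiv_extend τ h.injective hN
  have hexp : Set.range A.exp = Set.range A.α ∪ Set.range A.β := by
    rw [MonomialExponents.exp, Set.Sum.elim_range]
  have hfn : Set.range (fun p => d (A.fn u v p)) =
      Set.range (fun i => d (monomial u (A.α i))) ∪
          Set.range (fun j => d (monomial u (A.β j) * (v ∘ π) (Fin.castLE hr j))) := by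
    rw [← Set.Sum.elim_range]
    congr 1
    ext (i | j)
    · rfl
    · simp [MonomialExponents.fn, hπ]
  refine ⟨s, r, u, v ∘ π, z ∘ ρ, ⟨?_, huv.components⟩, hz.comp_equiv ρ, l, l', h.card, hr,
    A.α, A.β, μ, _, rfl, ?_, A.linearIndependent, ?_, ⟨hexp ▸ hμ, ?_⟩, ?_⟩
  · have := huv.coordinates.comp_equiv (Equiv.sumCongr (Equiv.refl _) π)
    convert this using 1
    ext (i | j) <;> rfl
  · rw [← hfn, ← h.span_rows]
    congr 1
    ext η
    constructor
    · rintro ⟨m, hm, rfl⟩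
      refine ⟨⟨m, hm⟩, ?_⟩
      change d (φ (z (τ ⟨m, hm⟩))) = d (φ (z (ρ m)))
      rw [← hρ]
      rfl
    · rintro ⟨i, rfl⟩
      exact ⟨Fin.castLE hN i, i.2, by simp [hρ]⟩
  · rw [← hexp]
    rintro _ ⟨p, rfl⟩ _ ⟨q, rfl⟩ _
    exact h.total p q
  · rw [← hexp]
    rintro _ ⟨p, rfl⟩
    exact h.exp_le p
  · intro m _
    refine ⟨g (ρ m), monomial u μ * T (ρ m), h.eq (ρ m), ?_, dvd_mul_right _ _⟩
    have := h.d_g (ρ m)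
    rw [← h.span_rows] at this
    refine Submodule.span_mono ?_ this
    rintro _ ⟨i, rfl⟩
    exact ⟨Fin.castLE hN i, i.2, by simp [hρ]⟩

/-- The log minors of order `j ≤ k` of a morphism in Hsiang-Pati form are monomial. -/
theorem HasHsiangPatiForm.exists_logMinors_eq [Algebra ℚ O] {P Θ : Type*} [CommRing P]
    [AddCommGroup Θ] [Module P Θ] {dP : P → Θ} {φ : P → O} {eqn : ι → O → Prop}
    (h : HasHsiangPatiForm d eqn dP φ N k) (hd : IsExteriorDerivative d) :
    ∃ (s r : ℕ) (u : Fin s → O) (v : Fin r → O) (huv : IsAdapted d eqn u v) (z : Fin N → P),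
      IsCoordinateSystem dP z ∧ ∀ j ≤ k, ∃ γ,
        logMinors hd huv.coordinates (fun m => φ (z m)) j = Ideal.span {monomial u γ} := by
  obtain ⟨s, r, u, v, z, huv, hz, l, l', hk, hr, α, β, μ, M, hM, hM', hα, hchain, hμ, hg⟩ := h
  refine ⟨s, r, u, v, huv, z, hz, fun j hj => ?_⟩
  let A : MonomialExponents s r l l' := ⟨α, β, Fin.castLE hr, Fin.castLE_injective hr, hα⟩
  have hexp : Set.range A.exp = Set.range α ∪ Set.range β := by
    rw [MonomialExponents.exp, Set.Sum.elim_range]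
  have hfn : M = Submodule.span O (Set.range fun p => d (A.fn u v p)) := by
    rw [hM', ← Set.Sum.elim_range]
    congr 2
    ext (i | j) <;> rfl
  have : ∀ m : Fin N, ∃ g T : O, φ (z m) = g + monomial u μ * T ∧ d g ∈ M := by
    intro m
    by_cases hm : (m : ℕ) < k
    · refine ⟨φ (z m), 0, by simp, ?_⟩
      rw [hM]
      exact Submodule.subset_span ⟨m, hm, rfl⟩
    · obtain ⟨g, S, h1, h2, T, rfl⟩ := hg m (not_lt.1 hm)
      exact ⟨g, T, h1, h2⟩
  choose g T h1 h2 using this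
  have hdec : IsDecomposition d A u v μ (fun m => φ (z m)) g T :=
    { exp_le := fun p => hμ.2 (hexp ▸ Set.mem_range_self p)
      d_g := fun m => hfn ▸ h2 m
      d_fn := fun p => by
        have : d (A.fn u v p) ∈ M := by
          rw [hfn]
          exact Submodule.subset_span ⟨p, rfl⟩
        rw [hM] at this
        refine Submodule.span_mono ?_ this
        rintro _ ⟨m, _, rfl⟩
        exact ⟨m, rfl⟩
      eq := h1 }
  refine hdec.exists_logMinors_eq huv.coordinates hd (fun p q => ?_) (by omega)
  by_cases hpq : A.exp p = A.exp q
  · exact .inl hpq.le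
  · exact hchain (hexp ▸ Set.mem_range_self p) (hexp ▸ Set.mem_range_self q) hpq

/-- A partial form is extended by a differential monomial `d y` of exponent `μ`, when `d f_{m₀}` is
a unit times `d y`, modulo the module generated by the differential monomials already present. -/
theorem IsPartialForm.succ (h : IsPartialForm d A u v μ f g T τ) {n n' : ℕ}
    (A' : MonomialExponents s r n n') (hcard : n + n' = k + 1) {y : O}
    (hfn : Set.range (A'.fn u v) = insert y (Set.range (A.fn u v)))
    (hexp : Set.range A'.exp = insert μ (Set.range A.exp)) {m₀ : Fin N} (hm₀ : m₀ ∉ Set.range τ)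
    {e : O} (he : IsUnit e)
    (hy : d (f m₀) - e • d y ∈ Submodule.span O (Set.range fun p => d (A.fn u v p))) :
    IsPartialForm d A' u v μ f g T (Fin.snoc τ m₀ : Fin (k + 1) → Fin N) := by
  have hspan : Submodule.span O (Set.range fun p => d (A'.fn u v p)) =
      Submodule.span O {d y} ⊔ Submodule.span O (Set.range fun p => d (A.fn u v p)) := by
    have : (Set.range fun p => d (A'.fn u v p)) = insert (d y) (Set.range fun p => d (A.fn u v p)) := by
      have h1 := Set.range_comp d (A'.fn u v)
      have h2 := Set.range_comp d (A.fn u v)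
      simp only [Function.comp_def] at h1 h2
      rw [h1, h2, hfn, Set.image_insert_eq]
    rw [this, Submodule.span_insert]
  have hmem : ∀ p, A'.exp p = μ ∨ ∃ q, A'.exp p = A.exp q := by
    intro p
    have : A'.exp p ∈ insert μ (Set.range A.exp) := hexp ▸ Set.mem_range_self p
    rcases this with h1 | ⟨q, hq⟩
    · exact .inl h1
    · exact .inr ⟨q, hq.symm⟩
  have hle : ∀ p, A'.exp p ≤ μ := by
    intro p
    rcases hmem p with h1 | ⟨q, hq⟩
    · exact h1.le
    · exact hq ▸ h.exp_le q
  refine ⟨hle, fun m => hspan ▸ Submodule.mem_sup_right (h.d_g m), h.eq, hcard, fun p q => ?_,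
    Fin.snoc_injective_iff.2 ⟨h.injective, hm₀⟩, ?_⟩
  · rcases hmem p with hp | ⟨p', hp⟩
    · exact .inr (hp ▸ hle q)
    · rcases hmem q with hq | ⟨q', hq⟩
      · exact .inl (hq ▸ hle p)
      · rw [hp, hq]
        exact h.total p' q'
  · have h1 : (Set.range fun i => d (f ((Fin.snoc τ m₀ : Fin (k + 1) → Fin N) i))) =
        insert (d (f m₀)) (Set.range fun i => d (f (τ i))) := by
      have h2 := Set.range_comp (fun m => d (f m)) (Fin.snoc τ m₀ : Fin (k + 1) → Fin N)
      have h3 := Set.range_comp (fun m => d (f m)) τ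
      simp only [Function.comp_def] at h2 h3
      rw [h2, h3, Fin.range_snoc, Set.image_insert_eq]
    rw [h1, Submodule.span_insert, h.span_rows, hspan]
    set M := Submodule.span O (Set.range fun p => d (A.fn u v p))
    refine le_antisymm (sup_le ?_ le_sup_right) (sup_le ?_ le_sup_right)
    · rw [Submodule.span_singleton_le_iff_mem, ← sub_add_cancel (d (f m₀)) (e • d y)]
      exact Submodule.add_mem _ (Submodule.mem_sup_right hy)
        (Submodule.smul_mem _ _ (Submodule.mem_sup_left (Submodule.mem_span_singleton_self _)))
    · rw [Submodule.span_singleton_le_iff_mem]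
      obtain ⟨e, rfl⟩ := he
      have : d y = (↑e⁻¹ : O) • (d (f m₀) - (d (f m₀) - (e : O) • d y)) := by
        rw [sub_sub_cancel, smul_smul, Units.inv_mul, one_smul]
      rw [this]
      exact Submodule.smul_mem _ _ (Submodule.sub_mem _
        (Submodule.mem_sup_left (Submodule.mem_span_singleton_self _))
        (Submodule.mem_sup_right hy))

namespace MonomialExponents

/-- One more monomial `u^δ`. -/
def snocLeft (A : MonomialExponents s r l l') (δ : Fin s → ℕ)
    (hδ : (fun h => (δ h : ℚ)) ∉ Submodule.span ℚ (Set.range fun i h => (A.α i h : ℚ))) :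
    MonomialExponents s r (l + 1) l' where
  α := Fin.snoc A.α δ
  β := A.β
  idx := A.idx
  idx_injective := A.idx_injective
  linearIndependent := by
    have : (fun (i : Fin (l + 1)) (h : Fin s) => ((Fin.snoc A.α δ : Fin (l + 1) → _) i h : ℚ)) =
        Fin.snoc (fun i h => (A.α i h : ℚ)) (fun h => (δ h : ℚ)) := by
      ext i
      refine Fin.lastCases ?_ (fun i => ?_) i <;> simp
    rw [this, linearIndependent_finSnoc]
    exact ⟨A.linearIndependent, hδ⟩

/-- One more monomial `u^δ v_j`. -/
def snocRight (A : MonomialExponents s r l l') (δ : Fin s → ℕ) (j : Fin r)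
    (hj : j ∉ Set.range A.idx) : MonomialExponents s r l (l' + 1) where
  α := A.α
  β := Fin.snoc A.β δ
  idx := Fin.snoc A.idx j
  idx_injective := Fin.snoc_injective_iff.2 ⟨A.idx_injective, hj⟩
  linearIndependent := A.linearIndependent

variable (A) (δ : Fin s → ℕ) (u v)

theorem range_snoc_elim {B : Type*} {a : Fin l → B} {b : Fin l' → B} {x : B} :
    Set.range (Sum.elim (Fin.snoc a x : Fin (l + 1) → B) b) = insert x (Set.range (Sum.elim a b)) ∧
    Set.range (Sum.elim a (Fin.snoc b x : Fin (l' + 1) → B)) =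
      insert x (Set.range (Sum.elim a b)) := by
  simp only [Set.Sum.elim_range, Fin.range_snoc, Set.insert_union, Set.union_insert, and_self]

theorem range_exp_snocLeft (hδ) :
    Set.range (A.snocLeft δ hδ).exp = insert δ (Set.range A.exp) :=
  range_snoc_elim.1

theorem range_exp_snocRight (j : Fin r) (hj) :
    Set.range (A.snocRight δ j hj).exp = insert δ (Set.range A.exp) :=
  range_snoc_elim.2

theorem range_fn_snocLeft (hδ) : Set.range ((A.snocLeft δ hδ).fn u v) =
    insert (monomial u δ) (Set.range (A.fn u v)) := by
  rw [fn, fn, ← range_snoc_elim.1]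
  congr 2
  ext i
  refine Fin.lastCases ?_ (fun i => ?_) i <;> simp [snocLeft]

theorem range_fn_snocRight (j : Fin r) (hj) : Set.range ((A.snocRight δ j hj).fn u v) =
    insert (monomial u δ * v j) (Set.range (A.fn u v)) := by
  rw [fn, fn, ← range_snoc_elim.2]
  congr 2
  ext i
  refine Fin.lastCases ?_ (fun i => ?_) i <;> simp [snocRight]

end MonomialExponents

end PartialForm

end HsiangPati

namespace HsiangPati

/-! ### Changes of coordinates -/

section Change

variable {O Ω ι : Type*} [CommRing O] [AddCommGroup Ω] [Module O Ω] [Algebra ℚ O]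
  {d : O → Ω}

/-- A change of coordinates with invertible Jacobian matrix. -/
theorem IsCoordinateSystem.of_isUnit_det {κ : Type*} [Fintype κ] [DecidableEq κ] {x : κ → O}
    (hx : IsCoordinateSystem d x) (hd : IsExteriorDerivative d) {x' : κ → O}
    (hx' : ∀ i, x' i ∈ nonunits O)
    (hdet : IsUnit (Matrix.of fun i j => hx.partialDeriv hd j (x' i)).det) :
    IsCoordinateSystem d x' := by
  set J : Matrix κ κ O := Matrix.of fun i j => hx.partialDeriv hd j (x' i) with hJ
  have h1 : ∀ i, d (x' i) = ∑ j, J i j • d (x j) := fun i => hx.d_eq_sum hd (x' i)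
  have hcomb : ∀ c : κ → O, ∑ i, c i • d (x' i) = ∑ j, (Matrix.vecMul c J) j • d (x j) := by
    intro c
    simp only [h1, Finset.smul_sum, Matrix.vecMul, dotProduct, Finset.sum_smul, smul_smul]
    rw [Finset.sum_comm]
  refine ⟨hx', ?_, fun f => ?_⟩
  · rw [Fintype.linearIndependent_iff]
    intro c hc
    rw [hcomb] at hc
    have h2 : Matrix.vecMul c J = 0 := funext (Fintype.linearIndependent_iff.1 hx.linearIndependent _ hc)
    have h3 : c = 0 := by
      have := congrArg (fun w => Matrix.vecMul w J⁻¹) h2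
      simpa [Matrix.vecMul_vecMul, Matrix.mul_nonsing_inv J hdet] using this
    exact fun i => congrFun h3 i
  · rw [Submodule.mem_span_range_iff_exists_fun]
    refine ⟨Matrix.vecMul (hx.grad hd f) J⁻¹, ?_⟩
    rw [hcomb, Matrix.vecMul_vecMul, Matrix.nonsing_inv_mul J hdet, Matrix.vecMul_one]
    exact (hx.d_eq_sum hd f).symm

theorem IsCoordinateSystem.mul_units [IsLocalRing O] {κ : Type*} [Fintype κ] {x : κ → O}
    (hx : IsCoordinateSystem d x) (hd : IsExteriorDerivative d) (ξ : κ → Oˣ) :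
    IsCoordinateSystem d fun i => x i * ξ i := by
  classical
  refine hx.of_isUnit_det hd (fun i => mul_mem_nonunits_left (hx.vanish i)) ?_
  rw [← IsLocalRing.residue_ne_zero_iff_isUnit, RingHom.map_det]
  have : (IsLocalRing.residue O).mapMatrix
      (Matrix.of fun i j => hx.partialDeriv hd j (x i * ξ i)) =
      Matrix.diagonal fun i => IsLocalRing.residue O (ξ i) := by
    ext i j
    have h0 : IsLocalRing.residue O (x i) = 0 :=
      (IsLocalRing.residue_eq_zero_iff _).2 (hx.vanish i)
    rw [RingHom.mapMatrix_apply, Matrix.map_apply, Matrix.of_apply, Derivation.leibniz,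
      hx.partialDeriv_coord hd, smul_eq_mul, smul_eq_mul, _root_.map_add, _root_.map_mul,
      _root_.map_mul, h0, zero_mul, zero_add, Matrix.diagonal_apply]
    by_cases h : j = i
    · subst h; simp
    · simp [h, Ne.symm h]
  rw [this, Matrix.det_diagonal, Finset.prod_ne_zero_iff]
  exact fun i _ => (IsLocalRing.residue_ne_zero_iff_isUnit _).2 (ξ i).isUnit

theorem IsCoordinateSystem.update {κ : Type*} [Fintype κ] [DecidableEq κ] {x : κ → O}
    (hx : IsCoordinateSystem d x) (hd : IsExteriorDerivative d) (i : κ) {y : O}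
    (hy : y ∈ nonunits O) (hy' : IsUnit (hx.partialDeriv hd i y)) :
    IsCoordinateSystem d (Function.update x i y) := by
  refine hx.of_isUnit_det hd (fun j => ?_) ?_
  · by_cases h : j = i
    · subst h; simpa using hy
    · simpa [h] using hx.vanish j
  · have : (Matrix.of fun i' j => hx.partialDeriv hd j (Function.update x i y i')) =
        (1 : Matrix κ κ O).updateRow i (hx.grad hd y) := by
      ext i' j
      by_cases h : i' = i
      · subst h; simp [IsCoordinateSystem.grad]
      · simp [h, hx.partialDeriv_coord hd, Matrix.one_apply, eq_comm]
    rw [this, ← Matrix.cramer_transpose_apply, Matrix.transpose_one, Matrix.cramer_one]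
    exact hy'

variable {eqn : ι → O → Prop} {s r : ℕ} {u : Fin s → O} {v : Fin r → O}

theorem IsAdapted.mul_units [IsLocalRing O] (hM : IsLogModel d eqn) (huv : IsAdapted d eqn u v)
    (ξ : Fin s → Oˣ) (ζ : Fin r → Oˣ) :
    IsAdapted d eqn (fun i => u i * ξ i) (fun j => v j * ζ j) where
  coordinates := by
    have := huv.coordinates.mul_units hM.isExteriorDerivative (Sum.elim ξ ζ)
    convert this using 1
    ext (i | j) <;> rfl
  components := by
    obtain ⟨e, he⟩ := huv.components
    exact ⟨e, fun i => hM.eqn_mul _ _ _ (he i) (ξ i).isUnit⟩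

theorem IsAdapted.update (hM : IsLogModel d eqn) (huv : IsAdapted d eqn u v) (j : Fin r) {y : O}
    (hy : y ∈ nonunits O)
    (hy' : IsUnit (huv.coordinates.partialDeriv hM.isExteriorDerivative (.inr j) y)) :
    IsAdapted d eqn u (Function.update v j y) where
  coordinates := by
    have := huv.coordinates.update hM.isExteriorDerivative (.inr j) hy hy'
    rwa [Sum.update_elim_inr] at this
  components := huv.components

/-- A vector field all of whose components are nonunits has no unit values. -/
theorem IsCoordinateSystem.vectorField_mem_nonunits [IsLocalRing O] {κ : Type*} [Fintype κ]
    {x : κ → O} (hx : IsCoordinateSystem d x) (hd : IsExteriorDerivative d) {c : κ → O}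
    (hc : ∀ i, c i ∈ nonunits O) (f : O) : hx.vectorField hd c f ∈ nonunits O := by
  rw [hx.vectorField_apply hd, ← IsLocalRing.mem_maximalIdeal]
  exact Ideal.sum_mem _ fun i _ => Ideal.mul_mem_right _ _ ((IsLocalRing.mem_maximalIdeal _).2 (hc i))

variable {l l' : ℕ} (A : MonomialExponents s r l l') (hM : IsLogModel d eqn)
  (hx : IsCoordinateSystem d (Sum.elim u v))
include hM

/-- A function annihilated by the vector fields that annihilate the differential monomials, and
divisible by all the monomials involved, has its differential in the module they generate. -/
theorem MonomialExponents.d_mem_span {g : O}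
    (hg : ∀ F ∈ A.annCol u v, hx.vectorField hM.isExteriorDerivative F g = 0)
    (hdvd : ∀ p, monomial u (A.exp p) ∣ g) :
    d g ∈ Submodule.span O (Set.range fun p => d (A.fn u v p)) := by
  have hd := hM.isExteriorDerivative
  obtain ⟨lam, hlam⟩ := A.exists_dual
  have h1 : ∀ p, monomial u (A.exp p) ∣ hx.vectorField hd (A.dualCol u v lam p) g := fun p =>
    hx.monomial_dvd_vectorField hd (A.dvd_dualCol lam p) (hdvd p)
  choose a ha using h1
  rw [Submodule.mem_span_range_iff_exists_fun]
  refine ⟨a, Eq.symm ((hx.d_eq_sum_iff hd).2 ?_)⟩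
  set η : Fin s ⊕ Fin r → O := hx.grad hd g - ∑ p, a p • hx.grad hd (A.fn u v p) with hη
  have h2 : ∀ c, η ⬝ᵥ c = hx.vectorField hd c g - ∑ p, a p * hx.vectorField hd c (A.fn u v p) := by
    intro c
    simp only [hη, sub_dotProduct, sum_dotProduct, smul_dotProduct, hx.grad_dotProduct, smul_eq_mul]
  have h3 : ∀ c ∈ Submodule.span O (Set.range (A.dualCol u v lam) ∪ A.annCol u v), η ⬝ᵥ c = 0 := by
    intro c hc
    induction hc using Submodule.span_induction with
    | mem c hc =>
      rw [h2]
      rcases hc with ⟨q, rfl⟩ | hc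
      · simp [A.dualCol_fn hx hd hlam, ha, mul_comm]
      · simp [A.annCol_fn hx hd hc, hg c hc]
    | zero => simp
    | add c c' _ _ h h' => rw [dotProduct_add, h, h', add_zero]
    | smul b c _ h => rw [dotProduct_smul, h, smul_zero]
  rw [A.span_cols hlam] at h3
  have h4 : η = 0 := by
    ext (i | j)
    · have := h3 _ (Submodule.subset_span ⟨.inl i, rfl⟩)
      rw [logCol, Sum.elim_inl, dotProduct_single, mul_comm] at this
      exact hM.mul_eq_zero hx (.inl i) _ this
    · have := h3 _ (Submodule.subset_span ⟨.inr j, rfl⟩)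
      rwa [logCol, Sum.elim_inr, dotProduct_single, mul_one] at this
  intro i
  have := congrFun h4 i
  simp only [hη, Pi.sub_apply, Finset.sum_apply, Pi.smul_apply, smul_eq_mul, Pi.zero_apply,
    sub_eq_zero] at this
  exact this

omit hM in
theorem MonomialExponents.annCol_monomial {F : Fin s ⊕ Fin r → O} (hF : F ∈ A.annCol u v)
    (hd : IsExteriorDerivative d) (γ : Fin s → ℕ) : ∃ q : ℚ,
    hx.vectorField hd F (monomial u γ) = q • monomial u γ := by
  rcases hF with ⟨w, -, rfl⟩ | ⟨j, -, rfl⟩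
  · exact ⟨_, hx.euler_monomial hd _ γ⟩
  · refine ⟨0, ?_⟩
    rw [hx.vectorField_single hd, hx.partialDeriv_inr_monomial hd, mul_zero, zero_smul]

theorem MonomialExponents.annCol_const {F : Fin s ⊕ Fin r → O} (hF : F ∈ A.annCol u v) (i : Fin s)
    {y : O} (hy : hx.partialDeriv hM.isExteriorDerivative (.inl i) y = 0) :
    hx.partialDeriv hM.isExteriorDerivative (.inl i)
      (hx.vectorField hM.isExteriorDerivative F y) = 0 := by
  have hd := hM.isExteriorDerivative
  rcases hF with ⟨w, -, rfl⟩ | ⟨j, -, rfl⟩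
  · rw [hx.vectorField_apply hd, _root_.map_sum]
    refine Finset.sum_eq_zero fun l _ => ?_
    rw [Derivation.leibniz, hM.partialDeriv_comm hx, hy, _root_.map_zero, smul_zero, zero_add, euler,
      Derivation.map_smul, hx.partialDeriv_coord hd]
    by_cases h : .inl i = l
    · subst h; rw [hy, zero_smul]
    · rw [if_neg h, smul_zero, smul_zero]
  · rw [hx.vectorField_single hd, one_mul, hM.partialDeriv_comm hx, hy, _root_.map_zero]

/-- If `T` is congruent modulo `u_i` to a function `y` which does not depend on `u_i`, and the
derivatives of `u^μ T` along the annihilating vector fields are divisible by `u^μ u_i`, then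
these vector fields annihilate `u^μ y`. -/
theorem MonomialExponents.annCol_eq_zero {F : Fin s ⊕ Fin r → O} (hF : F ∈ A.annCol u v)
    {i : Fin s} {y T T' : O} (hy : hx.partialDeriv hM.isExteriorDerivative (.inl i) y = 0)
    (hT : T = y + u i * T') {μ : Fin s → ℕ}
    (hdvd : monomial u μ * u i ∣ hx.vectorField hM.isExteriorDerivative F (monomial u μ * T)) :
    hx.vectorField hM.isExteriorDerivative F (monomial u μ * y) = 0 := by
  have hd := hM.isExteriorDerivative
  obtain ⟨q, hq⟩ := A.annCol_monomial hx hF hd μ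
  have h1 : ∀ f, hx.vectorField hd F (monomial u μ * f) =
      monomial u μ * (q • f + hx.vectorField hd F f) := by
    intro f
    rw [Derivation.leibniz, hq, smul_eq_mul, smul_eq_mul, Algebra.smul_def, Algebra.smul_def]
    ring
  rw [h1] at hdvd ⊢
  have h2 : u i ∣ q • T + hx.vectorField hd F T := by
    obtain ⟨c, hc⟩ := hdvd
    rw [mul_assoc] at hc
    exact ⟨c, hM.monomial_mul_cancel hx μ hc⟩
  have h3 : u i ∣ hx.vectorField hd F (u i * T') := by
    have := hx.monomial_dvd_vectorField (γ := Pi.single i 1) hd (A.dvd_of_mem_annCol hF)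
      (f := u i * T') (by rw [monomial_single]; exact dvd_mul_right _ _)
    rwa [monomial_single] at this
  have h4 : u i ∣ q • y + hx.vectorField hd F y := by
    have : q • y + hx.vectorField hd F y = (q • T + hx.vectorField hd F T) -
        (u i * (q • T') + hx.vectorField hd F (u i * T')) := by
      rw [hT, _root_.map_add, smul_add, mul_smul_comm]
      abel
    rw [this]
    exact dvd_sub h2 (dvd_add (dvd_mul_right _ _) h3)
  rw [hM.eq_zero_of_dvd hx (.inl i) _ h4, mul_zero]
  rw [_root_.map_add, Derivation.map_smul, hy, smul_zero, zero_add]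
  exact A.annCol_const hM hx hF i hy

end Change

end HsiangPati

namespace HsiangPati

/-! ### Families of models closed under extensions -/

/-- A local ring with exterior derivative and divisor as in `IsLogModel`, together with the
components `f_m` of a morphism. -/
structure LogModel (N : ℕ) where
  O : Type w₁
  Ω : Type w₂
  ι : Type w₃
  [commRing : CommRing O]
  [isLocalRing : IsLocalRing O]
  [algebra : Algebra ℚ O]
  [addCommGroup : AddCommGroup Ω]
  [module : Module O Ω]
  d : O → Ω
  eqn : ι → O → Prop
  f : Fin N → O
  isLogModel : IsLogModel d eqn

attribute [instance] LogModel.commRing LogModel.isLocalRing LogModel.algebra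
  LogModel.addCommGroup LogModel.module

namespace LogModel

variable {N : ℕ}

theorem hd (M : LogModel.{w₁, w₂, w₃} N) : IsExteriorDerivative M.d :=
  M.isLogModel.isExteriorDerivative

/-- An extension of models, such as the pull-back of functions to an étale neighbourhood. -/
structure Ext (M M' : LogModel.{w₁, w₂, w₃} N) where
  hom : M.O →+* M'.O
  mem_nonunits : ∀ a ∈ nonunits M.O, hom a ∈ nonunits M'.O
  isAdapted : ∀ {s r : ℕ} {u : Fin s → M.O} {v : Fin r → M.O}, IsAdapted M.d M.eqn u v →
    IsAdapted M'.d M'.eqn (hom ∘ u) (hom ∘ v)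
  d_hom : ∀ {P : Type} [Fintype P] (f : M.O) (a h : P → M.O), M.d f = ∑ p, a p • M.d (h p) →
    M'.d (hom f) = ∑ p, hom (a p) • M'.d (hom (h p))
  hom_f : ∀ m, hom (M.f m) = M'.f m

namespace Ext

variable {M M' : LogModel.{w₁, w₂, w₃} N} (e : Ext M M') {s r : ℕ} {u : Fin s → M.O}
  {v : Fin r → M.O}

theorem hom_monomial (γ : Fin s → ℕ) : e.hom (monomial u γ) = monomial (e.hom ∘ u) γ := by
  simp [monomial]

theorem hom_fn {l l' : ℕ} (A : MonomialExponents s r l l') (p : Fin l ⊕ Fin l') :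
    e.hom (A.fn u v p) = A.fn (e.hom ∘ u) (e.hom ∘ v) p := by
  rcases p with i | j <;> simp [MonomialExponents.fn, e.hom_monomial]

theorem d_mem_span {P : Type} [Fintype P] {f : M.O} {h : P → M.O}
    (hf : M.d f ∈ Submodule.span M.O (Set.range fun p => M.d (h p))) :
    M'.d (e.hom f) ∈ Submodule.span M'.O (Set.range fun p => M'.d (e.hom (h p))) := by
  rw [Submodule.mem_span_range_iff_exists_fun] at hf ⊢
  obtain ⟨a, ha⟩ := hf
  exact ⟨_, (e.d_hom f a h ha.symm).symm⟩

variable (huv : IsAdapted M.d M.eqn u v)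

theorem partialDeriv_hom (i : Fin s ⊕ Fin r) (f : M.O) :
    (e.isAdapted huv).coordinates.partialDeriv M'.hd i (e.hom f) =
      e.hom (huv.coordinates.partialDeriv M.hd i f) := by
  refine (e.isAdapted huv).coordinates.partialDeriv_eq M'.hd
    (c := fun i => e.hom (huv.coordinates.partialDeriv M.hd i f)) ?_ i
  rw [e.d_hom _ _ _ (huv.coordinates.d_eq_sum M.hd f)]
  refine Finset.sum_congr rfl fun i _ => ?_
  rcases i with i | j <;> rfl

theorem vectorField_hom (c : Fin s ⊕ Fin r → M.O) (f : M.O) :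
    (e.isAdapted huv).coordinates.vectorField M'.hd (fun i => e.hom (c i)) (e.hom f) =
      e.hom (huv.coordinates.vectorField M.hd c f) := by
  rw [(e.isAdapted huv).coordinates.vectorField_apply, huv.coordinates.vectorField_apply]
  simp [e.partialDeriv_hom huv]

theorem hom_annCol {l l' : ℕ} (A : MonomialExponents s r l l') :
    A.annCol (e.hom ∘ u) (e.hom ∘ v) = (fun c i => e.hom (c i)) '' A.annCol u v := by
  have h1 : ∀ w, (fun i => e.hom (euler (Sum.elim u v) w i)) =
      euler (Sum.elim (e.hom ∘ u) (e.hom ∘ v)) w := by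
    intro w
    ext (i | j) <;> simp [euler, Algebra.smul_def]
  have h2 : ∀ j, (fun i => e.hom ((Pi.single (.inr j) 1 : Fin s ⊕ Fin r → M.O) i)) =
      Pi.single (.inr j) 1 := by
    intro j
    ext i
    by_cases h : i = .inr j
    · subst h; simp
    · simp [h]
  ext c
  constructor
  · rintro (⟨w, hw, rfl⟩ | ⟨j, hj, rfl⟩)
    · exact ⟨_, .inl ⟨w, hw, rfl⟩, h1 _⟩
    · exact ⟨_, .inr ⟨j, hj, rfl⟩, h2 j⟩
  · rintro ⟨_, ⟨w, hw, rfl⟩ | ⟨j, hj, rfl⟩, rfl⟩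
    · exact .inl ⟨w, hw, h1 _⟩
    · exact .inr ⟨j, hj, h2 j⟩

theorem logMinors_hom (j : ℕ) :
    logMinors M'.hd (e.isAdapted huv).coordinates M'.f j =
      (logMinors M.hd huv.coordinates M.f j).map e.hom := by
  rw [logMinors, logMinors, minorIdeal_map]
  congr 1
  · rw [← Set.range_comp]
    congr 1
    ext m i
    simp [IsCoordinateSystem.grad, ← e.hom_f, e.partialDeriv_hom huv]
  · rw [← Set.range_comp]
    congr 1
    ext c i
    rcases c with c | c
    · by_cases h : i = .inl c
      · subst h; simp [logCol]
      · simp [logCol, h]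
    · by_cases h : i = .inr c
      · subst h; simp [logCol]
      · simp [logCol, h]

theorem isPartialForm {l l' k : ℕ} {A : MonomialExponents s r l l'} {μ : Fin s → ℕ}
    {g T : Fin N → M.O} {τ : Fin k → Fin N} (h : IsPartialForm M.d A u v μ M.f g T τ) :
    IsPartialForm M'.d A (e.hom ∘ u) (e.hom ∘ v) μ M'.f (e.hom ∘ g) (e.hom ∘ T) τ where
  exp_le := h.exp_le
  d_g m := by
    have := e.d_mem_span (h.d_g m)
    simp only [e.hom_fn] at this
    exact this
  eq m := by rw [← e.hom_f, h.eq]; simp [e.hom_monomial]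
  card := h.card
  total := h.total
  injective := h.injective
  span_rows := by
    refine le_antisymm (Submodule.span_le.2 ?_) (Submodule.span_le.2 ?_)
    · rintro _ ⟨i, rfl⟩
      have : M.d (M.f (τ i)) ∈ Submodule.span M.O (Set.range fun p => M.d (A.fn u v p)) := by
        rw [← h.span_rows]
        exact Submodule.subset_span ⟨i, rfl⟩
      have := e.d_mem_span this
      simp only [e.hom_fn, e.hom_f] at this
      exact this
    · rintro _ ⟨p, rfl⟩
      have : M.d (A.fn u v p) ∈ Submodule.span M.O (Set.range fun i => M.d (M.f (τ i))) := by
        rw [h.span_rows]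
        exact Submodule.subset_span ⟨p, rfl⟩
      have := e.d_mem_span this
      simp only [e.hom_fn, e.hom_f] at this
      exact this

end Ext

/-- The log minors of order `j` generate a monomial ideal. -/
def MonomialMinors (M : LogModel.{w₁, w₂, w₃} N) (j : ℕ) : Prop :=
  ∃ (s r : ℕ) (u : Fin s → M.O) (v : Fin r → M.O) (huv : IsAdapted M.d M.eqn u v)
    (γ : Fin s → ℕ), logMinors M.hd huv.coordinates M.f j = Ideal.span {monomial u γ}

theorem Ext.monomialMinors {M M' : LogModel.{w₁, w₂, w₃} N} (e : Ext M M') {j : ℕ}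
    (h : M.MonomialMinors j) : M'.MonomialMinors j := by
  obtain ⟨s, r, u, v, huv, γ, h⟩ := h
  refine ⟨s, r, _, _, e.isAdapted huv, γ, ?_⟩
  rw [e.logMinors_hom huv, h, Ideal.map_span, Set.image_singleton, e.hom_monomial]

/-- Monomials in different adapted coordinates generate the same ideals. -/
theorem _root_.HsiangPati.IsLogModel.exists_span_monomial_eq {O Ω ι : Type*} [CommRing O]
    [AddCommGroup Ω] [Module O Ω] [Algebra ℚ O] {d : O → Ω} {eqn : ι → O → Prop}
    (hM : IsLogModel d eqn) {s r s' r' : ℕ} {u : Fin s → O}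
    {v : Fin r → O} {u' : Fin s' → O} {v' : Fin r' → O} (huv : IsAdapted d eqn u v)
    (huv' : IsAdapted d eqn u' v') (γ' : Fin s' → ℕ) :
    ∃ γ : Fin s → ℕ, Ideal.span {monomial u' γ'} = Ideal.span {monomial u γ} := by
  obtain ⟨e, he⟩ := huv.components
  obtain ⟨e', he'⟩ := huv'.components
  let π : Fin s ≃ Fin s' := e.trans e'.symm
  have h1 : ∀ i, eqn (e i) (u' (π i)) := fun i => by simpa [π] using he' (π i)
  have h2 : ∀ i, u i ∣ u' (π i) := fun i =>
    hM.eqn_dvd huv.coordinates (e i) (.inl i) _ (he i) (h1 i)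
  have h3 : ∀ i, u' (π i) ∣ u i := fun i =>
    hM.eqn_dvd huv'.coordinates (e i) (.inl (π i)) _ (h1 i) (he i)
  refine ⟨γ' ∘ π, ?_⟩
  rw [monomial, ← Equiv.prod_comp π, monomial]
  exact le_antisymm
    (Ideal.span_singleton_le_span_singleton.2
      (Finset.prod_dvd_prod_of_dvd _ _ fun i _ => pow_dvd_pow_of_dvd (h2 i) _))
    (Ideal.span_singleton_le_span_singleton.2
      (Finset.prod_dvd_prod_of_dvd _ _ fun i _ => pow_dvd_pow_of_dvd (h3 i) _))

theorem MonomialMinors.exists_eq {M : LogModel.{w₁, w₂, w₃} N} {j : ℕ} (h : M.MonomialMinors j)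
    {s r : ℕ} {u : Fin s → M.O} {v : Fin r → M.O} (huv : IsAdapted M.d M.eqn u v) :
    ∃ γ : Fin s → ℕ, logMinors M.hd huv.coordinates M.f j = Ideal.span {monomial u γ} := by
  obtain ⟨s', r', u', v', huv', γ', h⟩ := h
  obtain ⟨γ, hγ⟩ := M.isLogModel.exists_span_monomial_eq huv huv' γ'
  exact ⟨γ, by rw [← hγ, ← h, M.isLogModel.logMinors_eq huv huv']⟩

/-- A family of models in which, after extension, functions can be restricted to the components of
the divisor, values of functions at the point can be taken, and units have roots. -/
structure IsClosedFamily (C : LogModel.{w₁, w₂, w₃} N → Prop) : Prop where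
  /-- `ρ R` is the restriction of `R` to `(u_i = 0)`, as a function independent of `u_i`. -/
  restrict : ∀ M, C M → ∀ {s r : ℕ} {u : Fin s → M.O} {v : Fin r → M.O}
    (huv : IsAdapted M.d M.eqn u v) (i : Fin s), ∃ (M' : LogModel.{w₁, w₂, w₃} N) (e : Ext M M')
      (ρ : M.O → M'.O), C M' ∧ ∀ R, e.hom (u i) ∣ e.hom R - ρ R ∧
        (e.isAdapted huv).coordinates.partialDeriv M'.hd (.inl i) (ρ R) = 0
  const : ∀ M, C M → ∀ R : M.O, (∃ (s r : ℕ) (u : Fin s → M.O) (v : Fin r → M.O),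
    IsAdapted M.d M.eqn u v) → ∃ (M' : LogModel.{w₁, w₂, w₃} N) (e : Ext M M') (c : M'.O),
      C M' ∧ M'.d c = 0 ∧ e.hom R - c ∈ nonunits M'.O
  root : ∀ M, C M → ∀ (R : M.O) (p : ℕ), (∃ (s r : ℕ) (u : Fin s → M.O) (v : Fin r → M.O),
    IsAdapted M.d M.eqn u v) → IsUnit R → 0 < p →
    ∃ (M' : LogModel.{w₁, w₂, w₃} N) (e : Ext M M') (c t : M'.O),
      C M' ∧ M'.d c = 0 ∧ e.hom R = c * t ^ p

theorem IsClosedFamily.and_monomialMinors {C : LogModel.{w₁, w₂, w₃} N → Prop}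
    (h : IsClosedFamily C) (k : ℕ) :
    IsClosedFamily fun M => C M ∧ ∀ j, 1 ≤ j → j ≤ k → M.MonomialMinors j where
  restrict M hM s r u v huv i := by
    obtain ⟨M', e, ρ, h1, h2⟩ := h.restrict M hM.1 huv i
    exact ⟨M', e, ρ, ⟨h1, fun j hj hj' => e.monomialMinors (hM.2 j hj hj')⟩, h2⟩
  const M hM R hR := by
    obtain ⟨M', e, c, h1, h2⟩ := h.const M hM.1 R hR
    exact ⟨M', e, c, ⟨h1, fun j hj hj' => e.monomialMinors (hM.2 j hj hj')⟩, h2⟩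
  root M hM R p hR hR' hp := by
    obtain ⟨M', e, c, t, h1, h2⟩ := h.root M hM.1 R p hR hR' hp
    exact ⟨M', e, c, t, ⟨h1, fun j hj hj' => e.monomialMinors (hM.2 j hj hj')⟩, h2⟩

/-- The remainders `u^μ T_m` have derivatives along the vector fields annihilating the differential
monomials which generate the ideal `(u^δ)`. -/
def HasExponent (M : LogModel.{w₁, w₂, w₃} N) {s r l l' : ℕ} (A : MonomialExponents s r l l')
    {u : Fin s → M.O} {v : Fin r → M.O} (huv : IsAdapted M.d M.eqn u v) (μ δ : Fin s → ℕ)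
    (T : Fin N → M.O) : Prop :=
  (∀ m, ∀ F ∈ A.annCol u v, monomial u δ ∣
    huv.coordinates.vectorField M.hd F (monomial u μ * T m)) ∧
  ∃ m, ∃ F ∈ A.annCol u v, ∃ ξ, IsUnit ξ ∧
    huv.coordinates.vectorField M.hd F (monomial u μ * T m) = monomial u δ * ξ

variable {C : LogModel.{w₁, w₂, w₃} N → Prop} {s r l l' k : ℕ} {A : MonomialExponents s r l l'}

/-- The exponent of the remainders can be raised to that of their derivatives along the annihilating
vector fields, by moving the restriction of `T_m` to `(u_i = 0)` into `g_m`. -/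
theorem IsClosedFamily.exists_isPartialForm (hC : IsClosedFamily C) {τ : Fin k → Fin N}
    {δ : Fin s → ℕ} (n : ℕ) :
    ∀ {M : LogModel.{w₁, w₂, w₃} N}, C M → ∀ {u : Fin s → M.O} {v : Fin r → M.O}
      (huv : IsAdapted M.d M.eqn u v) {μ : Fin s → ℕ} {g T : Fin N → M.O},
      IsPartialForm M.d A u v μ M.f g T τ → HasExponent M A huv μ δ T → μ ≤ δ →
      ∑ i, δ i = n + ∑ i, μ i →
      ∃ (M' : LogModel.{w₁, w₂, w₃} N) (u' : Fin s → M'.O) (v' : Fin r → M'.O)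
        (huv' : IsAdapted M'.d M'.eqn u' v') (g' T' : Fin N → M'.O), C M' ∧
        IsPartialForm M'.d A u' v' δ M'.f g' T' τ ∧ HasExponent M' A huv' δ δ T' := by
  induction n with
  | zero =>
    intro M hM u v huv μ g T h hT hμ hn
    obtain rfl : μ = δ := by
      funext i
      exact (Finset.sum_eq_sum_iff_of_le fun i _ => hμ i).1 (by omega) i (Finset.mem_univ i)
    exact ⟨M, u, v, huv, g, T, hM, h, hT⟩
  | succ n ih =>
    intro M hM u v huv μ g T h hT hμ hn
    obtain ⟨i, hi⟩ : ∃ i, μ i < δ i := by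
      by_contra! hle
      have := Finset.sum_le_sum fun i (_ : i ∈ Finset.univ) => hle i
      omega
    obtain ⟨M', e, ρ, hM', hρ⟩ := hC.restrict M hM huv i
    have huv' := e.isAdapted huv
    have h' := e.isPartialForm h
    choose T' hT' using fun m => (hρ (T m)).1
    have hT'' : ∀ m, e.hom (T m) = ρ (T m) + (e.hom ∘ u) i * T' m := fun m => by
      rw [Function.comp_apply, ← hT']; abel
    have hle : μ + Pi.single i 1 ≤ δ := by
      intro i'
      by_cases hii : i' = i
      · subst hii; simpa using hi
      · simpa [hii] using hμ i'
    have hV : ∀ m c, huv'.coordinates.vectorField M'.hd (fun i => e.hom (c i))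
        (monomial (e.hom ∘ u) μ * e.hom (T m)) =
        e.hom (huv.coordinates.vectorField M.hd c (monomial u μ * T m)) := by
      intro m c
      rw [← e.vectorField_hom huv, RingHom.map_mul e.hom, e.hom_monomial]
    -- `u^μ ρ(T_m)` is annihilated, since its derivatives are divisible by `u_i u^μ`, while `ρ(T_m)`
    -- does not depend on `u_i`
    have hzero : ∀ m, ∀ F ∈ A.annCol (e.hom ∘ u) (e.hom ∘ v),
        huv'.coordinates.vectorField M'.hd F (monomial (e.hom ∘ u) μ * ρ (T m)) = 0 := by
      intro m F hF
      refine A.annCol_eq_zero M'.isLogModel huv'.coordinates hF (hρ (T m)).2 (hT'' m) ?_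
      rw [e.hom_annCol] at hF
      obtain ⟨c, hc, rfl⟩ := hF
      rw [hV, ← monomial_single (e.hom ∘ u) i, ← monomial_add, ← e.hom_monomial]
      exact _root_.map_dvd _ ((monomial_dvd_monomial u hle).trans (hT.1 m c hc))
    have hV' : ∀ m, ∀ c ∈ A.annCol u v, huv'.coordinates.vectorField M'.hd (fun i => e.hom (c i))
        (monomial (e.hom ∘ u) (μ + Pi.single i 1) * T' m) =
        e.hom (huv.coordinates.vectorField M.hd c (monomial u μ * T m)) := by
      intro m c hc
      have h1 : monomial (e.hom ∘ u) (μ + Pi.single i 1) * T' m =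
          monomial (e.hom ∘ u) μ * e.hom (T m) - monomial (e.hom ∘ u) μ * ρ (T m) := by
        rw [monomial_add, monomial_single, hT'' m]; ring
      rw [h1, _root_.map_sub, hV, hzero m _ (by rw [e.hom_annCol]; exact ⟨c, hc, rfl⟩), sub_zero]
    -- hence `u^μ ρ(T_m)` can be moved from the remainder to `g_m`
    refine ih hM' huv' (μ := μ + Pi.single i 1)
      (g := fun m => e.hom (g m) + monomial (e.hom ∘ u) μ * ρ (T m)) (T := T') ?_ ?_ hle ?_
    · refine ⟨fun p => (h.exp_le p).trans le_self_add, fun m => ?_, fun m => ?_, h.card, h.total,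
        h.injective, h'.span_rows⟩
      · rw [M'.hd.map_add]
        refine Submodule.add_mem _ (h'.d_g m) (A.d_mem_span M'.isLogModel huv'.coordinates
          (fun F hF => hzero m F hF) fun p => (monomial_dvd_monomial _ (h.exp_le p)).mul_right _)
      · have := h'.eq m
        simp only [Function.comp_apply] at this
        rw [this, hT'' m, monomial_add, monomial_single]
        ring
    · refine ⟨fun m F hF => ?_, ?_⟩
      · rw [e.hom_annCol] at hF
        obtain ⟨c, hc, rfl⟩ := hF
        rw [hV' m c hc, ← e.hom_monomial]
        exact _root_.map_dvd _ (hT.1 m c hc)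
      · obtain ⟨m, c, hc, ξ, hξ, hξ'⟩ := hT.2
        refine ⟨m, _, by rw [e.hom_annCol]; exact ⟨c, hc, rfl⟩, e.hom ξ, hξ.map _, ?_⟩
        rw [hV' m c hc, hξ', _root_.map_mul, e.hom_monomial]
    · simp only [Pi.add_apply, Finset.sum_add_distrib, Finset.sum_pi_single', Finset.mem_univ,
        if_true]
      omega

end LogModel

end HsiangPati

namespace HsiangPati

/-! ### The inductive construction of Hsiang-Pati coordinates -/

section Step

variable {O Ω ι : Type*} [CommRing O] [AddCommGroup Ω] [Module O Ω] [Algebra ℚ O]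
  {d : O → Ω} {eqn : ι → O → Prop} {s r l l' N k : ℕ} {A : MonomialExponents s r l l'}
  {u : Fin s → O} {v : Fin r → O} {δ : Fin s → ℕ} {f g T : Fin N → O} {τ : Fin k → Fin N}

omit [Algebra ℚ O] in
theorem monomial_mul_zpow (t : Oˣ) (lam : Fin s → ℤ) (γ : Fin s → ℕ) :
    monomial (fun h => u h * ((t ^ lam h : Oˣ) : O)) γ =
      monomial u γ * ((t ^ (∑ h, γ h * lam h) : Oˣ) : O) := by
  simp only [monomial, mul_pow, Finset.prod_mul_distrib]
  congr 1
  have : ∀ h, ((t ^ lam h : Oˣ) : O) ^ γ h = ((t ^ (γ h * lam h) : Oˣ) : O) := by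
    intro h
    rw [mul_comm, zpow_mul, zpow_natCast, Units.val_pow_eq_pow_val]
  simp only [this]
  rw [← Units.coe_prod]
  exact congrArg _ (map_sum (zpowersHom Oˣ t).toAdditiveRight _ _).symm

theorem MonomialExponents.dotProduct_eq_zero {w : Fin s → ℚ}
    (hw : ∀ i, ∑ h, (A.α i h : ℚ) * w h = 0) {y : Fin s → ℚ}
    (hy : y ∈ Submodule.span ℚ (Set.range fun i h => (A.α i h : ℚ))) : y ⬝ᵥ w = 0 := by
  induction hy using Submodule.span_induction with
  | mem y hy => obtain ⟨i, rfl⟩ := hy; exact hw i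
  | zero => simp
  | add y z _ _ hy hz => rw [add_dotProduct, hy, hz, add_zero]
  | smul a y _ hy => rw [smul_dotProduct, hy, smul_zero]

/-- Integral weights of `u` orthogonal to the `α_i`, but not to a given exponent outside their
span. -/
theorem MonomialExponents.exists_int_weight
    (hδ : (fun h => (δ h : ℚ)) ∉ Submodule.span ℚ (Set.range fun i h => (A.α i h : ℚ))) :
    ∃ (lam : Fin s → ℤ) (p : ℕ), 0 < p ∧ (∀ i, ∑ h, A.α i h * lam h = 0) ∧
      ∑ h, δ h * lam h = p := by
  obtain ⟨w, hw⟩ := (A.snocLeft δ hδ).exists_dual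
  obtain ⟨b, hb⟩ := IsLocalization.exist_integer_multiples_of_finset (nonZeroDivisors ℤ)
    (Finset.univ.image (w (Fin.last l)))
  have hb0 : (b : ℤ) ≠ 0 := nonZeroDivisors.coe_ne_zero b
  have h1 : ∀ h, ∃ a : ℤ, (a : ℚ) = (b : ℤ) * w (Fin.last l) h := by
    intro h
    obtain ⟨a, ha⟩ := hb _ (Finset.mem_image_of_mem _ (Finset.mem_univ h))
    exact ⟨a, by simpa [Algebra.smul_def] using ha⟩
  choose a ha using h1
  have h2 : ∀ γ : Fin s → ℕ, ((∑ h, γ h * ((b : ℤ) * a h) : ℤ) : ℚ) =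
      (b : ℤ) ^ 2 * ∑ h, γ h * w (Fin.last l) h := by
    intro γ
    push_cast
    rw [Finset.mul_sum]
    refine Finset.sum_congr rfl fun h _ => ?_
    rw [ha]; ring
  refine ⟨fun h => b * a h, ((b : ℤ) ^ 2).toNat, by
    have : 0 < (b : ℤ) ^ 2 := by positivity
    omega, fun i => ?_, ?_⟩
  · have h3 := h2 (A.α i)
    have h4 := hw (Fin.last l) (Fin.castSucc i)
    simp only [snocLeft, Fin.snoc_castSucc] at h4
    rw [h4, if_neg (Fin.castSucc_lt_last i).ne', mul_zero] at h3
    exact_mod_cast h3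
  · have h3 := h2 δ
    have h4 := hw (Fin.last l) (Fin.last l)
    simp only [snocLeft, Fin.snoc_last, if_true] at h4
    rw [h4, mul_one] at h3
    rw [Int.toNat_of_nonneg (by positivity)]
    exact_mod_cast h3

/-- If a remainder `u^δ T_m` is the product of `u^δ` with a constant and a `p`-th power of a unit,
where `δ` is independent of the `α_i`, then it is a constant times a new monomial. -/
theorem IsPartialForm.exists_succ_left [IsLocalRing O] (hM : IsLogModel d eqn)
    (huv : IsAdapted d eqn u v)
    (h : IsPartialForm d A u v δ f g T τ) {m₀ : Fin N} (hm₀ : m₀ ∉ Set.range τ)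
    (hδ : (fun h => (δ h : ℚ)) ∉ Submodule.span ℚ (Set.range fun i h => (A.α i h : ℚ)))
    {lam : Fin s → ℤ} {p : ℕ} (hA : ∀ i, ∑ h, A.α i h * lam h = 0) (hp : ∑ h, δ h * lam h = p)
    {c : O} {t : Oˣ} (hc : d c = 0) (hcu : IsUnit c) (hT : T m₀ = c * t ^ p) :
    ∃ (u' : Fin s → O) (v' : Fin r → O) (T' : Fin N → O), IsAdapted d eqn u' v' ∧
      IsPartialForm d (A.snocLeft δ hδ) u' v' δ f g T' (Fin.snoc τ m₀ : Fin (k + 1) → Fin N) := by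
  -- multiply `u_h` by `t^{λ_h}`, which changes only `u^δ` among the `u^α_i` and `u^δ`, and
  -- compensate in the `v_j` for the change of the `u^β_j`
  set ξ : Fin s → Oˣ := fun h => t ^ lam h with hξ
  set ζ : Fin r → Oˣ := fun j => t ^ (∑ j', if A.idx j' = j then -∑ h, A.β j' h * lam h else 0)
    with hζ
  have hmon : ∀ γ, monomial (fun h => u h * (ξ h : O)) γ =
      monomial u γ * ((t ^ (∑ h, γ h * lam h) : Oˣ) : O) := monomial_mul_zpow t lam
  have hfn : A.fn (fun h => u h * (ξ h : O)) (fun j => v j * (ζ j : O)) = A.fn u v := by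
    funext q
    rcases q with i | j
    · simp only [MonomialExponents.fn, Sum.elim_inl, hmon, hA, zpow_zero, Units.val_one, mul_one]
    · simp only [MonomialExponents.fn, Sum.elim_inr, hmon]
      have h1 : ζ (A.idx j) = t ^ (-∑ h, A.β j h * lam h) := by
        rw [hζ]
        dsimp only
        rw [Finset.sum_eq_single j, if_pos rfl]
        · intro j' _ hj
          rw [if_neg fun h => hj (A.idx_injective h)]
        · simp
      rw [h1, mul_mul_mul_comm, ← Units.val_mul, ← zpow_add, add_neg_cancel, zpow_zero,
        Units.val_one, mul_one]
  have hdelta : monomial (fun h => u h * (ξ h : O)) δ = monomial u δ * (t : O) ^ p := by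
    rw [hmon, hp, zpow_natCast, Units.val_pow_eq_pow_val]
  have hform : IsPartialForm d A (fun h => u h * (ξ h : O)) (fun j => v j * (ζ j : O)) δ f g
      (fun m => ((t⁻¹ : Oˣ) : O) ^ p * T m) τ :=
    { exp_le := h.exp_le
      d_g := by rw [hfn]; exact h.d_g
      eq := fun m => by
        rw [h.eq m, hdelta, mul_assoc, ← mul_assoc ((t : O) ^ p), ← mul_pow, Units.mul_inv,
          one_pow, one_mul]
      card := h.card
      total := h.total
      injective := h.injective
      span_rows := by rw [hfn]; exact h.span_rows }
  refine ⟨_, _, _, huv.mul_units hM ξ ζ, hform.succ _ (by have := h.card; omega)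
    (MonomialExponents.range_fn_snocLeft A _ _ δ hδ) (A.range_exp_snocLeft δ hδ) hm₀ hcu ?_⟩
  rw [hfn, ← hM.isExteriorDerivative.map_const_mul hc, ← hM.isExteriorDerivative.map_sub, hdelta,
    h.eq, hT]
  convert h.d_g m₀ using 2
  ring

/-- If the derivative of `T_m` with respect to an unused coordinate `v_j` is a unit, then
`T_m - c` can be made the coordinate `v_j`. -/
theorem IsPartialForm.exists_succ_right [IsLocalRing O] (hM : IsLogModel d eqn)
    (huv : IsAdapted d eqn u v)
    (h : IsPartialForm d A u v δ f g T τ) {m₀ : Fin N} (hm₀ : m₀ ∉ Set.range τ)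
    {j : Fin r} (hj : j ∉ Set.range A.idx) {c : O} (hc : T m₀ - c ∈ nonunits O)
    (hc' : d (monomial u δ * c) ∈ Submodule.span O (Set.range fun p => d (A.fn u v p)))
    (hu : IsUnit (huv.coordinates.partialDeriv hM.isExteriorDerivative (.inr j) (T m₀ - c))) :
    ∃ v' : Fin r → O, IsAdapted d eqn u v' ∧
      IsPartialForm d (A.snocRight δ j hj) u v' δ f g T (Fin.snoc τ m₀ : Fin (k + 1) → Fin N) := by
  have hfn : A.fn u (Function.update v j (T m₀ - c)) = A.fn u v := by
    funext q
    rcases q with i | j'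
    · rfl
    · simp only [MonomialExponents.fn, Sum.elim_inr]
      rw [Function.update_of_ne fun h => hj ⟨j', h⟩]
  have hform : IsPartialForm d A u (Function.update v j (T m₀ - c)) δ f g T τ :=
    ⟨h.exp_le, by rw [hfn]; exact h.d_g, h.eq, h.card, h.total, h.injective,
      by rw [hfn]; exact h.span_rows⟩
  refine ⟨_, huv.update hM j hc hu, hform.succ _ (by have := h.card; omega)
    (MonomialExponents.range_fn_snocRight A _ _ δ j hj) (A.range_exp_snocRight δ j hj) hm₀ isUnit_one
    ?_⟩
  rw [hfn, one_smul, ← hM.isExteriorDerivative.map_sub, Function.update_self, h.eq]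
  have : g m₀ + monomial u δ * T m₀ - monomial u δ * (T m₀ - c) = g m₀ + monomial u δ * c := by ring
  rw [this, hM.isExteriorDerivative.map_add]
  exact Submodule.add_mem _ (h.d_g m₀) hc'

/-- The remainders of the functions `f_{τ i}`, whose differentials are combinations of the
differential monomials, are annihilated by the vector fields that annihilate these. -/
theorem IsPartialForm.vectorField_eq_zero {μ : Fin s → ℕ} (h : IsPartialForm d A u v μ f g T τ)
    (hx : IsCoordinateSystem d (Sum.elim u v)) (hd : IsExteriorDerivative d)
    {F : Fin s ⊕ Fin r → O} (hF : F ∈ A.annCol u v) (i : Fin k) :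
    hx.vectorField hd F (monomial u μ * T (τ i)) = 0 := by
  have key : ∀ y, d y ∈ Submodule.span O (Set.range fun p => d (A.fn u v p)) →
      hx.vectorField hd F y = 0 := by
    intro y hy
    obtain ⟨a, ha⟩ := Submodule.mem_span_range_iff_exists_fun _ |>.1 hy
    have h1 := (hx.d_eq_sum_iff hd).1 ha.symm
    rw [hx.vectorField_apply hd]
    simp only [h1, Finset.mul_sum]
    rw [Finset.sum_comm]
    refine Finset.sum_eq_zero fun p _ => ?_
    have h2 := A.annCol_fn hx hd hF p
    rw [hx.vectorField_apply hd] at h2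
    calc ∑ i, F i * (a p * hx.partialDeriv hd i (A.fn u v p))
        = a p * ∑ i, F i * hx.partialDeriv hd i (A.fn u v p) := by
          rw [Finset.mul_sum]
          exact Finset.sum_congr rfl fun _ _ => by ring
      _ = 0 := by rw [h2, mul_zero]
  have h1 : monomial u μ * T (τ i) = f (τ i) - g (τ i) := by rw [h.eq]; ring
  rw [h1, _root_.map_sub, key _ (h.d_g _), key, sub_zero]
  rw [← h.span_rows]
  exact Submodule.subset_span ⟨i, rfl⟩

end Step

namespace LogModel

variable {N : ℕ} {C : LogModel.{w₁, w₂, w₃} N → Prop} {s r k : ℕ}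

/-- There are adapted coordinates in which the functions `f_m` are in Hsiang-Pati form of order
`k`. -/
def HasPartialForm (M : LogModel.{w₁, w₂, w₃} N) (k : ℕ) : Prop :=
  ∃ (s r l l' : ℕ) (A : MonomialExponents s r l l') (u : Fin s → M.O) (v : Fin r → M.O)
    (μ : Fin s → ℕ) (g T : Fin N → M.O) (τ : Fin k → Fin N), IsAdapted M.d M.eqn u v ∧
    IsPartialForm M.d A u v μ M.f g T τ ∧ (1 ≤ k → μ ∈ Set.range A.exp)

theorem hasPartialForm_zero (M : LogModel.{w₁, w₂, w₃} N) {u : Fin s → M.O} {v : Fin r → M.O}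
    (huv : IsAdapted M.d M.eqn u v) : M.HasPartialForm 0 := by
  let A : MonomialExponents s r 0 0 :=
    ⟨Fin.elim0, Fin.elim0, Fin.elim0, fun i => i.elim0, linearIndependent_empty_type⟩
  refine ⟨s, r, 0, 0, A, u, v, 0, 0, M.f, Fin.elim0, huv, ⟨?_, fun m => ?_, fun m => ?_, rfl, ?_,
    fun i => i.elim0, ?_⟩, by simp⟩
  · rintro (i | i) <;> exact i.elim0
  · rw [Pi.zero_apply, M.hd.map_zero]
    exact Submodule.zero_mem _
  · simp [monomial_zero]
  · rintro (i | i) <;> exact i.elim0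
  · rw [Set.range_eq_empty, Set.range_eq_empty]

/-- If the log minors of order one more generate a monomial ideal, then Hsiang-Pati form of order
`k` can be extended to order `k + 1` in an extension of the model. -/
theorem IsClosedFamily.hasPartialForm_succ (hC : IsClosedFamily C) {M : LogModel.{w₁, w₂, w₃} N}
    (hM : C M) (h : M.HasPartialForm k) (hminors : M.MonomialMinors (k + 1)) :
    ∃ M', C M' ∧ M'.HasPartialForm (k + 1) := by
  classical
  obtain ⟨s, r, l, l', A, u, v, μ, g, T, τ, huv, h, -⟩ := h
  obtain ⟨γ, hγ⟩ := hminors.exists_eq huv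
  obtain ⟨δ, hμδ, hdvd, hex⟩ := h.isDecomposition.exists_exponent M.isLogModel huv.coordinates
    (γ := γ) (by rw [h.card]; exact hγ)
  -- raise the exponent of the remainders to `δ`
  obtain ⟨M, u, v, huv, g, T, hM, h, -, m₀, F, hF, ξ, hξ, hFT⟩ :=
    hC.exists_isPartialForm (∑ i, δ i - ∑ i, μ i) hM huv h ⟨hdvd, hex⟩ hμδ
      (Nat.sub_add_cancel (Finset.sum_le_sum fun i _ => hμδ i)).symm
  have hd := M.hd
  have hx := huv.coordinates
  have hm₀ : m₀ ∉ Set.range τ := by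
    rintro ⟨i, rfl⟩
    rw [h.vectorField_eq_zero hx hd hF i] at hFT
    have : (0 : M.O) = ξ := M.isLogModel.monomial_mul_cancel hx δ (by rw [mul_zero, hFT])
    exact not_isUnit_zero (this ▸ hξ)
  -- the new monomial is `u^δ`, if `T_{m₀}` is a unit and `δ` is independent of the `α_i`
  have hleft : IsUnit (T m₀) →
      (fun h => (δ h : ℚ)) ∉ Submodule.span ℚ (Set.range fun i h => (A.α i h : ℚ)) →
      ∃ M', C M' ∧ M'.HasPartialForm (k + 1) := by
    intro hT hδ
    obtain ⟨lam, p, hp, hlam, hlam'⟩ := A.exists_int_weight hδ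
    obtain ⟨M', e, c, t, hM', hc, ht⟩ := hC.root M hM (T m₀) p ⟨s, r, u, v, huv⟩ hT hp
    have h1 : IsUnit (c * t ^ p) := ht ▸ hT.map e.hom
    obtain ⟨t, rfl⟩ := (isUnit_pow_iff hp.ne').1 (isUnit_of_mul_isUnit_right h1)
    obtain ⟨u', v', T', huv', hform⟩ := (e.isPartialForm h).exists_succ_left M'.isLogModel
      (e.isAdapted huv) hm₀ hδ hlam hlam' hc (isUnit_of_mul_isUnit_left h1) ht
    refine ⟨M', hM', s, r, l + 1, l', _, u', v', δ, _, T', _, huv', hform, fun _ => ?_⟩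
    rw [MonomialExponents.range_exp_snocLeft]
    exact Set.mem_insert _ _
  rcases hF with ⟨w, hw, rfl⟩ | ⟨j, hj, rfl⟩
  · -- an Euler vector field
    have h1 : ξ = (∑ h, δ h * w h) • T m₀ +
        hx.vectorField hd (euler (Sum.elim u v) (A.weight w)) (T m₀) := by
      refine M.isLogModel.monomial_mul_cancel hx δ ?_
      rw [← hFT, Derivation.leibniz, hx.euler_monomial hd, smul_eq_mul, smul_eq_mul]
      simp only [MonomialExponents.weight, Sum.elim_inl, Algebra.smul_def]
      ring
    have h2 : hx.vectorField hd (euler (Sum.elim u v) (A.weight w)) (T m₀) ∈ nonunits M.O := by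
      refine hx.vectorField_mem_nonunits hd (fun i => ?_) _
      rw [euler, Algebra.smul_def]
      exact mul_mem_nonunits_right (hx.vanish i)
    have h3 : IsUnit ((∑ h, (δ h : ℚ) * w h) • T m₀) := by
      by_contra h4
      exact IsLocalRing.nonunits_add h4 h2 (h1 ▸ hξ)
    rw [Algebra.smul_def] at h3
    refine hleft (isUnit_of_mul_isUnit_right h3) fun hspan => ?_
    have h4 : ∑ h, (δ h : ℚ) * w h = 0 := MonomialExponents.dotProduct_eq_zero hw hspan
    rw [h4, _root_.map_zero, zero_mul] at h3
    exact not_isUnit_zero h3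
  · -- the vector field `∂/∂v_j`
    have h1 : IsUnit (hx.partialDeriv hd (.inr j) (T m₀)) := by
      have : ξ = hx.partialDeriv hd (.inr j) (T m₀) := by
        refine M.isLogModel.monomial_mul_cancel hx δ ?_
        rw [← hFT, hx.vectorField_single hd, one_mul, Derivation.leibniz,
          hx.partialDeriv_inr_monomial hd, smul_zero, add_zero, smul_eq_mul]
      exact this ▸ hξ
    by_cases hT : IsUnit (T m₀)
    · by_cases hδ : (fun h => (δ h : ℚ)) ∈ Submodule.span ℚ (Set.range fun i h => (A.α i h : ℚ))
      · -- `d(u^δ)` is a combination of the `d(u^α_i)`, so the value `c` of `T_{m₀}` can be subtracted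
        obtain ⟨M', e, c, hM', hc, hc'⟩ := hC.const M hM (T m₀) ⟨s, r, u, v, huv⟩
        have h' := e.isPartialForm h
        have huv' := e.isAdapted huv
        have hcon : ∀ F ∈ A.annCol (e.hom ∘ u) (e.hom ∘ v),
            huv'.coordinates.vectorField M'.hd F (monomial (e.hom ∘ u) δ * c) = 0 := by
          have hc0 : ∀ F, huv'.coordinates.vectorField M'.hd F c = 0 := by
            intro F
            rw [huv'.coordinates.vectorField_apply M'.hd]
            simp [(huv'.coordinates.d_eq_zero_iff M'.hd).1 hc]
          rintro _ (⟨w, hw, rfl⟩ | ⟨j', -, rfl⟩)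
          · have h2 : ∑ h, (δ h : ℚ) * w h = 0 := MonomialExponents.dotProduct_eq_zero hw hδ
            rw [Derivation.leibniz, hc0, huv'.coordinates.euler_monomial M'.hd]
            simp only [MonomialExponents.weight, Sum.elim_inl, h2, zero_smul, smul_zero, add_zero]
          · rw [Derivation.leibniz, hc0, huv'.coordinates.vectorField_single M'.hd,
              huv'.coordinates.partialDeriv_inr_monomial M'.hd]
            simp
        obtain ⟨v', hv', hform⟩ := h'.exists_succ_right M'.isLogModel huv' hm₀ hj hc'
          (A.d_mem_span M'.isLogModel huv'.coordinates hcon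
            fun p => (monomial_dvd_monomial _ (h.exp_le p)).mul_right _) (by
            rw [_root_.map_sub, (huv'.coordinates.d_eq_zero_iff M'.hd).1 hc, sub_zero,
              Function.comp_apply, e.partialDeriv_hom huv]
            exact h1.map e.hom)
        refine ⟨M', hM', s, r, l, l' + 1, _, _, v', δ, _, _, _, hv', hform, fun _ => ?_⟩
        rw [MonomialExponents.range_exp_snocRight]
        exact Set.mem_insert _ _
      · exact hleft hT hδ
    · -- `T_{m₀}` vanishes at the point, and can be made the coordinate `v_j`
      obtain ⟨v', hv', hform⟩ := h.exists_succ_right M.isLogModel huv hm₀ hj (c := 0)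
        (by rwa [sub_zero]) (by rw [mul_zero, hd.map_zero]; exact Submodule.zero_mem _)
        (by rwa [sub_zero])
      refine ⟨M, hM, s, r, l, l' + 1, _, u, v', δ, _, _, _, hv', hform, fun _ => ?_⟩
      rw [MonomialExponents.range_exp_snocRight]
      exact Set.mem_insert _ _

/-- If the log minors of orders `1, …, k` generate monomial ideals, then there are Hsiang-Pati
coordinates of order `k` in an extension. -/
theorem IsClosedFamily.hasPartialForm (hC : IsClosedFamily C) {M : LogModel.{w₁, w₂, w₃} N}
    (hM : C M) {u : Fin s → M.O} {v : Fin r → M.O} (huv : IsAdapted M.d M.eqn u v)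
    (hminors : ∀ j, 1 ≤ j → j ≤ k → M.MonomialMinors j) : ∃ M', C M' ∧ M'.HasPartialForm k := by
  have key : ∀ i ≤ k, ∃ M', (C M' ∧ ∀ j, 1 ≤ j → j ≤ k → M'.MonomialMinors j) ∧
      M'.HasPartialForm i := by
    intro i
    induction i with
    | zero => exact fun _ => ⟨M, ⟨hM, hminors⟩, M.hasPartialForm_zero huv⟩
    | succ i ih =>
      intro hi
      obtain ⟨M', hM', h'⟩ := ih (by omega)
      exact (hC.and_monomialMinors k).hasPartialForm_succ hM' h' (hM'.2 _ (by omega) hi)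
  obtain ⟨M', hM', h'⟩ := key k le_rfl
  exact ⟨M', hM'.1, h'⟩

end LogModel

section Equivalence

variable {O Ω P Θ ι : Type*} [CommRing O] [IsLocalRing O] [AddCommGroup Ω] [Module O Ω]
  [Algebra ℚ O] [CommRing P] [AddCommGroup Θ] [Module P Θ] {d : O → Ω} {eqn : ι → O → Prop}
  {dP : P → Θ} {φ : P → O} {N n k : ℕ}

/-- If the logarithmic Fitting ideals are principal monomial ideals, then there are coordinates of
the target, and the log minors in these coordinates generate monomial ideals. -/
theorem IsLogModel.exists_logMinors_eq (hM : IsLogModel d eqn) (hφ : IsPullback d dP φ N)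
    (hk : 1 ≤ k) (hkn : k ≤ n)
    (h : ∀ j, 1 ≤ j → j ≤ k → IsPrincipalMonomial d eqn (logFittingIdeal d eqn dP φ N n (n - j))) :
    ∃ (s r : ℕ) (u : Fin s → O) (v : Fin r → O) (huv : IsAdapted d eqn u v) (z : Fin N → P),
      IsCoordinateSystem dP z ∧ ∀ j, 1 ≤ j → j ≤ k → ∃ γ,
        logMinors hM.isExteriorDerivative huv.coordinates (fun m => φ (z m)) j =
          Ideal.span {monomial u γ} := by
  obtain ⟨s, r, u, v, γ, huv, hγ⟩ := h 1 le_rfl hk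
  obtain ⟨z, hz⟩ : ∃ z : Fin N → P, IsCoordinateSystem dP z := by
    by_contra! hno
    -- without coordinates of the target the Fitting ideal would be generated by the empty set
    have h1 : logFittingIdeal d eqn dP φ N n (n - 1) = ⊥ := by
      rw [logFittingIdeal, Ideal.span_eq_bot]
      rintro x ⟨_, _, _, _, z, _, _, _, _, hz, _⟩
      exact absurd hz (hno z)
    rw [h1, eq_comm, Ideal.span_singleton_eq_bot] at hγ
    have h2 : (1 : O) = 0 := hM.monomial_mul_cancel huv.coordinates γ (by rw [hγ]; ring)
    exact one_ne_zero h2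
  refine ⟨s, r, u, v, huv, z, hz, fun j hj hj' => ?_⟩
  obtain ⟨s', r', u', v', γ', huv', hγ'⟩ := h j hj hj'
  obtain ⟨γ, hγ⟩ := hM.exists_span_monomial_eq huv huv' γ'
  exact ⟨γ, by rw [← hγ, ← hγ', hM.logFittingIdeal_eq huv hφ hz (by omega)]⟩

omit [IsLocalRing O] in
theorem HasHsiangPatiForm.isPrincipalMonomial (h : HasHsiangPatiForm d eqn dP φ N k)
    (hM : IsLogModel d eqn) (hφ : IsPullback d dP φ N) {j : ℕ} (hj : j ≤ k) (hkn : k ≤ n) :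
    IsPrincipalMonomial d eqn (logFittingIdeal d eqn dP φ N n (n - j)) := by
  obtain ⟨s, r, u, v, huv, z, hz, h⟩ := h.exists_logMinors_eq hM.isExteriorDerivative
  obtain ⟨γ, hγ⟩ := h j hj
  exact ⟨s, r, u, v, γ, huv, by rw [hM.logFittingIdeal_eq huv hφ hz (by omega), hγ]⟩

end Equivalence

end HsiangPati

namespace HsiangPati.Analytic

/-! ### Division of analytic functions by coordinates -/

section Calculus

variable {𝕜 κ : Type*} [RCLike 𝕜] [Fintype κ] [DecidableEq κ]

/-- The projection `y ↦ (y with y_i replaced by 0)`. -/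
noncomputable def zeroAt (i : κ) : (κ → 𝕜) →L[𝕜] (κ → 𝕜) :=
  ContinuousLinearMap.pi fun j => if j = i then 0 else ContinuousLinearMap.proj j

omit [Fintype κ] in
theorem zeroAt_apply (i : κ) (y : κ → 𝕜) : zeroAt i y = Function.update y i 0 := by
  ext j
  by_cases h : j = i
  · subst h; simp [zeroAt]
  · simp [zeroAt, h]

theorem norm_zeroAt_apply_le (i : κ) (y : κ → 𝕜) : ‖zeroAt i y‖ ≤ ‖y‖ := by
  rw [zeroAt_apply, pi_norm_le_iff_of_nonneg (norm_nonneg _)]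
  intro j
  by_cases h : j = i
  · subst h; simp
  · simpa [h] using norm_le_pi_norm y j

theorem norm_zeroAt_le (i : κ) : ‖(zeroAt i : (κ → 𝕜) →L[𝕜] (κ → 𝕜))‖ ≤ 1 :=
  ContinuousLinearMap.opNorm_le_bound _ zero_le_one fun y => by
    rw [one_mul]
    exact norm_zeroAt_apply_le i y

omit [Fintype κ] in
theorem zeroAt_add (i : κ) (y : κ → 𝕜) : y = zeroAt i y + y i • Pi.single i 1 := by
  ext j
  by_cases h : j = i
  · subst h; simp [zeroAt_apply]
  · simp [zeroAt_apply, h]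

/-- The power series of the quotient of `F - F ∘ zeroAt i` by `y_i`, where `p` is the power series
of `F`. -/
noncomputable def quotientSeries (p : FormalMultilinearSeries 𝕜 (κ → 𝕜) 𝕜) (i : κ) :
    FormalMultilinearSeries 𝕜 (κ → 𝕜) 𝕜 := fun n =>
  ∑ k : Fin (n + 1), ((p (n + 1)).curryMid k (Pi.single i 1)).compContinuousLinearMap
    fun j => if j.castSucc < k then zeroAt i else ContinuousLinearMap.id 𝕜 _

theorem norm_quotientSeries_le (p : FormalMultilinearSeries 𝕜 (κ → 𝕜) 𝕜) (i : κ) (n : ℕ) :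
    ‖quotientSeries p i n‖ ≤ (n + 1) * ‖p (n + 1)‖ := by
  have h : ∀ k : Fin (n + 1), ‖((p (n + 1)).curryMid k
      (Pi.single i 1 : κ → 𝕜)).compContinuousLinearMap
      fun j => if j.castSucc < k then zeroAt i else ContinuousLinearMap.id 𝕜 _‖ ≤ ‖p (n + 1)‖ := by
    intro k
    refine (ContinuousMultilinearMap.norm_compContinuousLinearMap_le _ _).trans ?_
    have h1 : ∏ j : Fin n, ‖if j.castSucc < k then zeroAt i else
        ContinuousLinearMap.id 𝕜 (κ → 𝕜)‖ ≤ 1 := by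
      refine Finset.prod_le_one (fun _ _ => norm_nonneg _) fun j _ => ?_
      split_ifs
      · exact norm_zeroAt_le i
      · exact ContinuousLinearMap.norm_id_le
    have h2 : ‖(p (n + 1)).curryMid k (Pi.single i 1 : κ → 𝕜)‖ ≤ ‖p (n + 1)‖ := by
      refine (ContinuousLinearMap.le_opNorm _ _).trans ?_
      rw [ContinuousMultilinearMap.norm_curryMid, Pi.norm_single, norm_one, mul_one]
    exact (mul_le_mul h2 h1 (Finset.prod_nonneg fun _ _ => norm_nonneg _) (norm_nonneg _)).trans
      (by rw [mul_one])
  refine (norm_sum_le _ _).trans ((Finset.sum_le_sum fun k _ => h k).trans ?_)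
  simp

/-- The homogeneous parts of the quotient: a telescoping sum, in which the arguments `y` of the
multilinear form are replaced by `zeroAt i y` one at a time. -/
theorem mul_quotientSeries (p : FormalMultilinearSeries 𝕜 (κ → 𝕜) 𝕜) (i : κ) (n : ℕ)
    (y : κ → 𝕜) : y i * quotientSeries p i n (fun _ => y) =
      p (n + 1) (fun _ => y) - p (n + 1) (fun _ => zeroAt i y) := by
  let w : ℕ → Fin (n + 1) → κ → 𝕜 := fun k j => if (j : ℕ) < k then zeroAt i y else y
  have h : ∀ k : Fin (n + 1), y i * ((p (n + 1)).curryMid k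
      (Pi.single i 1 : κ → 𝕜)).compContinuousLinearMap (fun j => if j.castSucc < k then zeroAt i
        else ContinuousLinearMap.id 𝕜 _) (fun _ => y) =
      p (n + 1) (w k) - p (n + 1) (w (k + 1)) := by
    intro k
    rw [ContinuousMultilinearMap.compContinuousLinearMap_apply,
      ContinuousMultilinearMap.curryMid_apply]
    set m : Fin n → κ → 𝕜 := fun j =>
      (if j.castSucc < k then zeroAt i else ContinuousLinearMap.id 𝕜 _) y with hm
    have h1 : ∀ c : κ → 𝕜, ∀ k' : ℕ, (k' = k ∧ c = y) ∨ (k' = k + 1 ∧ c = zeroAt i y) →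
        w k' = k.insertNth c m := by
      intro c k' hk
      rw [Fin.eq_insertNth_iff]
      refine ⟨?_, ?_⟩
      · rcases hk with ⟨rfl, rfl⟩ | ⟨rfl, rfl⟩ <;> simp [w]
      · ext1 j
        simp only [Fin.removeNth, w, hm]
        rcases lt_or_ge j.castSucc k with hj | hj
        · have hj' : (j : ℕ) < k := hj
          rw [Fin.succAbove_of_castSucc_lt _ _ hj, if_pos hj, Fin.val_castSucc, if_pos]
          rcases hk with ⟨rfl, -⟩ | ⟨rfl, -⟩ <;> omega
        · have hj' : (k : ℕ) ≤ j := hj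
          rw [Fin.succAbove_of_le_castSucc _ _ hj, if_neg (not_lt.2 hj), Fin.val_succ, if_neg]
          · rfl
          · rcases hk with ⟨rfl, -⟩ | ⟨rfl, -⟩ <;> omega
    rw [h1 y k (.inl ⟨rfl, rfl⟩), h1 (zeroAt i y) (k + 1) (.inr ⟨rfl, rfl⟩)]
    have h2 := (p (n + 1)).toMultilinearMap.map_insertNth_add k m (zeroAt i y)
      (y i • Pi.single i 1)
    have h3 := (p (n + 1)).toMultilinearMap.map_insertNth_smul k m (y i) (Pi.single i 1)
    rw [← zeroAt_add, h3] at h2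
    simp only [ContinuousMultilinearMap.coe_coe, smul_eq_mul] at h2
    rw [h2]
    ring
  rw [quotientSeries, _root_.sum_apply, Finset.mul_sum]
  simp only [h]
  rw [Fin.sum_univ_eq_sum_range (fun k => p (n + 1) (w k) - p (n + 1) (w (k + 1))) (n + 1),
    Finset.sum_range_sub']
  congr 2
  ext1 j
  simp [w, j.2]

/-- Hadamard's lemma for analytic functions: `F - F ∘ zeroAt i` is divisible by `y_i`. -/
theorem _root_.AnalyticAt.exists_eq_add_mul {F : (κ → 𝕜) → 𝕜} (hF : AnalyticAt 𝕜 F 0) (i : κ) :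
    ∃ G : (κ → 𝕜) → 𝕜, AnalyticAt 𝕜 G 0 ∧
      ∀ᶠ y in 𝓝 0, F y = F (zeroAt i y) + y i * G y := by
  obtain ⟨p, R, hp⟩ := hF
  obtain ⟨r, hr0, hr⟩ := ENNReal.lt_iff_exists_nnreal_btwn.1 hp.r_pos
  have hr0' : 0 < r := by exact_mod_cast hr0
  obtain ⟨a, ha, C, hC, hpa⟩ := p.norm_mul_pow_le_mul_pow_of_lt_radius (hr.trans_le hp.r_le)
  obtain ⟨B, hB⟩ := (tendsto_self_mul_const_pow_of_lt_one ha.1.le ha.2).bddAbove_range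
  have hq : (r : ENNReal) ≤ (quotientSeries p i).radius := by
    refine (quotientSeries p i).le_radius_of_bound (C * B / r) fun n => ?_
    rw [le_div_iff₀ (by exact_mod_cast hr0')]
    calc ‖quotientSeries p i n‖ * (r : ℝ) ^ n * r
        ≤ ((n + 1) * ‖p (n + 1)‖) * (r : ℝ) ^ n * r := by
          gcongr
          exact norm_quotientSeries_le p i n
      _ = (n + 1) * (‖p (n + 1)‖ * (r : ℝ) ^ (n + 1)) := by ring
      _ ≤ (n + 1) * (C * a ^ (n + 1)) := mul_le_mul_of_nonneg_left (hpa _) (by positivity)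
      _ = C * ((n + 1 : ℕ) * a ^ (n + 1)) := by push_cast; ring
      _ ≤ C * B := by gcongr; exact hB ⟨n + 1, rfl⟩
  have hG := (quotientSeries p i).hasFPowerSeriesOnBall (hr0.trans_le hq)
  refine ⟨(quotientSeries p i).sum, hG.analyticAt, ?_⟩
  filter_upwards [Metric.eball_mem_nhds (0 : κ → 𝕜) hr0] with y hy
  have hy' : zeroAt i y ∈ Metric.eball (0 : κ → 𝕜) r := by
    rw [Metric.eball_coe, mem_ball_zero_iff] at hy ⊢
    exact (norm_zeroAt_apply_le i y).trans_lt hy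
  have h1 := hp.hasSum (Metric.eball_subset_eball hr.le hy)
  have h2 := hp.hasSum (Metric.eball_subset_eball hr.le hy')
  have h3 := (hG.hasSum (Metric.eball_subset_eball hq hy)).mul_left (y i)
  simp only [zero_add, mul_quotientSeries] at h1 h2 h3
  have h4 := (hasSum_nat_add_iff' 1).2 (h1.sub h2)
  have h5 := h3.unique h4
  have h6 : p 0 (fun _ => y) = p 0 (fun _ => zeroAt i y) := by
    congr 1
    ext1 j
    exact j.elim0
  rw [Finset.sum_range_one, h6, sub_self, sub_zero] at h5
  rw [h5]
  ring

/-- Coordinate functions are nonzerodivisors. -/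
theorem eventually_eq_zero_of_mul {F : (κ → 𝕜) → 𝕜} (hF : AnalyticAt 𝕜 F 0) (i : κ)
    (h : ∀ᶠ y in 𝓝 0, y i * F y = 0) : ∀ᶠ y in 𝓝 0, F y = 0 := by
  obtain ⟨ε, hε, hball⟩ := Metric.eventually_nhds_iff_ball.1 (h.and hF.eventually_analyticAt)
  refine Metric.eventually_nhds_iff_ball.2 ⟨ε, hε, fun y hy => ?_⟩
  by_cases hyi : y i = 0
  · -- approach `y` along the direction of `y_i`
    have hc : ContinuousAt F y := (hball y hy).2.continuousAt
    have hpath : Continuous fun t : 𝕜 => y + Pi.single i t :=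
      continuous_const.add (continuous_pi fun j => by
        by_cases h : j = i
        · subst h; simpa using continuous_id'
        · simpa [h] using continuous_const)
    have h0 : Filter.Tendsto (fun t : 𝕜 => F (y + Pi.single i t)) (𝓝[≠] 0) (𝓝 (F y)) := by
      have : Filter.Tendsto (fun t : 𝕜 => y + Pi.single i t) (𝓝 0) (𝓝 y) := by
        have := hpath.tendsto 0
        simpa using this
      exact (hc.tendsto.comp this).mono_left nhdsWithin_le_nhds
    refine tendsto_nhds_unique h0 (tendsto_const_nhds.congr' ?_)
    have hmem : ∀ᶠ t : 𝕜 in 𝓝 0, y + Pi.single i t ∈ Metric.ball (0 : κ → 𝕜) ε := by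
      refine hpath.continuousAt.eventually_mem (Metric.isOpen_ball.mem_nhds ?_)
      simpa using hy
    filter_upwards [nhdsWithin_le_nhds hmem, self_mem_nhdsWithin] with t ht ht'
    have := (hball _ ht).1
    rw [Pi.add_apply, hyi, zero_add, Pi.single_eq_same, mul_eq_zero] at this
    exact (this.resolve_left ht').symm
  · exact (mul_eq_zero.1 (hball y hy).1).resolve_left hyi

omit [Fintype κ] in
theorem tendsto_zeroAt (i : κ) : Filter.Tendsto (zeroAt i : (κ → 𝕜) → (κ → 𝕜)) (𝓝 0) (𝓝 0) := by
  have := (zeroAt i : (κ → 𝕜) →L[𝕜] (κ → 𝕜)).continuous.tendsto 0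
  simpa using this

theorem _root_.AnalyticAt.comp_zeroAt {F : (κ → 𝕜) → 𝕜} (hF : AnalyticAt 𝕜 F 0) (i : κ) :
    AnalyticAt 𝕜 (fun y => F (zeroAt i y)) 0 := by
  have h0 : (zeroAt i : (κ → 𝕜) →L[𝕜] (κ → 𝕜)) 0 = 0 := map_zero _
  exact AnalyticAt.comp (g := F) (by rw [h0]; exact hF) (ContinuousLinearMap.analyticAt (zeroAt i : (κ → 𝕜) →L[𝕜] (κ → 𝕜)) 0)

/-- A function with vanishing partial derivative with respect to `y_i` does not depend on `y_i`. -/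
theorem eventually_eq_zeroAt {F : (κ → 𝕜) → 𝕜} (hF : AnalyticAt 𝕜 F 0) (i : κ)
    (h : ∀ᶠ y in 𝓝 0, fderiv 𝕜 F y (Pi.single i 1) = 0) : ∀ᶠ y in 𝓝 0, F y = F (zeroAt i y) := by
  obtain ⟨ε, hε, hball⟩ := Metric.eventually_nhds_iff_ball.1 (h.and hF.eventually_analyticAt)
  refine Metric.eventually_nhds_iff_ball.2 ⟨ε, hε, fun y hy => ?_⟩
  have hmem : ∀ t : 𝕜, t ∈ Metric.ball (0 : 𝕜) ε → Function.update y i t ∈ Metric.ball (0 : κ → 𝕜) ε := by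
    intro t ht
    rw [mem_ball_zero_iff] at ht hy ⊢
    rw [pi_norm_lt_iff hε] at hy ⊢
    intro j
    by_cases hj : j = i
    · subst hj; simpa using ht
    · simpa [hj] using hy j
  have hder : ∀ t ∈ Metric.ball (0 : 𝕜) ε,
      HasDerivAt (fun t => F (Function.update y i t)) 0 t := by
    intro t ht
    have h1 := (hball _ (hmem t ht)).2.differentiableAt.hasFDerivAt
    have h2 := h1.comp_hasDerivAt t (hasDerivAt_update y i t)
    rwa [(hball _ (hmem t ht)).1] at h2
  have hconst := (Metric.isOpen_ball (x := (0 : 𝕜)) (ε := ε)).is_const_of_deriv_eq_zero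
    ((convex_ball (0 : 𝕜) ε).isPreconnected) (fun t ht => (hder t ht).differentiableAt.differentiableWithinAt)
    (fun t ht => (hder t ht).deriv)
    (x := y i) (y := 0) ?_ (Metric.mem_ball_self hε)
  · simpa [zeroAt_apply] using hconst
  · rw [mem_ball_zero_iff] at hy ⊢
    exact (norm_le_pi_norm y i).trans_lt hy

end Calculus

end HsiangPati.Analytic

namespace HsiangPati.Analytic

/-! ### The local ring of analytic germs -/

section GermRing

variable {𝕜 : Type*} [RCLike 𝕜] {n : ℕ} {X : Type*} [TopologicalSpace X]
  [ChartedSpace (EuclideanSpace 𝕜 (Fin n)) X] {a : X}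

namespace germRing

/-- The germ of a function. -/
def mk (f : X → 𝕜) (hf : ContMDiffAt 𝓘(𝕜, EuclideanSpace 𝕜 (Fin n)) 𝓘(𝕜, 𝕜) ω f a) : germRing 𝕜 n a :=
  ⟨(f : Filter.Germ (𝓝 a) 𝕜), f, hf, rfl⟩

/-- A representative of a germ. -/
noncomputable def rep (g : germRing 𝕜 n a) : X → 𝕜 := g.2.choose

theorem contMDiffAt_rep (g : germRing 𝕜 n a) : ContMDiffAt 𝓘(𝕜, EuclideanSpace 𝕜 (Fin n)) 𝓘(𝕜, 𝕜) ω (rep g) a :=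
  g.2.choose_spec.1

theorem coe_rep (g : germRing 𝕜 n a) : ((rep g) : Filter.Germ (𝓝 a) 𝕜) = g.1 := g.2.choose_spec.2

theorem eq_iff {g h : germRing 𝕜 n a} : g = h ↔ (rep g) =ᶠ[𝓝 a] (rep h) := by
  rw [← Filter.Germ.coe_eq, coe_rep, coe_rep, Subtype.ext_iff]

theorem rep_mk (f : X → 𝕜) (hf : ContMDiffAt 𝓘(𝕜, EuclideanSpace 𝕜 (Fin n)) 𝓘(𝕜, 𝕜) ω f a) :
    (rep (mk f hf)) =ᶠ[𝓝 a] f := by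
  rw [← Filter.Germ.coe_eq, coe_rep]
  rfl

theorem rep_mul (g h : germRing 𝕜 n a) : (rep (g * h)) =ᶠ[𝓝 a] fun y => (rep g) y * (rep h) y := by
  rw [← Filter.Germ.coe_eq, coe_rep]
  change g.1 * h.1 = _
  rw [← coe_rep, ← coe_rep]
  rfl

theorem rep_add (g h : germRing 𝕜 n a) : (rep (g + h)) =ᶠ[𝓝 a] fun y => (rep g) y + (rep h) y := by
  rw [← Filter.Germ.coe_eq, coe_rep]
  change g.1 + h.1 = _
  rw [← coe_rep, ← coe_rep]
  rfl

theorem rep_sub (g h : germRing 𝕜 n a) : (rep (g - h)) =ᶠ[𝓝 a] fun y => (rep g) y - (rep h) y := by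
  rw [← Filter.Germ.coe_eq, coe_rep]
  change g.1 - h.1 = _
  rw [← coe_rep, ← coe_rep]
  rfl

theorem rep_zero : (rep (0 : germRing 𝕜 n a)) =ᶠ[𝓝 a] fun _ => 0 := by
  rw [← Filter.Germ.coe_eq, coe_rep]
  rfl

theorem rep_one : (rep (1 : germRing 𝕜 n a)) =ᶠ[𝓝 a] fun _ => 1 := by
  rw [← Filter.Germ.coe_eq, coe_rep]
  rfl

theorem isUnit_iff {g : germRing 𝕜 n a} : IsUnit g ↔ (rep g) a ≠ 0 := by
  constructor
  · rintro ⟨g, rfl⟩ h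
    have h1 := (rep_mul (g : germRing 𝕜 n a) (g⁻¹ : (germRing 𝕜 n a)ˣ)).eq_of_nhds
    rw [Units.mul_inv, rep_one.eq_of_nhds, h, zero_mul] at h1
    exact one_ne_zero h1
  · intro h
    have hinv : ContMDiffAt 𝓘(𝕜, EuclideanSpace 𝕜 (Fin n)) 𝓘(𝕜, 𝕜) ω (fun y => ((rep g) y)⁻¹) a :=
      (contDiffAt_inv 𝕜 h).comp_contMDiffAt (contMDiffAt_rep g)
    refine IsUnit.of_mul_eq_one (mk _ hinv) (eq_iff.2 ?_)
    filter_upwards [rep_mul g (mk _ hinv), rep_mk _ hinv, rep_one (𝕜 := 𝕜) (n := n) (a := a),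
      (contMDiffAt_rep g).continuousAt.eventually_ne h] with y h1 h2 h3 h4
    rw [h1, h2, h3, mul_inv_cancel₀ h4]

theorem mem_nonunits_iff {g : germRing 𝕜 n a} : g ∈ nonunits (germRing 𝕜 n a) ↔ (rep g) a = 0 := by
  rw [_root_.mem_nonunits_iff, isUnit_iff, not_not]

instance : Nontrivial (germRing 𝕜 n a) :=
  ⟨⟨0, 1, fun h => by
    have := (eq_iff.1 h).eq_of_nhds
    rw [rep_zero.eq_of_nhds, rep_one.eq_of_nhds] at this
    exact zero_ne_one this⟩⟩

instance : IsLocalRing (germRing 𝕜 n a) :=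
  IsLocalRing.of_nonunits_add fun g h hg hh => by
    rw [mem_nonunits_iff] at hg hh ⊢
    rw [(rep_add g h).eq_of_nhds, hg, hh, add_zero]

variable (n a) in
/-- Constant functions. -/
def const : 𝕜 →+* germRing 𝕜 n a where
  toFun c := mk (fun _ => c) contMDiffAt_const
  map_one' := rfl
  map_zero' := rfl
  map_mul' _ _ := rfl
  map_add' _ _ := rfl

theorem rep_const (c : 𝕜) : (rep (const n a c)) =ᶠ[𝓝 a] fun _ => c :=
  rep_mk (fun _ => c) contMDiffAt_const

noncomputable instance : Algebra ℚ (germRing 𝕜 n a) :=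
  ((const n a).comp (algebraMap ℚ 𝕜)).toAlgebra

end germRing

open germRing

variable (n) in
/-- The differential of a function at a point. -/
noncomputable def dAt (f : X → 𝕜) (y : X) : EuclideanSpace 𝕜 (Fin n) →L[𝕜] 𝕜 :=
  mfderiv 𝓘(𝕜, EuclideanSpace 𝕜 (Fin n)) 𝓘(𝕜, 𝕜) f y

theorem dAt_congr {f g : X → 𝕜} {y : X} (h : f =ᶠ[𝓝 y] g) : dAt n f y = dAt n g y :=
  h.mfderiv_eq

theorem germD_eq {g : germRing 𝕜 n a} {f : X → 𝕜} (h : (rep g) =ᶠ[𝓝 a] f) :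
    germD 𝕜 n a g = (dAt n f : Filter.Germ (𝓝 a) (EuclideanSpace 𝕜 (Fin n) →L[𝕜] 𝕜)) := by
  rw [← Filter.Germ.coe_eq, coe_rep] at h
  rw [germD, h]
  rfl

theorem germD_eq_sum_iff {P : Type*} [Fintype P] {f : germRing 𝕜 n a}
    {c z : P → germRing 𝕜 n a} : germD 𝕜 n a f = ∑ p, c p • germD 𝕜 n a (z p) ↔
      ∀ᶠ y in 𝓝 a, dAt n (rep f) y = ∑ p, rep (c p) y • dAt n (rep (z p)) y := by
  have h1 : ∑ p, c p • germD 𝕜 n a (z p) = ((∑ p, fun y => rep (c p) y • dAt n (rep (z p)) y :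
      X → EuclideanSpace 𝕜 (Fin n) →L[𝕜] 𝕜) :
        Filter.Germ (𝓝 a) (EuclideanSpace 𝕜 (Fin n) →L[𝕜] 𝕜)) := by
    refine Eq.trans (Finset.sum_congr rfl fun p _ => ?_)
      (map_sum (Filter.Germ.coeAddHom (M := EuclideanSpace 𝕜 (Fin n) →L[𝕜] 𝕜) (𝓝 a)) _ _).symm
    rw [germD_eq (Filter.EventuallyEq.refl (𝓝 a) (rep (z p)))]
    change (c p).1 • (dAt n (rep (z p)) : Filter.Germ (𝓝 a) (EuclideanSpace 𝕜 (Fin n) →L[𝕜] 𝕜)) = _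
    rw [← coe_rep, ← Filter.Germ.coe_smul']
    rfl
  rw [h1, germD_eq (Filter.EventuallyEq.refl (𝓝 a) (rep f)), Filter.Germ.coe_eq]
  refine Filter.eventually_congr (Filter.Eventually.of_forall fun y => ?_)
  rw [Finset.sum_apply]

variable [IsManifold 𝓘(𝕜, EuclideanSpace 𝕜 (Fin n)) ω X]

theorem germRing.eventually_mdifferentiableAt (g : germRing 𝕜 n a) :
    ∀ᶠ y in 𝓝 a, MDifferentiableAt 𝓘(𝕜, EuclideanSpace 𝕜 (Fin n)) 𝓘(𝕜, 𝕜) (rep g) y :=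
  (((contMDiffAt_iff_contMDiffAt_nhds (by simp)).1 (contMDiffAt_rep g))).mono fun _ hy => hy.mdifferentiableAt (by simp)

/-- The representatives of a family of germs, as a mapping into a coordinate space. -/
noncomputable def coord {κ : Type*} (x : κ → germRing 𝕜 n a) (y : X) : κ → 𝕜 := fun i => (rep (x i)) y

section Coord

variable {κ : Type*} [Fintype κ] (x : κ → germRing 𝕜 n a)

omit [IsManifold 𝓘(𝕜, EuclideanSpace 𝕜 (Fin n)) ω X] in
theorem contMDiffAt_coord : ContMDiffAt 𝓘(𝕜, EuclideanSpace 𝕜 (Fin n)) 𝓘(𝕜, κ → 𝕜) ω (coord x) a :=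
  contMDiffAt_pi_space.2 fun i => (contMDiffAt_rep (x i))

variable {x}

omit [IsManifold 𝓘(𝕜, EuclideanSpace 𝕜 (Fin n)) ω X] in
theorem contMDiffAt_comp_coord {F : (κ → 𝕜) → 𝕜} (hF : AnalyticAt 𝕜 F (coord x a)) :
    ContMDiffAt 𝓘(𝕜, EuclideanSpace 𝕜 (Fin n)) 𝓘(𝕜, 𝕜) ω (F ∘ coord x) a :=
  hF.contDiffAt.comp_contMDiffAt (contMDiffAt_coord x)

omit [IsManifold 𝓘(𝕜, EuclideanSpace 𝕜 (Fin n)) ω X] [Fintype κ] in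
theorem dAt_rep_apply [Fintype κ] {y : X}
    (hy : MDifferentiableAt 𝓘(𝕜, EuclideanSpace 𝕜 (Fin n)) 𝓘(𝕜, κ → 𝕜) (coord x) y) (i : κ) (w : EuclideanSpace 𝕜 (Fin n)) :
    dAt n (rep (x i)) y w =
      (mfderiv 𝓘(𝕜, EuclideanSpace 𝕜 (Fin n)) 𝓘(𝕜, κ → 𝕜) (coord x) y : EuclideanSpace 𝕜 (Fin n) →L[𝕜] (κ → 𝕜)) w i := by
  have h1 : HasMFDerivAt 𝓘(𝕜, κ → 𝕜) 𝓘(𝕜, 𝕜) (fun z : κ → 𝕜 => z i) (coord x y)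
      (ContinuousLinearMap.proj i : (κ → 𝕜) →L[𝕜] 𝕜) :=
    (ContinuousLinearMap.proj i : (κ → 𝕜) →L[𝕜] 𝕜).hasFDerivAt.hasMFDerivAt
  have h2 := (h1.comp y hy.hasMFDerivAt).mfderiv
  have h3 : (fun z : κ → 𝕜 => z i) ∘ coord x = (rep (x i)) := rfl
  rw [h3] at h2
  rw [dAt, h2]
  rfl

open Classical in
/-- The chain rule. -/
theorem germD_comp_coord {F : (κ → 𝕜) → 𝕜} (hF : AnalyticAt 𝕜 F (coord x a))
    {f : germRing 𝕜 n a} (hf : (rep f) =ᶠ[𝓝 a] F ∘ coord x) {c : κ → germRing 𝕜 n a}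
    (hc : ∀ i, (rep (c i)) =ᶠ[𝓝 a] (fun z => fderiv 𝕜 F z (Pi.single i 1)) ∘ coord x) :
    germD 𝕜 n a f = ∑ i, c i • germD 𝕜 n a (x i) := by
  rw [germD_eq_sum_iff]
  have h1 : ∀ᶠ y in 𝓝 a, AnalyticAt 𝕜 F (coord x y) :=
    (contMDiffAt_coord x).continuousAt.eventually hF.eventually_analyticAt
  have h2 : ∀ᶠ y in 𝓝 a, MDifferentiableAt 𝓘(𝕜, EuclideanSpace 𝕜 (Fin n)) 𝓘(𝕜, κ → 𝕜) (coord x) y :=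
    ((contMDiffAt_iff_contMDiffAt_nhds (by simp)).1 (contMDiffAt_coord x)).mono fun _ hy => hy.mdifferentiableAt (by simp)
  filter_upwards [h1, h2, hf.eventuallyEq_nhds, Filter.eventually_all.2 hc] with y h1 h2 h3 h4
  rw [dAt_congr h3]
  obtain ⟨D, h5, h6⟩ : ∃ D : EuclideanSpace 𝕜 (Fin n) →L[𝕜] (κ → 𝕜),
      (∀ i w, dAt n (rep (x i)) y w = D w i) ∧
      dAt n (F ∘ coord x) y = (fderiv 𝕜 F (coord x y)).comp D :=
    ⟨mfderiv 𝓘(𝕜, EuclideanSpace 𝕜 (Fin n)) 𝓘(𝕜, κ → 𝕜) (coord x) y, dAt_rep_apply h2,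
      (HasMFDerivAt.comp y h1.differentiableAt.hasFDerivAt.hasMFDerivAt h2.hasMFDerivAt).mfderiv⟩
  rw [h6]
  refine ContinuousLinearMap.ext fun w => ?_
  have h7 : (∑ i, rep (c i) y • dAt n (rep (x i)) y) w =
      ∑ i, fderiv 𝕜 F (coord x y) (Pi.single i 1) * D w i := by
    rw [_root_.sum_apply]
    refine Finset.sum_congr rfl fun i _ => ?_
    rw [_root_.smul_apply, h5, h4, smul_eq_mul]
    rfl
  rw [h7, ContinuousLinearMap.comp_apply]
  conv_lhs => rw [← Finset.univ_sum_single (D w)]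
  rw [map_sum]
  refine Finset.sum_congr rfl fun i _ => ?_
  rw [mul_comm, ← smul_eq_mul, ← map_smul, ← Pi.single_smul, smul_eq_mul, mul_one]

end Coord

theorem isExteriorDerivative_germD : IsExteriorDerivative (germD 𝕜 n a) where
  map_add f g := by
    have h : germD 𝕜 n a (f + g) = ∑ p, (fun _ : Fin 2 => (1 : germRing 𝕜 n a)) p •
        germD 𝕜 n a (![f, g] p) := by
      rw [germD_eq_sum_iff]
      filter_upwards [(rep_add f g).eventuallyEq_nhds, (eventually_mdifferentiableAt f),
        (eventually_mdifferentiableAt g), rep_one (𝕜 := 𝕜) (n := n) (a := a)] with y h1 h2 h3 h4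
      rw [dAt_congr h1, Fin.sum_univ_two]
      simp only [h4, one_smul]
      exact (h2.hasMFDerivAt.add h3.hasMFDerivAt).mfderiv
    simpa using h
  leibniz f g := by
    have h : germD 𝕜 n a (f * g) = ∑ p, ![f, g] p • germD 𝕜 n a (![g, f] p) := by
      rw [germD_eq_sum_iff]
      filter_upwards [(rep_mul f g).eventuallyEq_nhds, (eventually_mdifferentiableAt f),
        (eventually_mdifferentiableAt g)] with y h1 h2 h3
      rw [dAt_congr h1, Fin.sum_univ_two]
      exact (h2.hasMFDerivAt.mul h3.hasMFDerivAt).mfderiv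
    simpa using h

end GermRing

end HsiangPati.Analytic

namespace HsiangPati.Analytic

/-! ### Analytic functions in local coordinates -/

section LocalCoordinates

variable {𝕜 : Type*} [RCLike 𝕜] {n : ℕ} {X : Type*} [TopologicalSpace X]
  [ChartedSpace (EuclideanSpace 𝕜 (Fin n)) X] {a : X}

open germRing

theorem _root_.AnalyticAt.fderiv_apply {κ : Type*} [Fintype κ] {F : (κ → 𝕜) → 𝕜} {y : κ → 𝕜}
    (hF : AnalyticAt 𝕜 F y) (w : κ → 𝕜) : AnalyticAt 𝕜 (fun z => fderiv 𝕜 F z w) y :=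
  ((ContinuousLinearMap.apply 𝕜 𝕜 w).analyticAt _).comp hF.fderiv

variable [IsManifold 𝓘(𝕜, EuclideanSpace 𝕜 (Fin n)) ω X]

theorem germD_mem_span {κ : Type*} [Fintype κ] {x : κ → germRing 𝕜 n a} {F : (κ → 𝕜) → 𝕜}
    (hF : AnalyticAt 𝕜 F (coord x a)) {f : germRing 𝕜 n a} (hf : rep f =ᶠ[𝓝 a] F ∘ coord x) :
    germD 𝕜 n a f ∈ Submodule.span (germRing 𝕜 n a) (Set.range fun i => germD 𝕜 n a (x i)) := by
  classical
  rw [germD_comp_coord hF hf (c := fun i => mk _ (contMDiffAt_comp_coord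
    (hF.fderiv_apply (Pi.single i 1)))) fun i => rep_mk _ _]
  exact Submodule.sum_mem _ fun i _ => Submodule.smul_mem _ _ (Submodule.subset_span ⟨i, rfl⟩)

omit [IsManifold 𝓘(𝕜, EuclideanSpace 𝕜 (Fin n)) ω X] in
theorem tendsto_extChartAt_symm :
    Filter.Tendsto (extChartAt 𝓘(𝕜, EuclideanSpace 𝕜 (Fin n)) a).symm
      (𝓝 (extChartAt 𝓘(𝕜, EuclideanSpace 𝕜 (Fin n)) a a)) (𝓝 a) := by
  have := (continuousAt_extChartAt_symm (I := 𝓘(𝕜, EuclideanSpace 𝕜 (Fin n))) a).tendsto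
  rwa [extChartAt_to_inv] at this

theorem contMDiffAt_extChartAt_symm :
    ContMDiffAt 𝓘(𝕜, EuclideanSpace 𝕜 (Fin n)) 𝓘(𝕜, EuclideanSpace 𝕜 (Fin n)) ω
      (extChartAt 𝓘(𝕜, EuclideanSpace 𝕜 (Fin n)) a).symm
      (extChartAt 𝓘(𝕜, EuclideanSpace 𝕜 (Fin n)) a a) :=
  (contMDiffOn_extChartAt_symm a).contMDiffAt (extChartAt_target_mem_nhds a)

theorem exists_hasMFDerivAt_extChartAt :
    ∃ e : EuclideanSpace 𝕜 (Fin n) ≃L[𝕜] EuclideanSpace 𝕜 (Fin n),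
      HasMFDerivAt 𝓘(𝕜, EuclideanSpace 𝕜 (Fin n)) 𝓘(𝕜, EuclideanSpace 𝕜 (Fin n))
        (extChartAt 𝓘(𝕜, EuclideanSpace 𝕜 (Fin n)) a) a
        (e : EuclideanSpace 𝕜 (Fin n) →L[𝕜] EuclideanSpace 𝕜 (Fin n)) := by
  have hd : MDifferentiableAt 𝓘(𝕜, EuclideanSpace 𝕜 (Fin n)) 𝓘(𝕜, EuclideanSpace 𝕜 (Fin n))
      (extChartAt 𝓘(𝕜, EuclideanSpace 𝕜 (Fin n)) a) a :=
    contMDiffAt_extChartAt.mdifferentiableAt (n := ω) (by simp)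
  obtain ⟨e, he⟩ := isInvertible_mfderiv_extChartAt (I := 𝓘(𝕜, EuclideanSpace 𝕜 (Fin n)))
    (mem_extChartAt_source (I := 𝓘(𝕜, EuclideanSpace 𝕜 (Fin n))) a)
  have := hd.hasMFDerivAt
  rw [← he] at this
  exact ⟨e, this⟩

/-- The coordinates of the chart at `a` generate all differentials, and separate tangent
vectors. -/
theorem exists_chart_coord : ∃ y : Fin n → germRing 𝕜 n a,
    (∀ f, germD 𝕜 n a f ∈
      Submodule.span (germRing 𝕜 n a) (Set.range fun i => germD 𝕜 n a (y i))) ∧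
    ∀ w, (∀ i, dAt n (rep (y i)) a w = 0) → w = 0 := by
  set φ := extChartAt 𝓘(𝕜, EuclideanSpace 𝕜 (Fin n)) a with hφ
  have hφa : ContMDiffAt 𝓘(𝕜, EuclideanSpace 𝕜 (Fin n)) 𝓘(𝕜, EuclideanSpace 𝕜 (Fin n)) ω φ a :=
    contMDiffAt_extChartAt
  have hc : ∀ i, ContMDiffAt 𝓘(𝕜, EuclideanSpace 𝕜 (Fin n)) 𝓘(𝕜, 𝕜) ω (fun p => φ p i) a :=
    fun i => (EuclideanSpace.proj i : EuclideanSpace 𝕜 (Fin n) →L[𝕜] 𝕜).contMDiff.contMDiffAt.comp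
      a hφa
  refine ⟨fun i => mk _ (hc i), fun f => ?_, fun w hw => ?_⟩
  · have hcoord : coord (fun i => mk _ (hc i)) =ᶠ[𝓝 a] fun p => (φ p).ofLp := by
      filter_upwards [Filter.eventually_all.2 fun i => rep_mk _ (hc i)] with p hp
      exact funext hp
    have hF : AnalyticAt 𝕜 (rep f ∘ φ.symm ∘ (WithLp.toLp 2 : (Fin n → 𝕜) → _))
        (coord (fun i => mk _ (hc i)) a) := by
      rw [hcoord.eq_of_nhds]
      have h1 : ContDiffAt 𝕜 ω (rep f ∘ φ.symm) (φ a) := by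
        rw [← contMDiffAt_iff_contDiffAt]
        exact (contMDiffAt_rep f).comp_of_eq contMDiffAt_extChartAt_symm (extChartAt_to_inv a)
      have h3 : ContDiffAt 𝕜 ω (WithLp.toLp 2 : (Fin n → 𝕜) → EuclideanSpace 𝕜 (Fin n))
          (φ a).ofLp := (PiLp.continuousLinearEquiv 2 𝕜 fun _ : Fin n => 𝕜).symm.contDiff.contDiffAt
      exact (ContDiffAt.comp (φ a).ofLp (g := rep f ∘ φ.symm) h1 h3).analyticAt
    refine germD_mem_span hF ?_
    filter_upwards [hcoord, extChartAt_source_mem_nhds (I := 𝓘(𝕜, EuclideanSpace 𝕜 (Fin n))) a]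
      with p hp hp'
    simp only [Function.comp_apply, hp, WithLp.toLp_ofLp, φ.left_inv hp']
  · obtain ⟨e, he⟩ := exists_hasMFDerivAt_extChartAt (𝕜 := 𝕜) (n := n) (a := a)
    refine (e.map_eq_zero_iff).1 ?_
    ext i
    have h1 : dAt n (rep (mk _ (hc i))) a = (EuclideanSpace.proj i :
        EuclideanSpace 𝕜 (Fin n) →L[𝕜] 𝕜).comp (e : _ →L[𝕜] EuclideanSpace 𝕜 (Fin n)) := by
      rw [dAt_congr (rep_mk _ (hc i))]
      exact (HasMFDerivAt.comp a ((EuclideanSpace.proj i :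
        EuclideanSpace 𝕜 (Fin n) →L[𝕜] 𝕜).hasFDerivAt (x := φ a)).hasMFDerivAt he).mfderiv
    have h2 := hw i
    rw [h1] at h2
    exact h2

variable {κ : Type*} [Fintype κ] {x : κ → germRing 𝕜 n a}

/-- A local inverse of a coordinate system. -/
theorem exists_localInverse (hx : IsCoordinateSystem (germD 𝕜 n a) x) :
    coord x a = 0 ∧ ∃ Φ : (κ → 𝕜) → X,
      ContMDiffAt 𝓘(𝕜, κ → 𝕜) 𝓘(𝕜, EuclideanSpace 𝕜 (Fin n)) ω Φ 0 ∧ Φ 0 = a ∧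
      (∀ᶠ y in 𝓝 0, coord x (Φ y) = y) ∧ ∀ᶠ p in 𝓝 a, Φ (coord x p) = p := by
  have hx0 : coord x a = 0 := funext fun i => mem_nonunits_iff.1 (hx.vanish i)
  refine ⟨hx0, ?_⟩
  obtain ⟨y, hy, hy'⟩ := exists_chart_coord (𝕜 := 𝕜) (n := n) (a := a)
  set φ := extChartAt 𝓘(𝕜, EuclideanSpace 𝕜 (Fin n)) a with hφ
  -- the derivative at `a` is injective
  have hinj : ∀ w, (∀ i, dAt n (rep (x i)) a w = 0) → w = 0 := by
    intro w hw
    refine hy' w fun j => ?_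
    obtain ⟨c, hc⟩ := Submodule.mem_span_range_iff_exists_fun _ |>.1 (hx.span (y j))
    rw [(germD_eq_sum_iff.1 hc.symm).self_of_nhds, _root_.sum_apply]
    exact Finset.sum_eq_zero fun i _ => by rw [_root_.smul_apply, hw, smul_zero]
  -- the `d x_i` are independent in a module generated by `n` elements
  have hcard : Fintype.card κ ≤ n := by
    classical
    have h1 : Set.range (fun i => germD 𝕜 n a (x i)) ≤
        Submodule.span (germRing 𝕜 n a) (Set.range fun i => germD 𝕜 n a (y i)) := by
      rintro _ ⟨i, rfl⟩
      exact hy (x i)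
    refine (linearIndependent_le_span_aux' _ hx.linearIndependent _ h1).trans ?_
    exact (Fintype.card_range_le _).trans (by simp)
  set h : EuclideanSpace 𝕜 (Fin n) → κ → 𝕜 := coord x ∘ φ.symm with hh
  have hdiff : ContDiffAt 𝕜 ω h (φ a) := by
    rw [← contMDiffAt_iff_contDiffAt]
    exact (contMDiffAt_coord x).comp_of_eq contMDiffAt_extChartAt_symm (extChartAt_to_inv a)
  have hleft : ∀ᶠ p in 𝓝 a, φ.symm (φ p) = p := by
    filter_upwards [extChartAt_source_mem_nhds (I := 𝓘(𝕜, EuclideanSpace 𝕜 (Fin n))) a] with p hp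
    exact φ.left_inv hp
  have hcomp : coord x =ᶠ[𝓝 a] h ∘ φ := by
    filter_upwards [hleft] with p hp
    simp only [hh, Function.comp_apply, hp]
  obtain ⟨e, he⟩ := exists_hasMFDerivAt_extChartAt (𝕜 := 𝕜) (n := n) (a := a)
  have hfd : HasFDerivAt h (fderiv 𝕜 h (φ a)) (φ a) := (hdiff.differentiableAt (by simp)).hasFDerivAt
  have hker : Function.Injective (fderiv 𝕜 h (φ a)) := by
    rw [injective_iff_map_eq_zero]
    intro w hw
    obtain ⟨w, rfl⟩ : ∃ w', e w' = w := e.surjective w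
    rw [hinj w, map_zero]
    intro i
    have h1 : dAt n (rep (x i)) a = ((ContinuousLinearMap.proj i : (κ → 𝕜) →L[𝕜] 𝕜).comp
        (fderiv 𝕜 h (φ a))).comp (e : _ →L[𝕜] EuclideanSpace 𝕜 (Fin n)) := by
      rw [dAt_congr (f := rep (x i)) (g := (fun p => h p i) ∘ φ)
        (hcomp.mono fun p hp => congrFun hp i)]
      exact (HasMFDerivAt.comp a ((hasFDerivAt_pi'.1 hfd i).hasMFDerivAt) he).mfderiv
    rw [h1]
    exact congrFun hw i
  have hfin : Module.finrank 𝕜 (EuclideanSpace 𝕜 (Fin n)) = Module.finrank 𝕜 (κ → 𝕜) := by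
    refine le_antisymm (LinearMap.finrank_le_finrank_of_injective
      (f := (fderiv 𝕜 h (φ a)).toLinearMap) hker) ?_
    simpa using hcard
  let f' : EuclideanSpace 𝕜 (Fin n) ≃L[𝕜] (κ → 𝕜) :=
    (LinearEquiv.ofInjectiveOfFinrankEq (fderiv 𝕜 h (φ a)).toLinearMap hker
      hfin).toContinuousLinearEquiv
  have hf' : HasFDerivAt h (f' : EuclideanSpace 𝕜 (Fin n) →L[𝕜] (κ → 𝕜)) (φ a) := by
    convert hfd using 1
    ext1 w
    rfl
  have hha : h (φ a) = 0 := by rw [← hx0, hcomp.eq_of_nhds]; rfl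
  have hs := hdiff.hasStrictFDerivAt' hf' (by simp)
  set ψ := hdiff.localInverse hf' (by simp) with hψ
  have hψ0 : ψ 0 = φ a := by rw [← hha]; exact hdiff.localInverse_apply_image hf' (by simp)
  have hψd : ContDiffAt 𝕜 ω ψ 0 := by
    have := hdiff.to_localInverse hf' (by simp)
    rwa [hha] at this
  refine ⟨φ.symm ∘ ψ, ?_, ?_, ?_, ?_⟩
  · have h1 : ContMDiffAt 𝓘(𝕜, EuclideanSpace 𝕜 (Fin n)) 𝓘(𝕜, EuclideanSpace 𝕜 (Fin n)) ω
        φ.symm (ψ 0) := by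
      rw [hψ0]
      exact contMDiffAt_extChartAt_symm
    exact h1.comp (0 : κ → 𝕜) hψd.contMDiffAt
  · rw [Function.comp_apply, hψ0]
    exact extChartAt_to_inv (I := 𝓘(𝕜, EuclideanSpace 𝕜 (Fin n))) a
  · have := hs.eventually_right_inverse
    rw [hha] at this
    exact this
  · have h1 : ∀ᶠ p in 𝓝 a, ψ (h (φ p)) = φ p :=
      (continuousAt_extChartAt (I := 𝓘(𝕜, EuclideanSpace 𝕜 (Fin n))) a).eventually
        hs.eventually_left_inverse
    filter_upwards [h1, hcomp, hleft] with p h1 h2 h3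
    rw [h2]
    simp only [Function.comp_apply] at h1 ⊢
    rw [h1, h3]

end LocalCoordinates

end HsiangPati.Analytic

namespace HsiangPati.Analytic

/-! ### The analytic model -/

section AnalyticModel

variable {𝕜 : Type*} [RCLike 𝕜] {n : ℕ} {X : Type*} [TopologicalSpace X]
  [ChartedSpace (EuclideanSpace 𝕜 (Fin n)) X] [IsManifold 𝓘(𝕜, EuclideanSpace 𝕜 (Fin n)) ω X]
  {a : X}

open germRing

section

variable {κ : Type*} [Fintype κ] {x : κ → germRing 𝕜 n a}
  (hx : IsCoordinateSystem (germD 𝕜 n a) x)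
include hx

theorem coord_self : coord x a = 0 := (exists_localInverse hx).1

theorem eventually_coord_iff {p : (κ → 𝕜) → Prop} :
    (∀ᶠ q in 𝓝 a, p (coord x q)) ↔ ∀ᶠ y in 𝓝 0, p y := by
  obtain ⟨hx0, Φ, hΦ, hΦ0, hl, -⟩ := exists_localInverse hx
  constructor
  · intro h
    have h1 : Filter.Tendsto Φ (𝓝 0) (𝓝 a) := by
      have := hΦ.continuousAt.tendsto
      rwa [hΦ0] at this
    filter_upwards [h1.eventually h, hl] with y h2 h3
    rwa [h3] at h2
  · intro h
    have h1 := (contMDiffAt_coord x).continuousAt.tendsto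
    rw [hx0] at h1
    exact h1.eventually h

/-- Every germ is an analytic function of given local coordinates. -/
theorem exists_analyticAt (f : germRing 𝕜 n a) :
    ∃ F : (κ → 𝕜) → 𝕜, AnalyticAt 𝕜 F 0 ∧ rep f =ᶠ[𝓝 a] F ∘ coord x := by
  obtain ⟨-, Φ, hΦ, hΦ0, -, hr⟩ := exists_localInverse hx
  refine ⟨rep f ∘ Φ, ?_, ?_⟩
  · have : ContMDiffAt 𝓘(𝕜, κ → 𝕜) 𝓘(𝕜, 𝕜) ω (rep f ∘ Φ) 0 :=
      (contMDiffAt_rep f).comp_of_eq hΦ hΦ0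
    exact (contMDiffAt_iff_contDiffAt.1 this).analyticAt
  · filter_upwards [hr] with p hp
    rw [Function.comp_apply, Function.comp_apply, hp]

theorem exists_germ {F : (κ → 𝕜) → 𝕜} (hF : AnalyticAt 𝕜 F 0) :
    ∃ f : germRing 𝕜 n a, rep f =ᶠ[𝓝 a] F ∘ coord x := by
  rw [← coord_self hx] at hF
  exact ⟨mk _ (contMDiffAt_comp_coord hF), rep_mk _ _⟩

variable [DecidableEq κ] {F : (κ → 𝕜) → 𝕜} (hF : AnalyticAt 𝕜 F 0) {f : germRing 𝕜 n a}
  (hf : rep f =ᶠ[𝓝 a] F ∘ coord x)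
include hF hf

theorem rep_partialDeriv (i : κ) :
    rep (hx.partialDeriv isExteriorDerivative_germD i f) =ᶠ[𝓝 a]
      (fun y => fderiv 𝕜 F y (Pi.single i 1)) ∘ coord x := by
  choose c hc using fun i => exists_germ hx (hF.fderiv_apply (Pi.single i 1))
  rw [← coord_self hx] at hF
  rw [hx.partialDeriv_eq isExteriorDerivative_germD (germD_comp_coord hF hf (c := c) fun j => by
    convert hc j)]
  exact hc i

/-- Divisibility by a coordinate means vanishing on the coordinate hyperplane. -/
theorem dvd_iff_eventually (i : κ) : x i ∣ f ↔ ∀ᶠ y in 𝓝 0, F (zeroAt i y) = 0 := by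
  constructor
  · rintro ⟨g, rfl⟩
    obtain ⟨G, hG, hg⟩ := exists_analyticAt hx g
    have h1 : ∀ᶠ y in 𝓝 0, F y = y i * G y := by
      rw [← eventually_coord_iff hx]
      filter_upwards [hf, hg, rep_mul (x i) g] with p h1 h2 h3
      rw [Function.comp_apply] at h1 h2
      rw [← h1, h3, h2]
      rfl
    filter_upwards [(tendsto_zeroAt i).eventually h1] with y hy
    rw [hy, zeroAt_apply, Function.update_self, zero_mul]
  · intro h
    obtain ⟨G, hG, hFG⟩ := hF.exists_eq_add_mul i
    obtain ⟨g, hg⟩ := exists_germ hx hG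
    refine ⟨g, eq_iff.2 ?_⟩
    have h1 : ∀ᶠ y in 𝓝 0, F y = y i * G y := by
      filter_upwards [h, hFG] with y h1 h2
      rw [h2, h1, zero_add]
    filter_upwards [hf, hg, rep_mul (x i) g, (eventually_coord_iff hx).2 h1] with p h1 h2 h3 h4
    rw [h1, h3, h2, Function.comp_apply, Function.comp_apply, h4]
    rfl

omit [DecidableEq κ] hF in
theorem eq_zero_iff_eventually : f = 0 ↔ ∀ᶠ y in 𝓝 0, F y = 0 := by
  rw [eq_iff, ← eventually_coord_iff hx]
  constructor
  · intro h
    filter_upwards [h, hf, rep_zero (𝕜 := 𝕜) (n := n) (a := a)] with p h1 h2 h3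
    rw [← Function.comp_apply (f := F), ← h2, h1, h3]
  · intro h
    filter_upwards [h, hf, rep_zero (𝕜 := 𝕜) (n := n) (a := a)] with p h1 h2 h3
    rw [h2, h3, Function.comp_apply, h1]

end

theorem _root_.AnalyticAt.eventually_fderiv_comm {κ : Type*} [Fintype κ] {F : (κ → 𝕜) → 𝕜}
    (hF : AnalyticAt 𝕜 F 0) (w w' : κ → 𝕜) :
    ∀ᶠ y in 𝓝 0, fderiv 𝕜 (fun z => fderiv 𝕜 F z w) y w' =
      fderiv 𝕜 (fun z => fderiv 𝕜 F z w') y w := by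
  filter_upwards [hF.eventually_analyticAt] with y hy
  have h1 : DifferentiableAt 𝕜 (fderiv 𝕜 F) y := hy.fderiv.differentiableAt
  have h2 : ∀ w, fderiv 𝕜 (fun z => fderiv 𝕜 F z w) y = (fderiv 𝕜 (fderiv 𝕜 F) y).flip w := by
    intro w
    have := h1.hasFDerivAt.clm_apply (hasFDerivAt_const w y)
    simpa using this.fderiv
  rw [h2, h2, ContinuousLinearMap.flip_apply, ContinuousLinearMap.flip_apply]
  exact hy.contDiffAt.isSymmSndFDerivAt (n := ω) (by simp) w' w

/-- Germs of analytic functions on a manifold. -/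
theorem isLogModel {ι : Type*} (E : ι → Set X) :
    IsLogModel (germD 𝕜 n a) (componentEqn 𝕜 n E a) where
  isExteriorDerivative := isExteriorDerivative_germD
  mul_eq_zero {κ} _ x hx i f h := by
    classical
    obtain ⟨F, hF, hf⟩ := exists_analyticAt hx f
    refine (eq_zero_iff_eventually hx hf).2 (eventually_eq_zero_of_mul hF i ?_)
    rw [← eventually_coord_iff hx]
    filter_upwards [rep_mul (x i) f, hf, eq_iff.1 h, rep_zero (𝕜 := 𝕜) (n := n) (a := a)]
      with p h1 h2 h3 h4
    rw [← Function.comp_apply (f := F), ← h2]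
    exact h1.symm.trans (h3.trans h4)
  dvd_of_dvd_mul {κ} _ x hx i j f hij h := by
    classical
    obtain ⟨F, hF, hf⟩ := exists_analyticAt hx f
    refine (dvd_iff_eventually hx hF hf i).2 (eventually_eq_zero_of_mul (hF.comp_zeroAt i) j ?_)
    have hG : AnalyticAt 𝕜 (fun y : κ → 𝕜 => y j * F y) 0 :=
      ((ContinuousLinearMap.proj j : (κ → 𝕜) →L[𝕜] 𝕜).analyticAt 0).mul hF
    have h1 : rep (x j * f) =ᶠ[𝓝 a] (fun y : κ → 𝕜 => y j * F y) ∘ coord x := by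
      filter_upwards [rep_mul (x j) f, hf] with p h1 h2
      rw [h1, h2]
      rfl
    filter_upwards [(dvd_iff_eventually hx hG h1 i).1 h] with y hy
    rwa [zeroAt_apply, Function.update_of_ne hij.symm, ← zeroAt_apply] at hy
  eq_zero_of_dvd {κ} _ x hx i f h h' := by
    classical
    obtain ⟨F, hF, hf⟩ := exists_analyticAt hx f
    refine (eq_zero_iff_eventually hx hf).2 ?_
    have h1 := (eq_zero_iff_eventually hx (rep_partialDeriv hx hF hf i)).1 h'
    filter_upwards [eventually_eq_zeroAt hF i h1, (dvd_iff_eventually hx hF hf i).1 h] with y h2 h3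
    rw [h2, h3]
  partialDeriv_comm {κ} _ x hx i j f := by
    classical
    obtain ⟨F, hF, hf⟩ := exists_analyticAt hx f
    have h1 := fun i j => rep_partialDeriv hx (hF.fderiv_apply _) (rep_partialDeriv hx hF hf i) j
    rw [eq_iff]
    filter_upwards [h1 j i, h1 i j, (eventually_coord_iff hx).2
      (hF.eventually_fderiv_comm (Pi.single j 1) (Pi.single i 1))] with p h2 h3 h4
    rw [h2, h3]
    exact h4
  eqn_mul i t ξ h hξ := by
    obtain ⟨f, hf, hf'⟩ := h
    refine ⟨rep (t * ξ), coe_rep _, ?_⟩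
    rw [← coe_rep, Filter.Germ.coe_eq] at hf
    filter_upwards [hf, hf', rep_mul t ξ,
      (contMDiffAt_rep ξ).continuousAt.eventually_ne (isUnit_iff.1 hξ)] with p h1 h2 h3 h4
    rw [h2, h3, ← h1, mul_eq_zero, or_iff_left h4]
  eqn_dvd {κ} _ x hx i l t h h' := by
    classical
    obtain ⟨F, hF, hf⟩ := exists_analyticAt hx t
    obtain ⟨g, hg, hg'⟩ := h
    obtain ⟨g', hg₁, hg₁'⟩ := h'
    rw [← coe_rep, Filter.Germ.coe_eq] at hg hg₁
    have h1 : ∀ᶠ y : κ → 𝕜 in 𝓝 0, y l = 0 → F y = 0 := by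
      rw [← eventually_coord_iff hx]
      filter_upwards [hg, hg', hg₁, hg₁', hf] with p h1 h2 h3 h4 h5 h6
      rw [← Function.comp_apply (f := F), ← h5, ← h3, ← h4, h2, h1]
      exact h6
    refine (dvd_iff_eventually hx hF hf l).2 ?_
    filter_upwards [(tendsto_zeroAt l).eventually h1] with y hy
    exact hy (by rw [zeroAt_apply, Function.update_self])

omit [IsManifold 𝓘(𝕜, EuclideanSpace 𝕜 (Fin n)) ω X] in
/-- A unit is a constant times a `p`-th power. -/
theorem exists_root {R : germRing 𝕜 n a} (hR : IsUnit R) {p : ℕ} (hp : 0 < p) :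
    ∃ (c : 𝕜) (t : germRing 𝕜 n a), R = const n a c * t ^ p := by
  have hc := isUnit_iff.1 hR
  -- take the root, near `1`, of the quotient of `R` by its value
  have hderiv : deriv (fun z : 𝕜 => z ^ p) 1 ≠ 0 := by
    simp [hp.ne']
  have han : AnalyticAt 𝕜 (fun z : 𝕜 => z ^ p) 1 := analyticAt_id.pow p
  have hinv := han.analyticAt_localInverse hderiv
  set ψ := han.hasStrictDerivAt.localInverse (fun z : 𝕜 => z ^ p) _ 1 hderiv with hψ
  have hroot : ∀ᶠ z in 𝓝 (1 : 𝕜), ψ z ^ p = z := by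
    have := HasStrictDerivAt.eventually_right_inverse (hf := han.hasStrictDerivAt) (hf' := hderiv)
    simp only [one_pow] at this
    exact this
  have hquot : ContMDiffAt 𝓘(𝕜, EuclideanSpace 𝕜 (Fin n)) 𝓘(𝕜, 𝕜) ω
      (fun q => (rep R a)⁻¹ * rep R q) a := contMDiffAt_const.mul (contMDiffAt_rep R)
  have h1 : (rep R a)⁻¹ * rep R a = 1 := inv_mul_cancel₀ hc
  have ht : ContMDiffAt 𝓘(𝕜, EuclideanSpace 𝕜 (Fin n)) 𝓘(𝕜, 𝕜) ω
      (fun q => ψ ((rep R a)⁻¹ * rep R q)) a := by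
    have h2 : ContDiffAt 𝕜 ω ψ ((rep R a)⁻¹ * rep R a) := by
      rw [h1]
      simpa using hinv.contDiffAt
    exact ContDiffAt.comp_contMDiffAt (f := fun q => (rep R a)⁻¹ * rep R q) h2 hquot
  refine ⟨rep R a, mk _ ht, ?_⟩
  have h3 : const n a (rep R a) * mk _ ht ^ p = mk _ ((contMDiffAt_const (c := rep R a)).mul (ht.pow p)) := rfl
  rw [h3, eq_iff]
  have h4 : ∀ᶠ q in 𝓝 a, ψ ((rep R a)⁻¹ * rep R q) ^ p = (rep R a)⁻¹ * rep R q := by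
    have := hquot.continuousAt.tendsto
    rw [h1] at this
    exact this.eventually hroot
  filter_upwards [h4, rep_mk _ ((contMDiffAt_const (c := rep R a)).mul (ht.pow p))] with q h4 h5
  rw [h5]
  simp only [Pi.mul_apply, h4, mul_inv_cancel_left₀ hc]

omit [IsManifold 𝓘(𝕜, EuclideanSpace 𝕜 (Fin n)) ω X] in
theorem sub_const_mem_nonunits (R : germRing 𝕜 n a) :
    R - const n a (rep R a) ∈ nonunits (germRing 𝕜 n a) := by
  rw [germRing.mem_nonunits_iff, (rep_sub _ _).eq_of_nhds, (rep_const _).eq_of_nhds, sub_self]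

omit [IsManifold 𝓘(𝕜, EuclideanSpace 𝕜 (Fin n)) ω X] in
theorem germD_const (c : 𝕜) : germD 𝕜 n a (const n a c) = 0 := by
  have h : germD 𝕜 n a (const n a c) = ∑ p : Fin 0, (Fin.elim0 p : germRing 𝕜 n a) •
      germD 𝕜 n a (Fin.elim0 p) := by
    rw [germD_eq_sum_iff]
    filter_upwards [(rep_const (n := n) (a := a) c).eventuallyEq_nhds] with y hy
    rw [dAt_congr hy, Finset.univ_eq_empty, Finset.sum_empty]
    exact mfderiv_const
  simpa using h

variable {N : ℕ}

/-- The germs of analytic functions, with given functions `f_m`. -/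
noncomputable def logModel {ι : Type*} (E : ι → Set X) (a : X) (f : Fin N → germRing 𝕜 n a) :
    LogModel N where
  O := germRing 𝕜 n a
  Ω := Filter.Germ (𝓝 a) (EuclideanSpace 𝕜 (Fin n) →L[𝕜] 𝕜)
  ι := {i // a ∈ E i}
  d := germD 𝕜 n a
  eqn := componentEqn 𝕜 n E a
  f := f
  isLogModel := isLogModel E

/-- No extensions are needed in the analytic case. -/
theorem isClosedFamily {ι : Type*} (E : ι → Set X) (f : Fin N → germRing 𝕜 n a) :
    LogModel.IsClosedFamily fun M => M = logModel E a f where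
  restrict := by
    classical
    rintro _ rfl s r u v huv i
    refine ⟨_, ⟨RingHom.id _, fun _ h => h, fun h => h, fun _ _ _ h => h, fun _ => rfl⟩, ?_⟩
    have hx : IsCoordinateSystem (germD 𝕜 n a) (Sum.elim u v) := huv.coordinates
    choose F hF hf using exists_analyticAt hx
    choose ρ hρ using fun R : germRing 𝕜 n a => exists_germ hx ((hF R).comp_zeroAt (.inl i))
    refine ⟨ρ, rfl, fun (R : germRing 𝕜 n a) => ⟨?_, ?_⟩⟩
    · have h1 : AnalyticAt 𝕜 (fun y => F R y - F R (zeroAt (.inl i) y)) 0 :=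
        (hF R).sub ((hF R).comp_zeroAt _)
      have h2 : rep (R - ρ R) =ᶠ[𝓝 a]
          (fun y => F R y - F R (zeroAt (.inl i) y)) ∘ coord (Sum.elim u v) := by
        filter_upwards [rep_sub R (ρ R), hf R, hρ R] with p h2 h3 h4
        rw [h2, h3, h4]
        rfl
      refine (dvd_iff_eventually hx h1 h2 (.inl i)).2 (Filter.Eventually.of_forall fun y => ?_)
      rw [zeroAt_apply, zeroAt_apply, Function.update_idem, sub_self]
    · refine (eq_zero_iff_eventually hx
        (rep_partialDeriv hx ((hF R).comp_zeroAt (.inl i)) (hρ R) (.inl i))).2 ?_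
      filter_upwards [((hF R).comp_zeroAt (.inl i)).eventually_analyticAt] with y hy
      have h1 := hy.differentiableAt.hasFDerivAt.comp_hasDerivAt_of_eq (y (.inl i))
        (hasDerivAt_update y (.inl i) (y (.inl i))) (by rw [Function.update_eq_self])
      refine h1.unique ?_
      convert hasDerivAt_const (y (.inl i)) (F R (zeroAt (.inl i) y)) using 1
      ext t
      simp [zeroAt_apply]
  const := by
    rintro _ rfl R -
    exact ⟨_, ⟨RingHom.id _, fun _ h => h, fun h => h, fun _ _ _ h => h, fun _ => rfl⟩,
      const n a (rep (𝕜 := 𝕜) (n := n) (a := a) R a), rfl, germD_const _,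
      sub_const_mem_nonunits (𝕜 := 𝕜) (n := n) (a := a) R⟩
  root := by
    rintro _ rfl R p - hR hp
    obtain ⟨c, t, h⟩ := exists_root (𝕜 := 𝕜) (n := n) (a := a) hR hp
    exact ⟨_, ⟨RingHom.id _, fun _ h => h, fun h => h, fun _ _ _ h => h, fun _ => rfl⟩,
      const n a c, t, rfl, germD_const _, h⟩

variable {M₀ : Type*} [TopologicalSpace M₀] [ChartedSpace (EuclideanSpace 𝕜 (Fin N)) M₀]
  [IsManifold 𝓘(𝕜, EuclideanSpace 𝕜 (Fin N)) ω M₀] {σ : X → M₀}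

omit [IsManifold 𝓘(𝕜, EuclideanSpace 𝕜 (Fin n)) ω X] in
theorem isPullback
    (hσ : ContMDiff 𝓘(𝕜, EuclideanSpace 𝕜 (Fin n)) 𝓘(𝕜, EuclideanSpace 𝕜 (Fin N)) ω σ) :
    IsPullback (germD 𝕜 n a) (germD 𝕜 N (σ a)) (pullback hσ a) N := by
  intro f c z h
  have hrep : ∀ g, rep (pullback hσ a g) =ᶠ[𝓝 a] rep g ∘ σ := by
    intro g
    rw [← Filter.Germ.coe_eq, coe_rep, pullback]
    dsimp only
    rw [← coe_rep]
    rfl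
  have hdiff : ∀ᶠ y in 𝓝 a, MDifferentiableAt 𝓘(𝕜, EuclideanSpace 𝕜 (Fin n))
      𝓘(𝕜, EuclideanSpace 𝕜 (Fin N)) σ y :=
    Filter.Eventually.of_forall fun y => (hσ y).mdifferentiableAt (by simp)
  have hcont : Filter.Tendsto σ (𝓝 a) (𝓝 (σ a)) := hσ.continuous.continuousAt
  have key : ∀ g, ∀ᶠ y in 𝓝 a, ∀ D : EuclideanSpace 𝕜 (Fin n) →L[𝕜] EuclideanSpace 𝕜 (Fin N),
      HasMFDerivAt 𝓘(𝕜, EuclideanSpace 𝕜 (Fin n)) 𝓘(𝕜, EuclideanSpace 𝕜 (Fin N)) σ y D →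
      dAt n (rep (pullback hσ a g)) y = (dAt N (rep g) (σ y)).comp D := by
    intro g
    filter_upwards [(hrep g).eventuallyEq_nhds, hcont.eventually (eventually_mdifferentiableAt g)]
      with y h1 h2 D hD
    rw [dAt_congr h1]
    exact (HasMFDerivAt.comp y h2.hasMFDerivAt hD).mfderiv
  rw [germD_eq_sum_iff] at h ⊢
  filter_upwards [hcont.eventually h, hdiff, key f, Filter.eventually_all.2 fun l => key (z l),
    Filter.eventually_all.2 fun l => hrep (c l)] with y h1 h2 h3 h4 h5
  obtain ⟨D, hD⟩ : ∃ D : EuclideanSpace 𝕜 (Fin n) →L[𝕜] EuclideanSpace 𝕜 (Fin N),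
      HasMFDerivAt 𝓘(𝕜, EuclideanSpace 𝕜 (Fin n)) 𝓘(𝕜, EuclideanSpace 𝕜 (Fin N)) σ y D :=
    ⟨_, h2.hasMFDerivAt⟩
  rw [h3 D hD, h1]
  ext1 w
  simp only [ContinuousLinearMap.comp_apply, _root_.sum_apply, _root_.smul_apply, h4 _ D hD, h5,
    Function.comp_apply]

/-- The equivalence for analytic manifolds. -/
theorem isPrincipalMonomial_iff_hasHsiangPatiForm {k : ℕ} (hk : 1 ≤ k) (hkn : k ≤ n)
    (hσ : ContMDiff 𝓘(𝕜, EuclideanSpace 𝕜 (Fin n)) 𝓘(𝕜, EuclideanSpace 𝕜 (Fin N)) ω σ)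
    {ι : Type*} (E : ι → Set X) (a : X) :
    (∀ j, 1 ≤ j → j ≤ k → IsPrincipalMonomial (germD 𝕜 n a) (componentEqn 𝕜 n E a)
      (logFittingIdeal (germD 𝕜 n a) (componentEqn 𝕜 n E a) (germD 𝕜 N (σ a)) (pullback hσ a)
        N n (n - j))) ↔
    HasHsiangPatiForm (germD 𝕜 n a) (componentEqn 𝕜 n E a) (germD 𝕜 N (σ a)) (pullback hσ a)
      N k := by
  constructor
  · intro h
    obtain ⟨s, r, u, v, huv, z, hz, h⟩ :=
      (isLogModel E).exists_logMinors_eq (isPullback hσ) hk hkn h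
    obtain ⟨M, rfl, s, r, l, l', A, u, v, μ, g, T, τ, huv, hform, hμ⟩ :=
      (isClosedFamily E fun m => pullback hσ a (z m)).hasPartialForm (k := k) rfl huv
        fun j hj hj' => ⟨s, r, u, v, huv, h j hj hj'⟩
    exact hform.hasHsiangPatiForm hz huv (hμ hk)
  · intro h j _ hj'
    exact h.isPrincipalMonomial (isLogModel E) (isPullback hσ) hj' hkn

end AnalyticModel

end HsiangPati.Analytic

namespace HsiangPati.Algebraic

/-! ### Noetherian local rings with derivations -/

section Krull

variable {O : Type*} [CommRing O] [IsLocalRing O] [IsNoetherianRing O]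

/-- Ideals of a noetherian local ring are closed in the adic topologies (Krull). -/
theorem mem_of_forall_mem_sup_pow {I J : Ideal O} (hJ : J ≠ ⊤) {f : O}
    (h : ∀ n, f ∈ I ⊔ J ^ n) : f ∈ I := by
  have h1 := Ideal.iInf_pow_smul_eq_bot_of_isLocalRing (M := O ⧸ I) J hJ
  rw [← Ideal.Quotient.eq_zero_iff_mem, ← Submodule.mem_bot (R := O), ← h1, Submodule.mem_iInf]
  intro n
  obtain ⟨a, ha, b, hb, rfl⟩ := Submodule.mem_sup.1 (h n)
  rw [_root_.map_add, Ideal.Quotient.eq_zero_iff_mem.2 ha, zero_add]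
  have : Ideal.Quotient.mk I b = b • (1 : O ⧸ I) := by
    rw [Algebra.smul_def, mul_one]; rfl
  rw [this]
  exact Submodule.smul_mem_smul hb trivial

theorem mem_of_forall_exists_sub_mem {I : Ideal O} {x : O} (hx : x ∈ nonunits O) {f : O}
    (h : ∀ n, ∃ g, f - x ^ n * g ∈ I) : f ∈ I := by
  refine mem_of_forall_mem_sup_pow (J := Ideal.span {x})
    (fun h => hx (Ideal.span_singleton_eq_top.1 h)) fun n => ?_
  obtain ⟨g, hg⟩ := h n
  rw [Ideal.span_singleton_pow]
  exact Submodule.mem_sup.2 ⟨_, hg, x ^ n * g, Ideal.mem_span_singleton.2 ⟨g, rfl⟩, by ring⟩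

variable [Algebra ℚ O]

omit [IsLocalRing O] [IsNoetherianRing O] in
theorem inv_succ_mul_succ (n : ℕ) : algebraMap ℚ O ((n + 1 : ℚ)⁻¹) * ((n + 1 : ℕ) : O) = 1 := by
  rw [← _root_.map_natCast (algebraMap ℚ O), ← _root_.map_mul, ← _root_.map_one (algebraMap ℚ O)]
  congr 1
  push_cast
  exact inv_mul_cancel₀ (by positivity)

variable (D : Derivation ℚ O O)

/-- A function with a derivation of value one on it is not a zero divisor modulo an ideal
stable under the derivation. -/
theorem mem_of_mul_mem {I : Ideal O} (hI : ∀ f ∈ I, D f ∈ I) {x : O} (hx : x ∈ nonunits O)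
    (hD : D x = 1) {f : O} (h : x * f ∈ I) : f ∈ I := by
  refine mem_of_forall_exists_sub_mem hx fun n => ?_
  induction n with
  | zero => exact ⟨f, by simp⟩
  | succ n ih =>
    obtain ⟨g, hg⟩ := ih
    have h1 : x ^ (n + 1) * g ∈ I := by
      have := I.sub_mem h (I.mul_mem_left x hg)
      rwa [show x * f - x * (f - x ^ n * g) = x ^ (n + 1) * g by ring] at this
    have h2 := hI _ h1
    rw [D.leibniz, D.leibniz_pow, hD] at h2
    simp only [smul_eq_mul, nsmul_eq_mul, Nat.add_sub_cancel, mul_one] at h2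
    refine ⟨-(algebraMap ℚ O ((n + 1 : ℚ)⁻¹) * D g), ?_⟩
    have h3 := inv_succ_mul_succ (O := O) n
    have h4 := I.add_mem hg (I.mul_mem_left (algebraMap ℚ O ((n + 1 : ℚ)⁻¹)) h2)
    convert h4 using 1
    linear_combination (-(x ^ n * g)) * h3

theorem eq_zero_of_mul_eq_zero {x : O} (hx : x ∈ nonunits O) (hD : D x = 1) {f : O}
    (h : x * f = 0) : f = 0 := by
  have := mem_of_mul_mem D (I := ⊥) (fun f hf => by rw [(hf : f = 0), _root_.map_zero]; rfl) hx hD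
    (f := f) h
  exact this

/-- A function divisible by `x` and independent of `x` vanishes. -/
theorem eq_zero_of_dvd_of_derivation {x : O} (hx : x ∈ nonunits O) (hD : D x = 1) {f : O}
    (h : x ∣ f) (h' : D f = 0) : f = 0 := by
  have hpow : ∀ (n : ℕ) (g : O), x ^ n * g = 0 → g = 0 := by
    intro n
    induction n with
    | zero => intro g hg; simpa using hg
    | succ n ih =>
      intro g hg
      refine ih g (eq_zero_of_mul_eq_zero D hx hD ?_)
      rw [← hg]; ring
  have key : ∀ n : ℕ, ∃ g, f = x ^ (n + 1) * g := by
    intro n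
    induction n with
    | zero =>
      obtain ⟨g, rfl⟩ := h
      exact ⟨g, by ring⟩
    | succ n ih =>
      obtain ⟨g, rfl⟩ := ih
      rw [D.leibniz, D.leibniz_pow, hD] at h'
      simp only [smul_eq_mul, nsmul_eq_mul, Nat.add_sub_cancel, mul_one] at h'
      have h2 : ((n + 1 : ℕ) : O) * g + x * D g = 0 := by
        refine hpow n _ ?_
        rw [← h']; ring
      have h3 := inv_succ_mul_succ (O := O) n
      refine ⟨-(algebraMap ℚ O ((n + 1 : ℚ)⁻¹) * D g), ?_⟩
      linear_combination (-(x ^ (n + 1) * g)) * h3 +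
        (x ^ (n + 1) * algebraMap ℚ O ((n + 1 : ℚ)⁻¹)) * h2
  have : f ∈ (⊥ : Ideal O) := mem_of_forall_exists_sub_mem hx fun n => by
    obtain ⟨g, hg⟩ := key n
    refine ⟨x * g, ?_⟩
    rw [hg, Submodule.mem_bot]; ring
  exact this

omit [IsLocalRing O] [IsNoetherianRing O] in
/-- In characteristic zero the radical of an ideal stable under a derivation is stable. -/
theorem derivation_mem_radical {I : Ideal O} (hI : ∀ f ∈ I, D f ∈ I) {f : O}
    (hf : f ∈ I.radical) : D f ∈ I.radical := by
  obtain ⟨n, hn⟩ := hf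
  have key : ∀ m k : ℕ, f ^ m * D f ^ k ∈ I → ∃ k', D f ^ k' ∈ I := by
    intro m
    induction m with
    | zero => intro k h; exact ⟨k, by simpa using h⟩
    | succ m ih =>
      intro k h
      refine ih (k + 2) ?_
      have h1 := hI _ h
      rw [D.leibniz, D.leibniz_pow, D.leibniz_pow] at h1
      simp only [smul_eq_mul, nsmul_eq_mul, Nat.add_sub_cancel] at h1
      have h2 : f ^ (m + 1) * (k * (D f ^ (k - 1) * D (D f))) * D f =
          (f ^ (m + 1) * D f ^ k) * (k * D (D f)) := by
        rcases k with _ | k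
        · simp
        · rw [Nat.add_sub_cancel]; ring
      have h3 := I.sub_mem (I.mul_mem_right (D f) h1) (h2 ▸ I.mul_mem_right (k * D (D f)) h)
      have h4 := inv_succ_mul_succ (O := O) m
      have h5 := I.mul_mem_left (algebraMap ℚ O ((m + 1 : ℚ)⁻¹)) h3
      convert h5 using 1
      linear_combination (-(f ^ m * D f ^ (k + 2))) * h4
  obtain ⟨k, hk⟩ := key n 0 (by simpa using hn)
  exact ⟨k, hk⟩

end Krull

section Model

variable {K O ι : Type*} [Field K] [CommRing O] [Algebra K O]

theorem isExteriorDerivative_D : IsExteriorDerivative (KaehlerDifferential.D K O) :=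
  ⟨_root_.map_add _, fun f g => (KaehlerDifferential.D K O).leibniz f g⟩

/-- A derivation vanishing on coordinates and constants is zero. -/
theorem derivation_eq_zero {κ : Type*} {x : κ → O}
    (hx : IsCoordinateSystem (KaehlerDifferential.D K O) x) {M : Type*} [AddCommGroup M]
    [Module O M] [Module K M] [IsScalarTower K O M] (δ : Derivation K O M) (h : ∀ i, δ (x i) = 0)
    (f : O) : δ f = 0 := by
  rw [← δ.liftKaehlerDifferential_comp_D f]
  have h1 : Submodule.span O (Set.range fun i => KaehlerDifferential.D K O (x i)) ≤
      LinearMap.ker δ.liftKaehlerDifferential := by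
    rw [Submodule.span_le]
    rintro _ ⟨i, rfl⟩
    simp [h]
  exact h1 (hx.span f)

variable [Algebra ℚ O] {κ : Type*} [Fintype κ] {x : κ → O}

theorem partialDeriv_algebraMap (hx : IsCoordinateSystem (KaehlerDifferential.D K O) x) (i : κ)
    (c : K) : hx.partialDeriv isExteriorDerivative_D i (algebraMap K O c) = 0 :=
  hx.partialDeriv_eq isExteriorDerivative_D (c := fun _ => 0) (by simp) i

theorem partialDeriv_comm (hx : IsCoordinateSystem (KaehlerDifferential.D K O) x) (i j : κ)
    (f : O) :
    hx.partialDeriv isExteriorDerivative_D i (hx.partialDeriv isExteriorDerivative_D j f) =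
      hx.partialDeriv isExteriorDerivative_D j (hx.partialDeriv isExteriorDerivative_D i f) := by
  classical
  let δ := ⁅hx.partialDeriv isExteriorDerivative_D i, hx.partialDeriv isExteriorDerivative_D j⁆
  have hδ : ∀ f, δ f = hx.partialDeriv isExteriorDerivative_D i
      (hx.partialDeriv isExteriorDerivative_D j f) - hx.partialDeriv isExteriorDerivative_D j
      (hx.partialDeriv isExteriorDerivative_D i f) := fun f => Derivation.commutator_apply f
  have hc : ∀ c : K, δ (algebraMap K O c) = 0 := by
    intro c
    rw [hδ, partialDeriv_algebraMap, partialDeriv_algebraMap, _root_.map_zero, _root_.map_zero,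
      sub_zero]
  let δ' : Derivation K O O := Derivation.mk'
    { toFun := δ
      map_add' := _root_.map_add δ
      map_smul' := fun c f => by
        simp only [Algebra.smul_def, RingHom.id_apply]
        rw [δ.leibniz, hc]; simp }
    δ.leibniz
  refine sub_eq_zero.1 ((hδ f).symm.trans (derivation_eq_zero hx δ' (fun l => ?_) f))
  refine (hδ _).trans ?_
  rw [hx.partialDeriv_coord, hx.partialDeriv_coord]
  split_ifs <;> simp

variable [IsLocalRing O] [IsNoetherianRing O]

/-- Noetherian local algebras over a field, with divisors given by ideals. -/
theorem isLogModel (I : ι → Ideal O) :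
    IsLogModel (KaehlerDifferential.D K O) fun i t => Ideal.span {t} = I i where
  isExteriorDerivative := isExteriorDerivative_D
  mul_eq_zero hx i y h := by
    classical
    exact eq_zero_of_mul_eq_zero (hx.partialDeriv isExteriorDerivative_D i) (hx.vanish i)
      (by rw [hx.partialDeriv_coord, if_pos rfl]) h
  dvd_of_dvd_mul {_} _ x hx i j y hij h := by
    classical
    rw [← Ideal.mem_span_singleton] at h ⊢
    refine mem_of_mul_mem (hx.partialDeriv isExteriorDerivative_D j) (fun f hf => ?_) (hx.vanish j)
      (by rw [hx.partialDeriv_coord, if_pos rfl]) h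
    obtain ⟨g, rfl⟩ := Ideal.mem_span_singleton.1 hf
    rw [Derivation.leibniz, hx.partialDeriv_coord, if_neg hij.symm, smul_zero, add_zero]
    exact Ideal.mul_mem_right _ _ (Ideal.mem_span_singleton_self _)
  eq_zero_of_dvd hx i y h h' := by
    classical
    exact eq_zero_of_dvd_of_derivation (hx.partialDeriv isExteriorDerivative_D i) (hx.vanish i)
      (by rw [hx.partialDeriv_coord, if_pos rfl]) h h'
  partialDeriv_comm := partialDeriv_comm
  eqn_mul i t ξ h hξ := by rw [Ideal.span_singleton_mul_right_unit hξ, h]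
  eqn_dvd _ i l t h h' := by
    rw [← Ideal.mem_span_singleton, h, ← h']
    exact Ideal.mem_span_singleton_self t

variable [Algebra.EssFiniteType K O]

omit [Algebra ℚ O] [Fintype κ] [IsNoetherianRing O] in
/-- Coordinates generate the maximal ideal: the quotient by them is a local ring unramified over
`K`. -/
theorem span_coordinates_eq (hx : IsCoordinateSystem (KaehlerDifferential.D K O) x) :
    Ideal.span (Set.range x) = IsLocalRing.maximalIdeal O := by
  set J := Ideal.span (Set.range x) with hJ
  have hle : J ≤ IsLocalRing.maximalIdeal O := by
    rw [hJ, Ideal.span_le]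
    rintro _ ⟨i, rfl⟩
    exact (IsLocalRing.mem_maximalIdeal _).2 (hx.vanish i)
  have : Nontrivial (O ⧸ J) := Ideal.Quotient.nontrivial_iff.2
    fun h => (IsLocalRing.maximalIdeal.isMaximal O).ne_top (top_le_iff.1 (h ▸ hle))
  have : IsLocalRing (O ⧸ J) :=
    IsLocalRing.of_surjective' (Ideal.Quotient.mk J) Ideal.Quotient.mk_surjective
  have h1 : ∀ f : O ⧸ J, KaehlerDifferential.D K (O ⧸ J) f = 0 := by
    intro f
    obtain ⟨f, rfl⟩ := Ideal.Quotient.mk_surjective f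
    refine derivation_eq_zero hx ((KaehlerDifferential.D K (O ⧸ J)).compAlgebraMap O) (fun i => ?_) f
    change KaehlerDifferential.D K (O ⧸ J) (Ideal.Quotient.mk J (x i)) = 0
    rw [Ideal.Quotient.eq_zero_iff_mem.2 (Ideal.subset_span (Set.mem_range_self i)), _root_.map_zero]
  have : Algebra.FormallyUnramified K (O ⧸ J) := by
    refine ⟨?_⟩
    rw [← Submodule.subsingleton_iff (O ⧸ J), ← subsingleton_iff_bot_eq_top, eq_comm,
      ← KaehlerDifferential.span_range_derivation, Submodule.span_eq_bot]
    rintro _ ⟨f, rfl⟩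
    exact h1 f
  have : Algebra.EssFiniteType K (O ⧸ J) := Algebra.EssFiniteType.comp K O (O ⧸ J)
  have : IsReduced (O ⧸ J) := Algebra.FormallyUnramified.isReduced_of_field K _
  have : Module.Finite K (O ⧸ J) := Algebra.FormallyUnramified.finite_of_free K (O ⧸ J)
  have : IsArtinianRing (O ⧸ J) := IsArtinianRing.of_finite K _
  have hf : IsField (O ⧸ J) := IsArtinianRing.isField_of_isReduced_of_isLocalRing _
  have : J.IsMaximal := Ideal.Quotient.maximal_of_isField _ hf
  exact IsLocalRing.eq_maximalIdeal this

/-- Coordinate hyperplanes are reduced. The radical of `(x_l)` is stable under the other partial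
derivatives, so that, by applying the Euler operator, its elements lie in `(x_l)` modulo ever higher
powers of the maximal ideal. -/
theorem isRadical_span_coordinate (hx : IsCoordinateSystem (KaehlerDifferential.D K O) x) (l : κ) :
    (Ideal.span {x l}).IsRadical := by
  classical
  set D := hx.partialDeriv isExteriorDerivative_D with hD
  set I := Ideal.span {x l} with hI
  have hI' : ∀ i ≠ l, ∀ f ∈ I, D i f ∈ I := by
    intro i hi f hf
    obtain ⟨g, rfl⟩ := Ideal.mem_span_singleton.1 hf
    rw [Derivation.leibniz, hD, hx.partialDeriv_coord, if_neg hi, smul_zero, add_zero]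
    exact Ideal.mem_span_singleton.2 ⟨_, rfl⟩
  have hm := span_coordinates_eq hx
  have hrad : I.radical ≤ IsLocalRing.maximalIdeal O := by
    rw [(IsLocalRing.maximalIdeal.isMaximal O).isPrime.radical_le_iff, hI,
      Ideal.span_singleton_le_iff_mem]
    exact (IsLocalRing.mem_maximalIdeal _).2 (hx.vanish l)
  set 𝔪 := IsLocalRing.maximalIdeal O with h𝔪
  -- the Euler operator multiplies forms of degree `n` by `n`
  set E := hx.vectorField isExteriorDerivative_D x with hE
  have hE' : ∀ f, E f = ∑ i, x i * D i f := fun f => hx.vectorField_apply isExteriorDerivative_D x f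
  have hx𝔪 : ∀ i, x i ∈ 𝔪 := fun i => (IsLocalRing.mem_maximalIdeal _).2 (hx.vanish i)
  have hE𝔪 : ∀ f, E f ∈ 𝔪 := fun f => by
    rw [hE']
    exact Ideal.sum_mem _ fun i _ => Ideal.mul_mem_right _ _ (hx𝔪 i)
  have euler_one : ∀ f ∈ 𝔪, E f - f ∈ 𝔪 ^ 2 := by
    intro f hf
    rw [← hm] at hf
    induction hf using Submodule.span_induction with
    | mem f hf =>
      obtain ⟨i, rfl⟩ := hf
      rw [hE, hx.vectorField_coord, sub_self]
      exact zero_mem _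
    | zero => simp
    | add f g _ _ hf hg =>
      convert add_mem hf hg using 1
      rw [_root_.map_add]; ring
    | smul c f hf h =>
      rw [smul_eq_mul, E.leibniz, smul_eq_mul, smul_eq_mul, add_sub_right_comm, ← mul_sub]
      refine add_mem (Ideal.mul_mem_left _ _ h) ?_
      rw [pow_two]
      exact Ideal.mul_mem_mul (hm ▸ hf) (hE𝔪 c)
  have euler : ∀ n : ℕ, ∀ f ∈ 𝔪 ^ n, E f - n * f ∈ 𝔪 ^ (n + 1) := by
    intro n
    induction n with
    | zero => intro f _; simpa using hE𝔪 f
    | succ n ih =>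
      intro f hf
      rw [pow_succ'] at hf
      refine Submodule.smul_induction_on hf (fun a ha b hb => ?_) fun a b ha hb => ?_
      · have h1 : E (a • b) - (n + 1 : ℕ) * (a • b) = a * (E b - n * b) + (E a - a) * b := by
          rw [smul_eq_mul, E.leibniz, smul_eq_mul, smul_eq_mul]; push_cast; ring
        rw [h1]
        refine add_mem ?_ ?_
        · rw [pow_succ' 𝔪 (n + 1)]
          exact Ideal.mul_mem_mul ha (ih b hb)
        · rw [show n + 1 + 1 = 2 + n by ring, pow_add]
          exact Ideal.mul_mem_mul (euler_one a ha) hb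
      · convert add_mem ha hb using 1
        rw [_root_.map_add]; ring
  have key : ∀ n : ℕ, I.radical ≤ I ⊔ 𝔪 ^ (n + 1) := by
    intro n
    induction n with
    | zero => rw [zero_add, pow_one]; exact hrad.trans le_sup_right
    | succ n ih =>
      intro f hf
      obtain ⟨a, ha, b, hb, rfl⟩ := Submodule.mem_sup.1 (ih hf)
      refine add_mem (Ideal.mem_sup_left ha) ?_
      have hbr : b ∈ I.radical := by
        have := sub_mem hf (Ideal.le_radical ha)
        rwa [add_sub_cancel_left] at this
      have h1 : E b ∈ I ⊔ 𝔪 ^ (n + 1 + 1) := by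
        rw [hE']
        refine Ideal.sum_mem _ fun i _ => ?_
        by_cases hi : i = l
        · subst hi
          exact Ideal.mem_sup_left (Ideal.mul_mem_right _ _ (Ideal.mem_span_singleton_self _))
        · obtain ⟨a', ha', b', hb', h⟩ :=
            Submodule.mem_sup.1 (ih (derivation_mem_radical (D i) (hI' i hi) hbr))
          rw [← h, mul_add]
          refine add_mem (Ideal.mem_sup_left (Ideal.mul_mem_left _ _ ha')) (Ideal.mem_sup_right ?_)
          rw [pow_succ' 𝔪 (n + 1)]
          exact Ideal.mul_mem_mul (hx𝔪 i) hb'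
      have h2 := sub_mem h1 (Ideal.mem_sup_right (S := I) (euler (n + 1) b hb))
      rw [sub_sub_cancel] at h2
      have h3 := Ideal.mul_mem_left _ (algebraMap ℚ O (((n + 1 : ℕ) : ℚ)⁻¹)) h2
      rwa [← mul_assoc, ← _root_.map_natCast (algebraMap ℚ O), ← _root_.map_mul,
        inv_mul_cancel₀ (by positivity), _root_.map_one, one_mul] at h3
  intro f hf
  refine mem_of_forall_mem_sup_pow (J := 𝔪) (IsLocalRing.maximalIdeal.isMaximal O).ne_top
    fun n => ?_
  have h1 : 𝔪 ^ (n + 1) ≤ 𝔪 ^ n := Ideal.pow_le_pow_right n.le_succ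
  exact sup_le_sup_left h1 I (key n hf)

end Model

end HsiangPati.Algebraic

namespace HsiangPati.Algebraic

/-! ### Coordinates and étale algebras -/

open scoped TensorProduct

section FormallyEtale

variable {K O : Type*} [Field K] [CommRing O] [Algebra K O] {κ : Type*} {x : κ → O}

theorem span_D_coordinates (hx : IsCoordinateSystem (KaehlerDifferential.D K O) x) :
    ⊤ ≤ Submodule.span O (Set.range fun i => KaehlerDifferential.D K O (x i)) := by
  rw [← KaehlerDifferential.span_range_derivation, Submodule.span_le]
  rintro _ ⟨f, rfl⟩
  exact hx.span f

/-- Coordinates remain coordinates in formally étale extensions. -/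
theorem isCoordinateSystem_algebraMap (hx : IsCoordinateSystem (KaehlerDifferential.D K O) x)
    {O' : Type*} [CommRing O'] [Algebra K O'] [Algebra O O'] [IsScalarTower K O O']
    [Algebra.FormallyEtale O O'] (h : ∀ i, algebraMap O O' (x i) ∈ nonunits O') :
    IsCoordinateSystem (KaehlerDifferential.D K O') fun i => algebraMap O O' (x i) := by
  let b := (Module.Basis.mk hx.linearIndependent (span_D_coordinates hx)).baseChange O'
  let b' := b.map (KaehlerDifferential.tensorKaehlerEquivOfFormallyEtale K O O')
  have hb' : ∀ i, b' i = KaehlerDifferential.D K O' (algebraMap O O' (x i)) := by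
    intro i
    simp [b', b]
  refine ⟨h, ?_, fun f => ?_⟩
  · convert b'.linearIndependent using 2 with i
    exact (hb' i).symm
  · simp only [← hb']
    rw [b'.span_eq]
    trivial

/-- Coordinates of a formally smooth algebra define a formally étale map to affine space (the
Jacobian criterion). -/
theorem formallyEtale_of_isCoordinateSystem
    (hx : IsCoordinateSystem (KaehlerDifferential.D K O) x) [Algebra.FormallySmooth K O]
    [Algebra (MvPolynomial κ K) O] [IsScalarTower K (MvPolynomial κ K) O]
    (h : ∀ i, algebraMap (MvPolynomial κ K) O (MvPolynomial.X i) = x i) :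
    Algebra.FormallyEtale (MvPolynomial κ K) O := by
  let b := Module.Basis.mk hx.linearIndependent (span_D_coordinates hx)
  let c := (KaehlerDifferential.mvPolynomialBasis K κ).baseChange O
  have hc : ∀ i, KaehlerDifferential.mapBaseChange K (MvPolynomial κ K) O (c i) = b i := by
    intro i
    have : KaehlerDifferential.mvPolynomialBasis K κ i =
        KaehlerDifferential.D K _ (MvPolynomial.X i) := by
      apply (KaehlerDifferential.mvPolynomialBasis K κ).repr.injective
      simp
    simp [c, b, this, h]
  have heq : KaehlerDifferential.mapBaseChange K (MvPolynomial κ K) O =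
      (c.equiv b (Equiv.refl κ)).toLinearMap := by
    refine c.ext fun i => ?_
    rw [hc]
    simp
  refine ⟨?_, ?_⟩
  · refine subsingleton_of_forall_eq 0 fun y => ?_
    obtain ⟨y, rfl⟩ := KaehlerDifferential.map_surjective K (MvPolynomial κ K) O y
    refine (KaehlerDifferential.exact_mapBaseChange_map K (MvPolynomial κ K) O y).2 ?_
    rw [heq]
    exact (c.equiv b (Equiv.refl κ)).surjective y
  · refine subsingleton_of_forall_eq 0 fun y => ?_
    have h1 : Algebra.H1Cotangent.δ K (MvPolynomial κ K) O y = 0 := by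
      have h2 := (Algebra.H1Cotangent.exact_δ_mapBaseChange K (MvPolynomial κ K) O
        (Algebra.H1Cotangent.δ K (MvPolynomial κ K) O y)).2 ⟨y, rfl⟩
      rw [heq] at h2
      exact (c.equiv b (Equiv.refl κ)).injective (h2.trans (_root_.map_zero _).symm)
    obtain ⟨z, rfl⟩ := (Algebra.H1Cotangent.exact_map_δ K (MvPolynomial κ K) O y).1 h1
    rw [Subsingleton.elim z 0, _root_.map_zero]

end FormallyEtale

/-! ### Étale maps to affine space -/

section Chart

variable {K : Type u} [Field K] {A : Type u} [CommRing A] [Algebra K A] [Algebra.FiniteType K A]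

/-- Coordinates at a point extend to an étale map from a neighbourhood to affine space. The
neighbourhood `B` is a localization of `A`, so that `A → B` is an epimorphism. -/
theorem exists_etale_aeval (P : Ideal A) [P.IsPrime] {O : Type u} [CommRing O] [Algebra A O]
    [Algebra K O] [IsScalarTower K A O] [IsLocalization.AtPrime O P] [Algebra.FormallySmooth K O]
    {κ : Type} [Finite κ] {x : κ → O} (hx : IsCoordinateSystem (KaehlerDifferential.D K O) x) :
    ∃ (B : Type u) (_ : CommRing B) (_ : Algebra A B) (_ : Algebra K B) (_ : IsScalarTower K A B)
      (_ : Algebra.Etale A B) (l : B →ₐ[A] O) (y : κ → B),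
      (∀ i, l (y i) = x i) ∧ (MvPolynomial.aeval y : MvPolynomial κ K →ₐ[K] B).toRingHom.Etale ∧
      ∀ (O' : Type u) [CommRing O'] (f g : B →+* O'),
        f.comp (algebraMap A B) = g.comp (algebraMap A B) → f = g := by
  -- `A₁ = A_s` contains the coordinates, and is étale over affine space at the point
  obtain ⟨⟨s, hs⟩, hsx⟩ := IsLocalization.exist_integer_multiples_of_finite P.primeCompl x
  choose a ha using hsx
  simp only [Algebra.smul_def] at ha
  let A₁ := Localization.Away s
  have hsu : IsUnit (algebraMap A O s) := IsLocalization.map_units O (⟨s, hs⟩ : P.primeCompl)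
  let l₁ : A₁ →+* O := IsLocalization.Away.lift s hsu
  have hl₁ : ∀ a, l₁ (algebraMap A A₁ a) = algebraMap A O a := IsLocalization.Away.lift_eq s hsu
  let y₁ : κ → A₁ := fun i => IsLocalization.mk' A₁ (a i) (⟨s, 1, pow_one s⟩ : Submonoid.powers s)
  have hy₁ : ∀ i, l₁ (y₁ i) = x i := by
    intro i
    refine hsu.mul_left_cancel ?_
    rw [← ha, ← hl₁ s, ← hl₁, ← _root_.map_mul]
    congr 1
    exact IsLocalization.mk'_spec' A₁ (a i) (⟨s, 1, pow_one s⟩ : Submonoid.powers s)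
  let : Algebra A₁ O := l₁.toAlgebra
  have : IsScalarTower A A₁ O := IsScalarTower.of_algebraMap_eq fun a => (hl₁ a).symm
  have : IsScalarTower K A₁ O := IsScalarTower.of_algebraMap_eq fun c => by
    rw [IsScalarTower.algebraMap_apply K A A₁, ← IsScalarTower.algebraMap_apply A A₁ O,
      ← IsScalarTower.algebraMap_apply]
  let : Algebra (MvPolynomial κ K) A₁ := (MvPolynomial.aeval y₁).toRingHom.toAlgebra
  have : IsScalarTower K (MvPolynomial κ K) A₁ :=
    IsScalarTower.of_algebraMap_eq fun c => ((MvPolynomial.aeval y₁).commutes c).symm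
  let : Algebra (MvPolynomial κ K) O :=
    ((algebraMap A₁ O).comp (algebraMap (MvPolynomial κ K) A₁)).toAlgebra
  have : IsScalarTower (MvPolynomial κ K) A₁ O := IsScalarTower.of_algebraMap_eq' rfl
  have : IsScalarTower K (MvPolynomial κ K) O := IsScalarTower.of_algebraMap_eq fun c => by
    rw [IsScalarTower.algebraMap_apply K A₁ O, IsScalarTower.algebraMap_apply K (MvPolynomial κ K) A₁]
    rfl
  have : Algebra.FormallyEtale (MvPolynomial κ K) O :=
    formallyEtale_of_isCoordinateSystem hx fun i => by
      rw [IsScalarTower.algebraMap_apply (MvPolynomial κ K) A₁ O]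
      refine Eq.trans ?_ (hy₁ i)
      exact congrArg l₁ (MvPolynomial.aeval_X y₁ i)
  have hle : Submonoid.powers s ≤ P.primeCompl := Submonoid.powers_le.2 hs
  have h1 := IsLocalization.isLocalization_of_submonoid_le A₁ O (Submonoid.powers s) P.primeCompl hle
  have : IsLocalRing O := IsLocalization.AtPrime.isLocalRing O P
  let P₁ : Ideal A₁ := (IsLocalRing.maximalIdeal O).comap (algebraMap A₁ O)
  have : IsLocalization.AtPrime O P₁ := by
    refine IsLocalization.of_le_of_exists_dvd (P.primeCompl.map (algebraMap A A₁)) _ ?_ ?_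
    · rintro _ ⟨t, ht, rfl⟩ h
      refine h ?_
      rw [← IsScalarTower.algebraMap_apply]
      exact IsLocalization.map_units O (⟨t, ht⟩ : P.primeCompl)
    · intro t ht
      obtain ⟨⟨b, s'⟩, hb⟩ := IsLocalization.surj (Submonoid.powers s) t
      refine ⟨algebraMap A A₁ b, ⟨b, ?_, rfl⟩, ⟨_, hb.symm⟩⟩
      intro hbP
      refine ht ?_
      have h2 : algebraMap A O b ∈ IsLocalRing.maximalIdeal O :=
        (IsLocalization.AtPrime.to_map_mem_maximal_iff O P b).2 hbP
      rw [IsScalarTower.algebraMap_apply A A₁ O, ← hb, _root_.map_mul] at h2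
      refine (Ideal.IsPrime.mem_or_mem inferInstance h2).resolve_right fun h3 => ?_
      exact h3 (((IsLocalization.map_units A₁ s').map (algebraMap A₁ O)))
  have : Algebra.IsEtaleAt (MvPolynomial κ K) P₁ := by
    have e : O ≃ₐ[A₁] Localization.AtPrime P₁ := IsLocalization.algEquiv P₁.primeCompl _ _
    exact Algebra.FormallyEtale.of_equiv (e.restrictScalars (MvPolynomial κ K))
  have : Algebra.FiniteType K A₁ := Algebra.FiniteType.trans (S := A) inferInstance inferInstance
  have : Algebra.FiniteType (MvPolynomial κ K) A₁ :=
    Algebra.FiniteType.of_restrictScalars_finiteType K _ _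
  have : Algebra.FinitePresentation (MvPolynomial κ K) A₁ :=
    Algebra.FinitePresentation.of_finiteType.1 inferInstance
  -- shrink `A₁` to `B`, where the map is étale everywhere
  obtain ⟨f, hf, hB⟩ := Algebra.exists_etale_of_isEtaleAt (R := MvPolynomial κ K) P₁
  let B := Localization.Away f
  have hfu : IsUnit (algebraMap A₁ O f) := by
    by_contra h
    exact hf h
  have h2 : Algebra.Etale A₁ B := Algebra.Etale.of_isLocalizationAway f
  have h3 : Algebra.Etale A A₁ := Algebra.Etale.of_isLocalizationAway s
  let l : B →+* O := IsLocalization.Away.lift f hfu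
  have hl : ∀ a, l (algebraMap A₁ B a) = l₁ a := IsLocalization.Away.lift_eq f hfu
  have : IsScalarTower A A₁ B := inferInstance
  refine ⟨B, inferInstance, inferInstance, inferInstance, inferInstance, .comp A A₁ B,
    { l with commutes' := fun a => ?_ }, fun i => algebraMap A₁ B (y₁ i), fun i => ?_, ?_,
    fun O' _ f' g h => ?_⟩
  · change l (algebraMap A B a) = _
    rw [IsScalarTower.algebraMap_apply A A₁ B, hl, hl₁]
  · exact (hl _).trans (hy₁ i)
  · have h4 : (MvPolynomial.aeval fun i => algebraMap A₁ B (y₁ i) :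
        MvPolynomial κ K →ₐ[K] B).toRingHom = algebraMap (MvPolynomial κ K) B := by
      refine MvPolynomial.ringHom_ext (fun c => ?_) fun i => ?_
      · change MvPolynomial.aeval _ (algebraMap K (MvPolynomial κ K) c) =
          algebraMap A₁ B (MvPolynomial.aeval y₁ (algebraMap K (MvPolynomial κ K) c))
        rw [AlgHom.commutes, AlgHom.commutes, ← IsScalarTower.algebraMap_apply]
      · change MvPolynomial.aeval _ (MvPolynomial.X i) =
          algebraMap A₁ B (MvPolynomial.aeval y₁ (MvPolynomial.X i))
        rw [MvPolynomial.aeval_X, MvPolynomial.aeval_X]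
    rw [h4]
    exact RingHom.etale_algebraMap.2 hB
  · refine IsLocalization.ringHom_ext (Submonoid.powers f)
      (IsLocalization.ringHom_ext (Submonoid.powers s) ?_)
    rwa [IsScalarTower.algebraMap_eq A A₁ B, ← RingHom.comp_assoc, ← RingHom.comp_assoc] at h

end Chart

/-! ### Étale extensions -/

section FibreProduct

variable {S B : Type u} [CommRing S] [CommRing B]

/-- The fibre product of an étale algebra with another algebra, with a point given by points of the
two factors. -/
theorem exists_fibreProduct_of_algebra {B₁ k : Type u} [CommRing B₁] [Algebra S B₁] [Algebra S B]
    [Algebra.Etale S B] [Field k] (m₁ : B₁ →+* k) (m : B →+* k)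
    (h : ∀ s, m₁ (algebraMap S B₁ s) = m (algebraMap S B s)) :
    ∃ (C : Type u) (_ : CommRing C) (i : B₁ →+* C) (j : B →+* C) (θ : C →+* k), i.Etale ∧
      (∀ s, j (algebraMap S B s) = i (algebraMap S B₁ s)) ∧ θ.comp i = m₁ ∧ θ.comp j = m := by
  let : Algebra S k := (m.comp (algebraMap S B)).toAlgebra
  let m' : B →ₐ[S] k := { m with commutes' := fun s => rfl }
  let m₁' : B₁ →ₐ[S] k := { m₁ with commutes' := fun s => h s }
  refine ⟨B₁ ⊗[S] B, inferInstance, algebraMap B₁ (B₁ ⊗[S] B),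
    (Algebra.TensorProduct.includeRight : B →ₐ[S] B₁ ⊗[S] B).toRingHom,
    (Algebra.TensorProduct.lift m₁' m' fun _ _ => .all _ _).toRingHom,
    RingHom.etale_algebraMap.2 inferInstance, fun s => ?_, ?_, ?_⟩
  · change (Algebra.TensorProduct.includeRight : B →ₐ[S] B₁ ⊗[S] B) (algebraMap S B s) = _
    rw [AlgHom.commutes, IsScalarTower.algebraMap_apply S B₁]
  · ext b
    simp [m₁']
  · ext b
    simp [m']

/-- The fibre product of an étale map `φ` with another map `φ₁` to the same space which agrees with
it at a point: it is étale over the source of `φ₁`, and contains a point over the diagonal. -/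
theorem exists_fibreProduct (φ φ₁ : S →+* B) (hφ : φ.Etale) (P : Ideal B) [P.IsPrime]
    (h : ∀ s, φ s - φ₁ s ∈ P) :
    ∃ (C : Type u) (_ : CommRing C) (i j : B →+* C) (Q : Ideal C) (_ : Q.IsPrime), i.Etale ∧
      (∀ s, j (φ s) = i (φ₁ s)) ∧ Q.comap i = P ∧ ∀ b, i b - j b ∈ Q := by
  let m : B →+* P.ResidueField := algebraMap B P.ResidueField
  have hm : ∀ b, m b = 0 ↔ b ∈ P := fun b => Ideal.algebraMap_residueField_eq_zero
  obtain ⟨C, _, i, j, θ, hi, hij, hθi, hθj⟩ := @exists_fibreProduct_of_algebra S B _ _ B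
    P.ResidueField _ φ₁.toAlgebra φ.toAlgebra hφ _ m m fun s => by
      refine (sub_eq_zero.1 ?_).symm
      rw [← _root_.map_sub]
      exact (hm _).2 (h s)
  refine ⟨C, inferInstance, i, j, RingHom.ker θ, RingHom.ker_isPrime θ, hi, hij, ?_, fun b => ?_⟩
  · ext b
    rw [Ideal.mem_comap, RingHom.mem_ker, ← hm, ← hθi]
    rfl
  · rw [RingHom.mem_ker, _root_.map_sub, sub_eq_zero]
    exact (RingHom.congr_fun hθi b).trans (RingHom.congr_fun hθj b).symm

/-- Functions on an étale cover are determined by their values at a point, modulo functions on the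
base. -/
theorem sub_mem_of_etale {O : Type*} [CommRing O] [IsLocalRing O] [IsNoetherianRing O]
    {φ : S →+* B} (hφ : φ.Etale) {J : Ideal O} (hJ : J ≤ IsLocalRing.maximalIdeal O)
    (f g : B →+* O) (h : ∀ s, f (φ s) - g (φ s) ∈ J)
    (h' : ∀ b, f b - g b ∈ IsLocalRing.maximalIdeal O) (b : B) : f b - g b ∈ J := by
  let : Algebra S B := φ.toAlgebra
  have : Algebra.Etale S B := hφ
  let : Algebra S (O ⧸ J) := (((Ideal.Quotient.mk J).comp g).comp φ).toAlgebra
  let f' : B →ₐ[S] O ⧸ J := { (Ideal.Quotient.mk J).comp f with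
    commutes' := fun s => Ideal.Quotient.eq.2 (h s) }
  let g' : B →ₐ[S] O ⧸ J := { (Ideal.Quotient.mk J).comp g with commutes' := fun s => rfl }
  have : Nontrivial (O ⧸ J) := Ideal.Quotient.nontrivial_iff.2
    fun h => (IsLocalRing.maximalIdeal.isMaximal O).ne_top (top_le_iff.1 (h ▸ hJ))
  have : IsLocalRing (O ⧸ J) :=
    IsLocalRing.of_surjective' (Ideal.Quotient.mk J) Ideal.Quotient.mk_surjective
  -- an étale algebra has at most one map to a separated local ring with given residues
  have heq : f' = g' := by
    refine Algebra.FormallyUnramified.ext_of_iInf (I := IsLocalRing.maximalIdeal (O ⧸ J))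
      (Ideal.iInf_pow_eq_bot_of_isLocalRing _ (IsLocalRing.maximalIdeal.isMaximal _).ne_top)
      fun b => ?_
    rw [Ideal.Quotient.eq]
    change Ideal.Quotient.mk J (f b) - Ideal.Quotient.mk J (g b) ∈ _
    rw [← _root_.map_sub, IsLocalRing.mem_maximalIdeal]
    intro hu
    refine (IsLocalRing.mem_maximalIdeal _).1 (h' b) ?_
    have : IsLocalHom (Ideal.Quotient.mk J) :=
      IsLocalHom.of_surjective _ Ideal.Quotient.mk_surjective
    exact isUnit_of_map_unit _ _ hu
  exact Ideal.Quotient.eq.1 (AlgHom.congr_fun heq b)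

/-- A derivation vanishing on functions on the base of an étale cover vanishes on those on the
cover. -/
theorem derivation_eq_zero_of_etale {O : Type*} [CommRing O] [Algebra ℚ O] (D : Derivation ℚ O O)
    {φ : S →+* B} (hφ : φ.Etale) (f : B →+* O) (h : ∀ s, D (f (φ s)) = 0) (b : B) :
    D (f b) = 0 := by
  let : Algebra S B := φ.toAlgebra
  have : Algebra.Etale S B := hφ
  let : Algebra B O := f.toAlgebra
  let : Module S O := Module.compHom O φ
  have : IsScalarTower S B O := ⟨fun s b o => by
    change f (φ s * b) * o = f (φ s) * (f b * o)
    rw [_root_.map_mul, mul_assoc]⟩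
  let D' : Derivation S B O := Derivation.mk'
    { toFun := fun b => D (f b)
      map_add' := fun a b => by rw [_root_.map_add, _root_.map_add]
      map_smul' := fun s b => by
        change D (f (φ s * b)) = f (φ s) * D (f b)
        rw [_root_.map_mul, D.leibniz, h]
        simp }
    fun a b => by
      change D (f (a * b)) = f a * D (f b) + f b * D (f a)
      rw [_root_.map_mul, D.leibniz]
      rfl
  change D' b = 0
  rw [← D'.liftKaehlerDifferential_comp_D b, Subsingleton.elim (KaehlerDifferential.D S B b) 0,
    _root_.map_zero]

/-- Étale-locally units have roots. -/
theorem exists_etale_root [Algebra ℚ B] (P : Ideal B) [P.IsPrime] {g : B} (hg : g ∉ P) {n : ℕ}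
    (hn : 0 < n) :
    ∃ (C : Type u) (_ : CommRing C) (i : B →+* C) (Q : Ideal C) (_ : Q.IsPrime) (t : C),
      i.Etale ∧ Q.comap i = P ∧ t ^ n = i g := by
  open Polynomial in
  let S : StandardEtalePair B :=
    { f := X ^ n - C g
      monic_f := monic_X_pow_sub_C g hn.ne'
      g := X
      cond := ⟨C (algebraMap ℚ B (n : ℚ)⁻¹), 0, n - 1, by
        have h1 : C ((n : B)) * C (algebraMap ℚ B (n : ℚ)⁻¹) = 1 := by
          rw [← C_mul, ← _root_.map_natCast (algebraMap ℚ B), ← _root_.map_mul,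
            mul_inv_cancel₀ (by positivity), _root_.map_one, C_1]
        rw [derivative_sub, derivative_X_pow, derivative_C, sub_zero, mul_zero, add_zero]
        linear_combination X ^ (n - 1) * h1⟩ }
  -- a root in an algebraic closure of the residue field gives a point over `P`
  let k := AlgebraicClosure P.ResidueField
  let m : B →+* k := (algebraMap P.ResidueField k).comp (algebraMap B P.ResidueField)
  have hm : ∀ b, m b = 0 ↔ b ∈ P := fun b => by
    rw [← Ideal.algebraMap_residueField_eq_zero (I := P)]
    exact _root_.map_eq_zero_iff _ (algebraMap P.ResidueField k).injective
  let : Algebra B k := m.toAlgebra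
  obtain ⟨c, hc⟩ := IsAlgClosed.exists_pow_nat_eq (m g) hn
  have hc0 : c ≠ 0 := by
    rintro rfl
    rw [zero_pow hn.ne'] at hc
    exact hg ((hm g).1 hc.symm)
  have hmap : S.HasMap c := by
    refine ⟨?_, ?_⟩
    · simp only [S, _root_.map_sub, _root_.map_pow, Polynomial.aeval_X, Polynomial.aeval_C, hc]
      exact sub_self _
    · simp only [S, Polynomial.aeval_X]
      exact isUnit_iff_ne_zero.2 hc0
  refine ⟨S.Ring, inferInstance, algebraMap B S.Ring, RingHom.ker (S.lift c hmap),
    RingHom.ker_isPrime _, S.X, RingHom.etale_algebraMap.2 inferInstance, ?_, ?_⟩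
  · ext b
    rw [Ideal.mem_comap, RingHom.mem_ker, AlgHom.commutes, ← hm]
    rfl
  · have := S.hasMap_X.1
    simp only [S, _root_.map_sub, _root_.map_pow, Polynomial.aeval_X, Polynomial.aeval_C] at this
    exact sub_eq_zero.1 this

end FibreProduct

end HsiangPati.Algebraic

namespace HsiangPati.Algebraic

/-! ### Restriction of functions and roots in étale neighbourhoods -/

section Extensions

variable {K : Type u} [Field K] {A : Type u} [CommRing A] [Algebra K A] [Algebra.FiniteType K A]
  (P : Ideal A) [P.IsPrime] {O : Type u} [CommRing O] [Algebra A O] [Algebra K O]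
  [IsScalarTower K A O] [IsLocalization.AtPrime O P]

theorem aeval_sub_aeval_mem {B : Type*} [CommRing B] [Algebra K B] {κ : Type*} (y y' : κ → B)
    {J : Ideal B} (h : ∀ i, y i - y' i ∈ J) (s : MvPolynomial κ K) :
    MvPolynomial.aeval y s - MvPolynomial.aeval y' s ∈ J := by
  rw [← Ideal.Quotient.eq]
  have : (Ideal.Quotient.mkₐ K J).comp (MvPolynomial.aeval y) =
      (Ideal.Quotient.mkₐ K J).comp (MvPolynomial.aeval y') := by
    refine MvPolynomial.algHom_ext fun i => ?_
    simp only [AlgHom.comp_apply, MvPolynomial.aeval_X]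
    exact Ideal.Quotient.eq.2 (h i)
  exact AlgHom.congr_fun this s

/-- After an étale extension functions can be restricted to the locus where some of the coordinates
vanish, as functions independent of these coordinates: the point has an étale neighbourhood which
maps to the given one by a map `ρ` compatible with the projection of affine space to the locus. -/
theorem exists_restriction [Algebra.FormallySmooth K O] {κ : Type} [Finite κ] {x : κ → O}
    (hx : IsCoordinateSystem (KaehlerDifferential.D K O) x) (H : Set κ) :
    ∃ (C : Type u) (_ : CommRing C) (i : A →+* C) (Q : Ideal C) (_ : Q.IsPrime), i.Etale ∧
      Q.comap i = P ∧ ∀ (O' : Type u) [CommRing O'] [IsLocalRing O'] [IsNoetherianRing O']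
        [Algebra ℚ O'] (c : C →+* O') (e : O →+* O'), (∀ t, t ∈ Q ↔ c t ∈ nonunits O') →
        e.comp (algebraMap A O) = c.comp i → ∃ ρ : O → O',
          (∀ R, e R - ρ R ∈ Ideal.span ((fun i => e (x i)) '' H)) ∧
          ∀ D : Derivation ℚ O' O', (∀ a, D (e (algebraMap K O a)) = 0) →
            (∀ l ∉ H, D (e (x l)) = 0) → ∀ R, D (ρ R) = 0 := by
  classical
  have : IsLocalRing O := IsLocalization.AtPrime.isLocalRing O P
  obtain ⟨B, _, _, _, _, hB, l, y, hy, hφ, hepi⟩ := exists_etale_aeval P hx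
  set φ := (MvPolynomial.aeval y : MvPolynomial κ K →ₐ[K] B).toRingHom with hφ'
  -- `φ₁` is the composite of `φ` with the projection to the locus where the `x_i`, `i ∈ H`, vanish
  let y' : κ → B := fun i => if i ∈ H then 0 else y i
  let φ₁ := (MvPolynomial.aeval y' : MvPolynomial κ K →ₐ[K] B).toRingHom
  let PB : Ideal B := (IsLocalRing.maximalIdeal O).comap l
  have hsub : ∀ s, φ s - φ₁ s ∈ Ideal.span (y '' H) := fun s => by
    refine aeval_sub_aeval_mem y y' (fun i => ?_) s
    by_cases hi : i ∈ H
    · simp only [y', if_pos hi, sub_zero]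
      exact Ideal.subset_span (Set.mem_image_of_mem y hi)
    · simp [y', if_neg hi]
  have hle : Ideal.span (y '' H) ≤ PB := by
    rw [Ideal.span_le]
    rintro _ ⟨i, -, rfl⟩
    change l (y i) ∈ IsLocalRing.maximalIdeal O
    rw [hy]
    exact (IsLocalRing.mem_maximalIdeal _).2 (hx.vanish i)
  obtain ⟨C, _, i, j, Q, hQ, hi, hij, hQi, hsubQ⟩ :=
    exists_fibreProduct φ φ₁ hφ PB fun s => hle (hsub s)
  have hPB : PB.comap (algebraMap A B) = P := by
    ext a
    change l (algebraMap A B a) ∈ IsLocalRing.maximalIdeal O ↔ _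
    rw [l.commutes]
    exact IsLocalization.AtPrime.to_map_mem_maximal_iff O P a
  refine ⟨C, inferInstance, i.comp (algebraMap A B), Q, hQ,
    RingHom.Etale.stableUnderComposition _ _ (RingHom.etale_algebraMap.2 hB) hi, ?_, ?_⟩
  · rw [← Ideal.comap_comap, hQi, hPB]
  intro O' _ _ _ _ c e hc he
  -- a function `b` is restricted to `j b`
  have hel : e.comp (l : B →+* O) = c.comp i := by
    refine hepi O' _ _ ?_
    rw [RingHom.comp_assoc, l.comp_algebraMap, he, RingHom.comp_assoc]
  have hel' : ∀ b, e (l b) = c (i b) := RingHom.congr_fun hel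
  set J := Ideal.span ((fun i => e (x i)) '' H) with hJ
  have hspan : ∀ b ∈ Ideal.span (y '' H), c (i b) ∈ J := by
    intro b hb
    have h1 := Ideal.mem_map_of_mem (c.comp i) hb
    rw [Ideal.map_span, Set.image_image] at h1
    have h2 : J = Ideal.span ((fun m => (c.comp i) (y m)) '' H) := by
      rw [hJ]
      congr 1
      refine Set.image_congr fun m _ => ?_
      rw [← hy, hel']
      rfl
    rwa [← h2] at h1
  have hJle : J ≤ IsLocalRing.maximalIdeal O' := by
    rw [hJ, Ideal.span_le]
    rintro _ ⟨m, -, rfl⟩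
    refine (IsLocalRing.mem_maximalIdeal _).2 ?_
    change e (x m) ∈ _
    rw [← hy, hel', ← hc, ← Ideal.mem_comap, hQi]
    change l (y m) ∈ IsLocalRing.maximalIdeal O
    rw [hy]
    exact (IsLocalRing.mem_maximalIdeal _).2 (hx.vanish m)
  have hB' : ∀ b, c (i b) - c (j b) ∈ J :=
    sub_mem_of_etale hφ hJle (c.comp i) (c.comp j) (fun s => by
      change c (i (φ s)) - c (j (φ s)) ∈ J
      rw [hij, ← _root_.map_sub, ← _root_.map_sub]
      exact hspan _ (hsub s)) fun b => by
      change c (i b) - c (j b) ∈ _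
      rw [← _root_.map_sub, IsLocalRing.mem_maximalIdeal]
      exact (hc _).1 (hsubQ b)
  have hunit : ∀ s : P.primeCompl, IsUnit ((c.comp j).comp (algebraMap A B) s) := by
    rintro ⟨s, hs⟩
    by_contra h
    have h1 : j (algebraMap A B s) ∈ Q := (hc _).2 h
    refine hs ?_
    change s ∈ P
    rw [← hPB, Ideal.mem_comap, ← hQi, Ideal.mem_comap]
    have := Q.add_mem (hsubQ (algebraMap A B s)) h1
    rwa [sub_add_cancel] at this
  let ρ : O →+* O' := IsLocalization.lift hunit
  have hρ : ∀ a, ρ (algebraMap A O a) = c (j (algebraMap A B a)) := IsLocalization.lift_eq hunit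
  refine ⟨ρ, fun R => ?_, fun D hD hD' R => ?_⟩
  · have h1 : (Ideal.Quotient.mk J).comp e = (Ideal.Quotient.mk J).comp ρ := by
      refine IsLocalization.ringHom_ext P.primeCompl ?_
      ext a
      change Ideal.Quotient.mk J (e (algebraMap A O a)) = Ideal.Quotient.mk J (ρ (algebraMap A O a))
      rw [hρ, Ideal.Quotient.eq, ← RingHom.comp_apply e, he]
      exact hB' _
    exact Ideal.Quotient.eq.1 (RingHom.congr_fun h1 R)
  · have h1 : ∀ s, D (c (i (φ₁ s))) = 0 := by
      intro s
      induction s using MvPolynomial.induction_on with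
      | C a =>
        have h2 : φ₁ (MvPolynomial.C a) = algebraMap A B (algebraMap K A a) := by
          rw [← IsScalarTower.algebraMap_apply]
          exact (MvPolynomial.aeval y').commutes a
        rw [h2, ← hel', l.commutes, ← IsScalarTower.algebraMap_apply, hD]
      | add p q hp hq => 
        rw [_root_.map_add, _root_.map_add, _root_.map_add, _root_.map_add, hp, hq, add_zero]
      | mul_X p m hp =>
        have h2 : D (c (i (φ₁ (MvPolynomial.X m)))) = 0 := by
          change D (c (i (MvPolynomial.aeval y' (MvPolynomial.X m)))) = 0
          rw [MvPolynomial.aeval_X]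
          by_cases hm : m ∈ H
          · simp [y', if_pos hm]
          · simp only [y', if_neg hm]
            rw [← hel', hy, hD' m hm]
        rw [_root_.map_mul, _root_.map_mul, _root_.map_mul, D.leibniz, hp, h2, smul_zero, smul_zero,
          add_zero]
    have h2 : ∀ a, D (ρ (algebraMap A O a)) = 0 := fun a => by
      rw [hρ]
      refine derivation_eq_zero_of_etale D hφ (c.comp j) (fun s => ?_) _
      change D (c (j (φ s))) = 0
      rw [hij, h1]
    obtain ⟨⟨a, s⟩, has⟩ := IsLocalization.surj P.primeCompl R
    have h3 := h2 a
    rw [← has, _root_.map_mul, D.leibniz, h2, smul_zero, zero_add, smul_eq_mul] at h3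
    refine ((hunit s).mul_right_eq_zero).1 ?_
    rw [← h3, hρ]
    rfl

omit [Algebra K A] [Algebra.FiniteType K A] [Algebra K O] [IsScalarTower K A O] in
/-- After an étale extension a unit has a root. -/
theorem exists_root [Algebra ℚ A] {R : O} (hR : IsUnit R) {n : ℕ} (hn : 0 < n) :
    ∃ (C : Type u) (_ : CommRing C) (i : A →+* C) (Q : Ideal C) (_ : Q.IsPrime), i.Etale ∧
      Q.comap i = P ∧ ∀ (O' : Type u) [CommRing O'] (c : C →+* O') (e : O →+* O'),
        e.comp (algebraMap A O) = c.comp i → ∃ t, e R = t ^ n := by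
  have : IsLocalRing O := IsLocalization.AtPrime.isLocalRing O P
  obtain ⟨⟨a, s⟩, has⟩ := IsLocalization.surj P.primeCompl R
  have ha : a ∉ P := by
    rw [← IsLocalization.AtPrime.to_map_mem_maximal_iff O P, ← has, IsLocalRing.mem_maximalIdeal]
    exact fun h => h (hR.mul (IsLocalization.map_units O s))
  have hg : a * (s : A) ^ (n - 1) ∉ P := fun h =>
    (Ideal.IsPrime.mem_or_mem inferInstance h).elim ha fun h =>
      s.2 (Ideal.IsPrime.mem_of_pow_mem inferInstance _ h)
  obtain ⟨C, _, i, Q, hQ, t, hi, hQi, ht⟩ := exists_etale_root P hg hn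
  refine ⟨C, inferInstance, i, Q, hQ, hi, hQi, fun O' _ c e he => ?_⟩
  have he' : ∀ a, e (algebraMap A O a) = c (i a) := RingHom.congr_fun he
  obtain ⟨w, hw⟩ := (IsLocalization.map_units O s).map e
  refine ⟨c t * ↑w⁻¹, ?_⟩
  rw [mul_pow, ← _root_.map_pow, ht, ← he', _root_.map_mul, ← has, _root_.map_mul, _root_.map_mul,
    _root_.map_pow, _root_.map_pow, ← hw, mul_assoc, mul_assoc, ← mul_assoc (w : O'), ← pow_succ',
    Nat.sub_add_cancel hn, ← mul_pow, Units.mul_inv, one_pow, mul_one]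

end Extensions

end HsiangPati.Algebraic

namespace HsiangPati.Algebraic
open AlgebraicGeometry

/-! ### Local rings of schemes -/

/-- The map from a ring to the local ring of its spectrum at a point. -/
noncomputable def toStalk (A : CommRingCat.{u}) (P : Spec A) : A ⟶ (Spec A).presheaf.stalk P :=
  (Scheme.ΓSpecIso A).inv ≫ (Spec A).presheaf.germ ⊤ P (TopologicalSpace.Opens.mem_top P)

theorem toStalk_stalkMap {A : CommRingCat.{u}} {X : Scheme.{u}} (f : X ⟶ Spec A) (a : X) :
    toStalk A (f a) ≫ f.stalkMap a =
      (Scheme.ΓSpecIso A).inv ≫ f.appTop ≫ X.presheaf.germ ⊤ a trivial := by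
  rw [toStalk, Category.assoc, Scheme.Hom.germ_stalkMap]
  rfl

theorem toStalk_stalkMap_specMap {A C : CommRingCat.{u}} (φ : A ⟶ C) (Q : Spec C) :
    toStalk A (Spec.map φ Q) ≫ (Spec.map φ).stalkMap Q = φ ≫ toStalk C Q := by
  rw [toStalk_stalkMap, ← Scheme.ΓSpecIso_inv_naturality_assoc]
  rfl

instance (A : CommRingCat.{u}) (P : Spec A) : P.asIdeal.IsPrime := P.isPrime

theorem isLocalization_toStalk (A : CommRingCat.{u}) (P : Spec A) :
    @IsLocalization.AtPrime A _ ((Spec A).presheaf.stalk P) _ (toStalk A P).hom.toAlgebra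
      P.asIdeal _ :=
  StructureSheaf.IsLocalization.to_stalk A P

variable {K : Type u} [Field K] {X U : Scheme.{u}}

theorem algebraMap_eq (p : X ⟶ Spec (.of K)) (a : X) :
    algebraMap K (LocalRing p a) = (toStalk (.of K) (p a) ≫ p.stalkMap a).hom := by
  rw [toStalk_stalkMap]
  rfl

theorem pullback_algebraMap {p : X ⟶ Spec (.of K)} {p' : U ⟶ Spec (.of K)} {g : U ⟶ X}
    (hg : g ≫ p = p') (b : U) (c : K) :
    pullback p' p g b (algebraMap K (LocalRing p (g b)) c) = algebraMap K (LocalRing p' b) c := by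
  subst hg
  rw [pullback]
  rw [algebraMap_eq, algebraMap_eq, Scheme.Hom.stalkMap_comp]
  rfl

theorem essFiniteType_toStalk (A : CommRingCat.{u}) (P : Spec A) :
    (toStalk A P).hom.EssFiniteType := by
  let := (toStalk A P).hom.toAlgebra
  have := isLocalization_toStalk A P
  exact Algebra.EssFiniteType.of_isLocalization _ P.asIdeal.primeCompl

theorem formallyEtale_toStalk (A : CommRingCat.{u}) (P : Spec A) :
    @Algebra.FormallyEtale A ((Spec A).presheaf.stalk P) _ _ (toStalk A P).hom.toAlgebra := by
  let := (toStalk A P).hom.toAlgebra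
  have := isLocalization_toStalk A P
  exact Algebra.FormallyEtale.of_isLocalization P.asIdeal.primeCompl

instance (p : X ⟶ Spec (.of K)) [LocallyOfFiniteType p] (a : X) :
    Algebra.EssFiniteType K (LocalRing p a) := by
  have h1 : (algebraMap K (LocalRing p a)).EssFiniteType := by
    rw [algebraMap_eq]
    exact (essFiniteType_toStalk (.of K) (p a)).comp (LocallyOfFiniteType.stalkMap p a)
  exact RingHom.essFiniteType_algebraMap.1 h1

instance (p : X ⟶ Spec (.of K)) [LocallyOfFiniteType p] (a : X) :
    IsNoetherianRing (LocalRing p a) :=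
  Algebra.EssFiniteType.isNoetherianRing K _

theorem formallySmooth_stalkMap (p : X ⟶ U) [Smooth p] (a : X) :
    (p.stalkMap a).hom.FormallySmooth := by
  rw [← Scheme.Hom.mem_smoothLocus, Scheme.Hom.smoothLocus_eq_top]
  trivial

instance (p : X ⟶ Spec (.of K)) [Smooth p] (a : X) :
    Algebra.FormallySmooth K (LocalRing p a) := by
  have h1 : (algebraMap K (LocalRing p a)).FormallySmooth := by
    rw [algebraMap_eq]
    let := (toStalk (.of K) (p a)).hom.toAlgebra
    have := formallyEtale_toStalk (.of K) (p a)
    refine RingHom.FormallySmooth.comp (f := (toStalk (.of K) (p a)).hom) ?_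
      (formallySmooth_stalkMap p a)
    exact Algebra.FormallyEtale.instFormallySmooth
  exact RingHom.formallySmooth_algebraMap.1 h1

noncomputable instance [CharZero K] (p : X ⟶ Spec (.of K)) (a : X) : Algebra ℚ (LocalRing p a) :=
  ((algebraMap K (LocalRing p a)).comp (algebraMap ℚ K)).toAlgebra

theorem formallyEtale_stalkMap (g : U ⟶ X) [Etale g] (b : U) :
    @Algebra.FormallyEtale _ _ _ _ (g.stalkMap b).hom.toAlgebra := by
  let := (g.stalkMap b).hom.toAlgebra
  have h1 : Algebra.FormallySmooth (X.presheaf.stalk (g b)) (U.presheaf.stalk b) :=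
    formallySmooth_stalkMap g b
  have h2 : Algebra.FormallyUnramified (X.presheaf.stalk (g b)) (U.presheaf.stalk b) :=
    FormallyUnramified.stalkMap g b
  exact Algebra.FormallyEtale.of_formallyUnramified_and_formallySmooth

theorem algebraMap_spec_eq {A : CommRingCat.{u}} (p : Spec A ⟶ Spec (.of K)) (P : Spec A) :
    algebraMap K (LocalRing p P) = (Spec.preimage p ≫ toStalk A P).hom := by
  obtain ⟨ψ, rfl⟩ := Spec.map_surjective p
  rw [algebraMap_eq, Spec.preimage_map, toStalk_stalkMap_specMap]

/-- Pull-back of a local equation which remains reduced. -/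
theorem span_singleton_eq_vanishingIdeal {R S : Type*} [CommRing R] [CommRing S] (φ : R →+* S)
    {W : Set (PrimeSpectrum R)} (hW : IsClosed W) {t : R}
    (ht : Ideal.span {t} = PrimeSpectrum.vanishingIdeal W) (hrad : (Ideal.span {φ t}).IsRadical) :
    Ideal.span {φ t} = PrimeSpectrum.vanishingIdeal (PrimeSpectrum.comap φ ⁻¹' W) := by
  have h1 : W = PrimeSpectrum.zeroLocus {t} := by
    rw [← PrimeSpectrum.zeroLocus_span, ht, PrimeSpectrum.zeroLocus_vanishingIdeal_eq_closure,
      hW.closure_eq]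
  rw [h1, PrimeSpectrum.preimage_comap_zeroLocus, Set.image_singleton,
    ← PrimeSpectrum.zeroLocus_span, PrimeSpectrum.vanishingIdeal_zeroLocus_eq_radical, hrad.radical]

section Pullback

variable {p : X ⟶ Spec (.of K)} {p' : U ⟶ Spec (.of K)} {g : U ⟶ X} (hg : g ≫ p = p') (b : U)

instance : IsLocalHom (pullback p' p g b) := inferInstanceAs (IsLocalHom (g.stalkMap b).hom)

theorem pullback_mem_nonunits {t : LocalRing p (g b)} (ht : t ∈ nonunits _) :
    pullback p' p g b t ∈ nonunits (LocalRing p' b) :=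
  fun h => ht (isUnit_of_map_unit (pullback p' p g b) t h)

include hg in
theorem D_pullback_eq_sum {κ : Type*} [Fintype κ] {f : LocalRing p (g b)}
    {c z : κ → LocalRing p (g b)}
    (h : KaehlerDifferential.D K (LocalRing p (g b)) f =
      ∑ l, c l • KaehlerDifferential.D K (LocalRing p (g b)) (z l)) :
    KaehlerDifferential.D K (LocalRing p' b) (pullback p' p g b f) =
      ∑ l, pullback p' p g b (c l) •
        KaehlerDifferential.D K (LocalRing p' b) (pullback p' p g b (z l)) := by
  let : Algebra (LocalRing p (g b)) (LocalRing p' b) := (pullback p' p g b).toAlgebra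
  have : IsScalarTower K (LocalRing p (g b)) (LocalRing p' b) :=
    IsScalarTower.of_algebraMap_eq fun c => (pullback_algebraMap hg b c).symm
  have h1 := congrArg (KaehlerDifferential.map K K (LocalRing p (g b)) (LocalRing p' b)) h
  simp only [KaehlerDifferential.map_D, _root_.map_sum, _root_.map_smul] at h1
  refine h1.trans (Finset.sum_congr rfl fun l _ => ?_)
  exact (algebraMap_smul (LocalRing p' b) (c l) (KaehlerDifferential.D K (LocalRing p' b)
    (algebraMap (LocalRing p (g b)) (LocalRing p' b) (z l)))).symm

include hg in
theorem isPullback_pullback (N : ℕ) :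
    IsPullback (KaehlerDifferential.D K (LocalRing p' b))
      (KaehlerDifferential.D K (LocalRing p (g b))) (pullback p' p g b) N :=
  fun _ _ _ h => D_pullback_eq_sum hg b h

include hg in
theorem isCoordinateSystem_pullback [Etale g] {κ : Type*} {x : κ → LocalRing p (g b)}
    (hx : IsCoordinateSystem (KaehlerDifferential.D K (LocalRing p (g b))) x) :
    IsCoordinateSystem (KaehlerDifferential.D K (LocalRing p' b))
      fun i => pullback p' p g b (x i) := by
  let : Algebra (LocalRing p (g b)) (LocalRing p' b) := (pullback p' p g b).toAlgebra
  have : IsScalarTower K (LocalRing p (g b)) (LocalRing p' b) :=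
    IsScalarTower.of_algebraMap_eq fun c => (pullback_algebraMap hg b c).symm
  have : Algebra.FormallyEtale (LocalRing p (g b)) (LocalRing p' b) := formallyEtale_stalkMap g b
  exact isCoordinateSystem_algebraMap hx fun i => pullback_mem_nonunits b (hx.vanish i)

/-- A local equation pulls back to a local equation if it remains reduced. -/
theorem isLocalEquation_pullback {Z : Set X} (hZ : IsClosed Z) {t : LocalRing p (g b)}
    (ht : IsLocalEquation p (g b) Z t) (hrad : (Ideal.span {pullback p' p g b t}).IsRadical) :
    IsLocalEquation p' b (g ⁻¹' Z) (pullback p' p g b t) := by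
  have h1 : IsClosed (X.fromSpecStalk (g b) ⁻¹' Z) :=
    hZ.preimage (X.fromSpecStalk (g b)).continuous
  have h2 : X.fromSpecStalk (g b) ∘ Spec.map (g.stalkMap b) = g ∘ U.fromSpecStalk b := by
    funext y
    exact congrArg (fun f : Spec (U.presheaf.stalk b) ⟶ X => f y)
      (Scheme.SpecMap_stalkMap_fromSpecStalk g (x := b))
  refine (span_singleton_eq_vanishingIdeal (g.stalkMap b).hom h1 ht hrad).trans ?_
  refine congrArg PrimeSpectrum.vanishingIdeal ?_
  change Spec.map (g.stalkMap b) ⁻¹' (X.fromSpecStalk (g b) ⁻¹' Z) = _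
  rw [← Set.preimage_comp, h2, Set.preimage_comp]
  rfl

include hg in
/-- Adapted coordinates remain adapted in étale neighbourhoods. -/
theorem isAdapted_pullback [CharZero K] [LocallyOfFiniteType p'] [Etale g] {ι : Type*}
    {E : ι → Set X} (hE : ∀ i, IsClosed (E i)) {s r : ℕ} {u : Fin s → LocalRing p (g b)}
    {v : Fin r → LocalRing p (g b)}
    (huv : IsAdapted (KaehlerDifferential.D K (LocalRing p (g b))) (componentEqn p E (g b)) u v) :
    IsAdapted (KaehlerDifferential.D K (LocalRing p' b))
      (componentEqn p' (fun i => g ⁻¹' E i) b) (pullback p' p g b ∘ u) (pullback p' p g b ∘ v) := by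
  have hx : IsCoordinateSystem (KaehlerDifferential.D K (LocalRing p' b))
      (Sum.elim (pullback p' p g b ∘ u) (pullback p' p g b ∘ v)) := by
    rw [← Sum.comp_elim]
    exact isCoordinateSystem_pullback hg b huv.coordinates
  obtain ⟨e, he⟩ := huv.components
  exact ⟨hx, e, fun i => isLocalEquation_pullback b (hE _) (he i)
    (isRadical_span_coordinate hx (.inl i))⟩

theorem pullback_pullback {V : Scheme.{u}} (h : V ⟶ U) (p'' : V ⟶ Spec (.of K)) (c : V)
    (t : LocalRing p ((h ≫ g) c)) :
    pullback p'' p (h ≫ g) c t = pullback p'' p' h c (pullback p' p g (h c) t) := by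
  have := congrArg (fun f => f.hom t) (Scheme.Hom.stalkMap_comp h g c)
  exact this

end Pullback

end HsiangPati.Algebraic

namespace HsiangPati.Algebraic
open AlgebraicGeometry

/-! ### Models on étale neighbourhoods -/

variable {K : Type u} [Field K] [CharZero K] {X U : Scheme.{u}} {N : ℕ} {ι : Type w₅}

theorem isLogModel_componentEqn (p : X ⟶ Spec (.of K)) [LocallyOfFiniteType p] (E : ι → Set X)
    (a : X) : IsLogModel (KaehlerDifferential.D K (LocalRing p a)) (componentEqn p E a) := by
  let I : {i // a ∈ E i} → Ideal (LocalRing p a) := fun i =>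
    show Ideal (X.presheaf.stalk a) from PrimeSpectrum.vanishingIdeal (X.fromSpecStalk a ⁻¹' E i)
  exact isLogModel I

/-- The local ring of a scheme at a point, with its Kähler differentials, the divisor `E` and the
functions `F`. -/
noncomputable def model (p : X ⟶ Spec (.of K)) [LocallyOfFiniteType p] (a : X) (E : ι → Set X)
    (F : Fin N → LocalRing p a) : LogModel.{u, u, w₅} N where
  O := LocalRing p a
  Ω := Ω[LocalRing p a⁄K]
  ι := {i // a ∈ E i}
  d := KaehlerDifferential.D K (LocalRing p a)
  eqn := componentEqn p E a
  f := F
  isLogModel := isLogModel_componentEqn p E a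

/-- Pull-back of functions by an étale morphism. -/
noncomputable def modelExt {p : X ⟶ Spec (.of K)} {p' : U ⟶ Spec (.of K)} [LocallyOfFiniteType p]
    [LocallyOfFiniteType p'] {g : U ⟶ X} [Etale g] (hg : g ≫ p = p') (b : U) {E : ι → Set X}
    (hE : ∀ i, IsClosed (E i)) {F : Fin N → LocalRing p (g b)} {F' : Fin N → LocalRing p' b}
    (hF : ∀ m, pullback p' p g b (F m) = F' m) :
    LogModel.Ext (model p (g b) E F) (model p' b (fun i => g ⁻¹' E i) F') where
  hom := pullback p' p g b
  mem_nonunits _ ht := pullback_mem_nonunits b ht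
  isAdapted huv := isAdapted_pullback hg b hE huv
  d_hom _ _ _ h := D_pullback_eq_sum hg b h
  hom_f := hF

/-- The models given by the affine étale neighbourhoods of a point `a`. -/
inductive IsEtaleModel (p : X ⟶ Spec (.of K)) [LocallyOfFiniteType p] (E : ι → Set X) :
    (a : X) → (Fin N → LocalRing p a) → LogModel.{u, u, w₅} N → Prop
  | mk (A : CommRingCat.{u}) (f : Spec A ⟶ X) [Etale f] (P : Spec A)
      (F : Fin N → LocalRing p (f P)) :
      IsEtaleModel p E (f P) F (model (f ≫ p) P (fun i => f ⁻¹' E i)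
        fun m => pullback (f ≫ p) p f P (F m))

/-- An étale algebra over the ring of an affine étale neighbourhood gives an extension. -/
theorem exists_ext (p : X ⟶ Spec (.of K)) [LocallyOfFiniteType p] {E : ι → Set X}
    (hE : ∀ i, IsClosed (E i)) {A : CommRingCat.{u}} (f : Spec A ⟶ X) [Etale f] (P : Spec A)
    (F : Fin N → LocalRing p (f P)) {C : Type u} [CommRing C] {i : A →+* C} (hi : i.Etale)
    {Q : Ideal C} [hQ : Q.IsPrime] (hQP : Q.comap i = P.asIdeal) :
    ∃ (M' : LogModel.{u, u, w₅} N) (e : LogModel.Ext (model (f ≫ p) P (fun i => f ⁻¹' E i)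
        fun m => pullback (f ≫ p) p f P (F m)) M') (c : C →+* M'.O),
      IsEtaleModel p E (f P) F M' ∧ IsNoetherianRing M'.O ∧ (∀ t, t ∈ Q ↔ c t ∈ nonunits M'.O) ∧
      e.hom.comp (toStalk A P).hom = c.comp i ∧
      ∀ x : K, M'.d (e.hom (algebraMap K (LocalRing (f ≫ p) P) x)) = 0 := by
  let φ : A ⟶ CommRingCat.of C := CommRingCat.ofHom i
  let Q' : Spec (.of C) := ⟨Q, hQ⟩
  have hφ : Etale (Spec.map φ) := HasRingHomProperty.Spec_iff.2 hi
  obtain rfl : Spec.map φ Q' = P := PrimeSpectrum.ext hQP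
  refine ⟨model ((Spec.map φ ≫ f) ≫ p) Q' (fun i => (Spec.map φ ≫ f) ⁻¹' E i)
    fun m => pullback ((Spec.map φ ≫ f) ≫ p) p (Spec.map φ ≫ f) Q' (F m),
    modelExt (g := Spec.map φ) (Category.assoc _ _ _).symm Q' (fun i => (hE i).preimage f.continuous)
      fun m => ?_, (toStalk (.of C) Q').hom, ?_, ?_, ?_, ?_, ?_⟩
  · exact (pullback_pullback (Spec.map φ) _ Q' (F m)).symm
  · exact .mk (.of C) (Spec.map φ ≫ f) Q' F
  · exact inferInstanceAs (IsNoetherianRing (LocalRing ((Spec.map φ ≫ f) ≫ p) Q'))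
  · intro t
    let := (toStalk (.of C) Q').hom.toAlgebra
    have := isLocalization_toStalk (.of C) Q'
    refine (IsLocalization.AtPrime.to_map_mem_maximal_iff
      ((Spec (.of C)).presheaf.stalk Q') Q'.asIdeal t).symm.trans ?_
    exact IsLocalRing.mem_maximalIdeal _
  · exact congrArg CommRingCat.Hom.hom (toStalk_stalkMap_specMap φ Q')
  · intro x
    change KaehlerDifferential.D K _ (pullback _ _ (Spec.map φ) Q' _) = 0
    rw [pullback_algebraMap (Category.assoc _ _ _).symm]
    exact Derivation.map_algebraMap _ _

omit [CharZero K] in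
/-- The ring of an affine étale neighbourhood of a smooth variety, with its local ring. -/
theorem exists_algebra {A : CommRingCat.{u}} (p : Spec A ⟶ Spec (.of K)) [Smooth p] (P : Spec A) :
    ∃ (_ : Algebra K A) (_ : Algebra A (LocalRing p P)),
      algebraMap A (LocalRing p P) = (toStalk A P).hom ∧
      Algebra.FiniteType K A ∧ IsScalarTower K A (LocalRing p P) ∧
      IsLocalization.AtPrime (LocalRing p P) P.asIdeal := by
  let := (Spec.preimage p).hom.toAlgebra
  let : Algebra A (LocalRing p P) := (toStalk A P).hom.toAlgebra
  refine ⟨inferInstance, inferInstance, rfl, ?_, ?_, isLocalization_toStalk A P⟩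
  · have h : LocallyOfFiniteType (Spec.map (Spec.preimage p)) := by
      rw [Spec.map_preimage]; infer_instance
    exact HasRingHomProperty.Spec_iff.1 h
  · refine IsScalarTower.of_algebraMap_eq' ?_
    rw [algebraMap_spec_eq]
    rfl

/-- Étale neighbourhoods are closed under the extensions needed: functions are restricted to
coordinate hyperplanes, or to the point itself, by means of `exists_restriction`. -/
theorem isClosedFamily (p : X ⟶ Spec (.of K)) [Smooth p] {E : ι → Set X}
    (hE : ∀ i, IsClosed (E i)) (a : X) (F : Fin N → LocalRing p a) :
    LogModel.IsClosedFamily (IsEtaleModel p E a F) where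
  restrict M hM s r u v huv i := by
    cases hM with
    | mk A f P F =>
    obtain ⟨_, _, hA, _, _, _⟩ := exists_algebra (f ≫ p) P
    have hx : IsCoordinateSystem (KaehlerDifferential.D K (LocalRing (f ≫ p) P))
      (Sum.elim u v : _ → LocalRing (f ≫ p) P) := huv.coordinates
    obtain ⟨C, _, j, Q, _, hj, hQ, h⟩ :=
      exists_restriction (K := K) (A := A) (O := LocalRing (f ≫ p) P) P.asIdeal hx {.inl i}
    obtain ⟨M', e, c, hM', _, hc, he, hK⟩ := exists_ext p hE f P F hj hQ
    obtain ⟨ρ, hρ, hρ'⟩ := h M'.O c e.hom hc (by rw [hA]; exact he)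
    refine ⟨M', e, ρ, hM', fun R => ⟨?_, ?_⟩⟩
    · have := hρ R
      rwa [Set.image_singleton, Ideal.mem_span_singleton] at this
    · refine hρ' _ (fun x => ?_) (fun l hl => ?_) R
      · exact ((e.isAdapted huv).coordinates.d_eq_zero_iff M'.hd).1 (hK x) _
      · have h1 : e.hom (Sum.elim u v l) = Sum.elim (e.hom ∘ u) (e.hom ∘ v) l := by
          rcases l with l | l <;> rfl
        refine (congrArg _ h1).trans ?_
        rw [(e.isAdapted huv).coordinates.partialDeriv_coord, if_neg]
        exact fun h => hl h.symm
  const M hM R hR := by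
    cases hM with
    | mk A f P F =>
    obtain ⟨s, r, u, v, huv⟩ := hR
    obtain ⟨_, _, hA, _, _, _⟩ := exists_algebra (f ≫ p) P
    have hx : IsCoordinateSystem (KaehlerDifferential.D K (LocalRing (f ≫ p) P))
      (Sum.elim u v : _ → LocalRing (f ≫ p) P) := huv.coordinates
    obtain ⟨C, _, j, Q, _, hj, hQ, h⟩ :=
      exists_restriction (K := K) (A := A) (O := LocalRing (f ≫ p) P) P.asIdeal hx Set.univ
    obtain ⟨M', e, c, hM', _, hc, he, hK⟩ := exists_ext p hE f P F hj hQ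
    obtain ⟨ρ, hρ, hρ'⟩ := h M'.O c e.hom hc (by rw [hA]; exact he)
    refine ⟨M', e, ρ R, hM', ?_, ?_⟩
    · refine ((e.isAdapted huv).coordinates.d_eq_zero_iff M'.hd).2 fun l => ?_
      refine hρ' _ (fun x => ?_) (fun l hl => absurd (Set.mem_univ l) hl) R
      exact ((e.isAdapted huv).coordinates.d_eq_zero_iff M'.hd).1 (hK x) _
    · rw [← IsLocalRing.mem_maximalIdeal]
      refine (Ideal.span_le.2 ?_) (hρ R)
      rintro _ ⟨l, -, rfl⟩
      exact (IsLocalRing.mem_maximalIdeal _).2 (e.mem_nonunits _ (huv.coordinates.vanish l))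
  root M hM R n hR hR' hn := by
    cases hM with
    | mk A f P F =>
    obtain ⟨_, _, hA, _, _, _⟩ := exists_algebra (f ≫ p) P
    let : Algebra ℚ A := ((algebraMap K A).comp (algebraMap ℚ K)).toAlgebra
    obtain ⟨C, _, j, Q, _, hj, hQ, h⟩ := exists_root (A := A) (O := LocalRing (f ≫ p) P) P.asIdeal hR' hn
    obtain ⟨M', e, c, hM', _, hc, he, hK⟩ := exists_ext p hE f P F hj hQ
    obtain ⟨t, ht⟩ := h M'.O c e.hom (by rw [hA]; exact he)
    exact ⟨M', e, 1, t, hM', M'.hd.map_one, ht.trans (one_mul _).symm⟩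

end HsiangPati.Algebraic

namespace HsiangPati.Algebraic
open AlgebraicGeometry

/-! ### The equivalence for smooth schemes -/

variable {K : Type u} [Field K] [CharZero K] {X M₀ U : Scheme.{u}} {n N k : ℕ} {ι : Type w₅}

omit [CharZero K] in
/-- Ideals of a local ring are determined by their extensions to étale neighbourhoods. -/
theorem comap_map_pullback (p : X ⟶ Spec (.of K)) (p' : U ⟶ Spec (.of K)) (g : U ⟶ X) [Etale g]
    (b : U) (I : Ideal (LocalRing p (g b))) :
    (I.map (pullback p' p g b)).comap (pullback p' p g b) = I := by
  let : Algebra (LocalRing p (g b)) (LocalRing p' b) := (pullback p' p g b).toAlgebra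
  have : Module.Flat (LocalRing p (g b)) (LocalRing p' b) := Flat.stalkMap g b
  have : IsLocalHom (algebraMap (LocalRing p (g b)) (LocalRing p' b)) :=
    inferInstanceAs (IsLocalHom (pullback p' p g b))
  have : Module.FaithfullyFlat (LocalRing p (g b)) (LocalRing p' b) :=
    Module.FaithfullyFlat.of_flat_of_isLocalHom
  exact Ideal.comap_map_eq_self_of_faithfullyFlat (B := LocalRing p' b) I

/-- A point of a scheme has an affine étale neighbourhood. -/
theorem exists_isEtaleModel (p : X ⟶ Spec (.of K)) [LocallyOfFiniteType p] {E : ι → Set X}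
    (hE : ∀ i, IsClosed (E i)) (a : X) (F : Fin N → LocalRing p a) :
    ∃ M', Nonempty (LogModel.Ext (model p a E F) M') ∧ IsEtaleModel p E a F M' := by
  obtain ⟨A, f, _, P, rfl⟩ : ∃ (A : CommRingCat.{u}) (f : Spec A ⟶ X) (_ : Etale f) (P : Spec A),
      f P = a := by
    obtain ⟨P, hP⟩ := X.affineOpenCover.covers a
    exact ⟨_, X.affineOpenCover.f _, inferInstance, P, hP⟩
  exact ⟨_, ⟨modelExt rfl P hE fun _ => rfl⟩, .mk A f P F⟩

/-- A model in Hsiang-Pati form gives étale Hsiang-Pati coordinates. -/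
theorem IsEtaleModel.exists_hasHsiangPatiForm {p : X ⟶ Spec (.of K)} [LocallyOfFiniteType p]
    (q : M₀ ⟶ Spec (.of K)) (σ : X ⟶ M₀) {E : ι → Set X} (hk : 1 ≤ k) {a : X}
    {z : Fin N → LocalRing q (σ a)}
    (hz : IsCoordinateSystem (KaehlerDifferential.D K (LocalRing q (σ a))) z)
    {F : Fin N → LocalRing p a} (hF : F = fun m => pullback p q σ a (z m))
    {M : LogModel.{u, u, w₅} N} (hM : IsEtaleModel p E a F M) (h : M.HasPartialForm k) :
    ∃ (U : Scheme.{u}) (f : U ⟶ X) (_ : Etale f) (b : U) (_ : f b = a),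
      HasHsiangPatiForm (KaehlerDifferential.D K (LocalRing (f ≫ p) b))
        (componentEqn (f ≫ p) (fun i => f ⁻¹' E i) b)
        (KaehlerDifferential.D K (LocalRing q ((f ≫ σ) b)))
        (pullback (f ≫ p) q (f ≫ σ) b) N k := by
  cases hM with
  | mk A f P F =>
  subst hF
  obtain ⟨s, r, l, l', A, u, v, μ, g, T, τ, huv, hform, hμ⟩ := h
  refine ⟨_, f, inferInstance, P, rfl, ?_⟩
  have hF : (fun m => pullback (f ≫ p) p f P (pullback p q σ (f P) (z m))) =
      fun m => pullback (f ≫ p) q (f ≫ σ) P (z m) :=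
    funext fun m => (pullback_pullback f (f ≫ p) P (z m)).symm
  change IsPartialForm (KaehlerDifferential.D K (LocalRing (f ≫ p) P)) A u v μ
    (fun m => pullback (f ≫ p) p f P (pullback p q σ (f P) (z m))) g T τ at hform
  rw [hF] at hform
  exact IsPartialForm.hasHsiangPatiForm (φ := pullback (f ≫ p) q (f ≫ σ) P) hz huv hform (hμ hk)

/-- If the Fitting ideals are monomial, there are Hsiang-Pati coordinates on an étale neighbourhood. -/
theorem exists_hasHsiangPatiForm {p : X ⟶ Spec (.of K)} [Smooth p]
    {q : M₀ ⟶ Spec (.of K)} {σ : X ⟶ M₀} (hσ : σ ≫ q = p) {E : ι → Set X}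
    (hE : ∀ i, IsClosed (E i)) (hk : 1 ≤ k) (hkn : k ≤ n) (a : X)
    (h : ∀ j, 1 ≤ j → j ≤ k → IsPrincipalMonomial (KaehlerDifferential.D K (LocalRing p a))
      (componentEqn p E a) (logFittingIdeal (KaehlerDifferential.D K (LocalRing p a))
        (componentEqn p E a) (KaehlerDifferential.D K (LocalRing q (σ a))) (pullback p q σ a)
        N n (n - j))) :
    ∃ (U : Scheme.{u}) (f : U ⟶ X) (_ : Etale f) (b : U) (_ : f b = a),
      HasHsiangPatiForm (KaehlerDifferential.D K (LocalRing (f ≫ p) b))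
        (componentEqn (f ≫ p) (fun i => f ⁻¹' E i) b)
        (KaehlerDifferential.D K (LocalRing q ((f ≫ σ) b)))
        (pullback (f ≫ p) q (f ≫ σ) b) N k := by
  obtain ⟨s, r, u, v, huv, z, hz, h⟩ :=
    (isLogModel_componentEqn p E a).exists_logMinors_eq (isPullback_pullback hσ a N) hk hkn h
  obtain ⟨M, ⟨e⟩, hM⟩ := exists_isEtaleModel p hE a fun m => pullback p q σ a (z m)
  obtain ⟨M', hM', hform⟩ := (isClosedFamily p hE a _).hasPartialForm (k := k) hM
    (e.isAdapted huv) fun j hj hj' => e.monomialMinors ⟨s, r, u, v, huv, h j hj hj'⟩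
  exact hM'.exists_hasHsiangPatiForm q σ hk hz rfl hform

/-- Monomiality of the Fitting ideals descends from an étale neighbourhood by faithful flatness. -/
theorem isPrincipalMonomial_of_hasHsiangPatiForm {p : X ⟶ Spec (.of K)} [LocallyOfFiniteType p]
    {q : M₀ ⟶ Spec (.of K)} {σ : X ⟶ M₀} (hσ : σ ≫ q = p) {E : ι → Set X}
    (hE : ∀ i, IsClosed (E i)) (f : U ⟶ X) [Etale f] (b : U)
    (huv : ∃ (s r : ℕ) (u : Fin s → LocalRing p (f b)) (v : Fin r → LocalRing p (f b)),
      IsAdapted (KaehlerDifferential.D K (LocalRing p (f b))) (componentEqn p E (f b)) u v)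
    (h : HasHsiangPatiForm (KaehlerDifferential.D K (LocalRing (f ≫ p) b))
        (componentEqn (f ≫ p) (fun i => f ⁻¹' E i) b)
        (KaehlerDifferential.D K (LocalRing q ((f ≫ σ) b)))
        (pullback (f ≫ p) q (f ≫ σ) b) N k) {j : ℕ} (hj : j ≤ k) (hkn : k ≤ n) :
    IsPrincipalMonomial (KaehlerDifferential.D K (LocalRing p (f b)))
      (componentEqn p E (f b)) (logFittingIdeal (KaehlerDifferential.D K (LocalRing p (f b)))
        (componentEqn p E (f b)) (KaehlerDifferential.D K (LocalRing q (σ (f b))))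
        (pullback p q σ (f b)) N n (n - j)) := by
  obtain ⟨s, r, u, v, huv⟩ := huv
  have hfσ : (f ≫ σ) ≫ q = f ≫ p := by rw [Category.assoc, hσ]
  have hM := isLogModel_componentEqn p E (f b)
  have hM' := isLogModel_componentEqn (f ≫ p) (fun i => f ⁻¹' E i) b
  have hφ := isPullback_pullback hfσ b N
  obtain ⟨s', r', u', v', γ', huv', hF'⟩ := h.isPrincipalMonomial hM' hφ hj hkn
  obtain ⟨_, _, _, _, z, _, hz, -⟩ := h
  let e := modelExt (p := p) rfl b hE (F := fun m => pullback p q σ (f b) (z m))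
    (F' := fun m => pullback (f ≫ p) q (f ≫ σ) b (z m)) fun m => (pullback_pullback f (f ≫ p) b (z m)).symm
  have huv₁ := isAdapted_pullback rfl b hE huv
  obtain ⟨γ, hγ⟩ := hM'.exists_span_monomial_eq huv₁ huv' γ'
  rw [hM'.logFittingIdeal_eq huv₁ hφ hz (hj.trans hkn), hγ] at hF'
  have h1 : (logMinors hM.isExteriorDerivative huv.coordinates
      (fun m => pullback p q σ (f b) (z m)) j).map (pullback (f ≫ p) p f b) =
      (Ideal.span {monomial u γ}).map (pullback (f ≫ p) p f b) := by
    rw [Ideal.map_span, Set.image_singleton]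
    refine ((e.logMinors_hom huv j).symm.trans hF').trans ?_
    exact congrArg (fun t => Ideal.span {t}) (e.hom_monomial γ).symm
  refine ⟨s, r, u, v, γ, huv, ?_⟩
  rw [hM.logFittingIdeal_eq huv (isPullback_pullback hσ (f b) N) hz (hj.trans hkn),
    ← comap_map_pullback p (f ≫ p) f b (logMinors _ _ _ _), h1, comap_map_pullback]

end HsiangPati.Algebraic

theorem lemma3p1 (n N k : ℕ) (hk : 1 ≤ k) (hkn : k ≤ n) :
    -- real- and complex-analytic manifolds
    (∀ (𝕜 : Type w₁) [RCLike 𝕜]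
      (X : Type w₂) [TopologicalSpace X] [ChartedSpace (EuclideanSpace 𝕜 (Fin n)) X]
      [IsManifold 𝓘(𝕜, EuclideanSpace 𝕜 (Fin n)) ω X]
      (M₀ : Type w₃) [TopologicalSpace M₀] [ChartedSpace (EuclideanSpace 𝕜 (Fin N)) M₀]
      [IsManifold 𝓘(𝕜, EuclideanSpace 𝕜 (Fin N)) ω M₀]
      (σ : X → M₀)
      (hσ : ContMDiff 𝓘(𝕜, EuclideanSpace 𝕜 (Fin n)) 𝓘(𝕜, EuclideanSpace 𝕜 (Fin N)) ω σ)
      (ι : Type w₄) (E : ι → Set X) (_ : HsiangPati.Analytic.IsSNCDivisor 𝕜 n E)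
      (_ : HsiangPati.Analytic.criticalLocus 𝕜 n N σ = ⋃ i, E i) (a : X),
      (∀ j, 1 ≤ j → j ≤ k →
        HsiangPati.IsPrincipalMonomial (HsiangPati.Analytic.germD 𝕜 n a)
          (HsiangPati.Analytic.componentEqn 𝕜 n E a)
          (HsiangPati.logFittingIdeal (HsiangPati.Analytic.germD 𝕜 n a)
            (HsiangPati.Analytic.componentEqn 𝕜 n E a) (HsiangPati.Analytic.germD 𝕜 N (σ a))
            (HsiangPati.Analytic.pullback hσ a) N n (n - j))) ↔
      HsiangPati.HasHsiangPatiForm (HsiangPati.Analytic.germD 𝕜 n a)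
        (HsiangPati.Analytic.componentEqn 𝕜 n E a) (HsiangPati.Analytic.germD 𝕜 N (σ a))
        (HsiangPati.Analytic.pullback hσ a) N k) ∧
    -- smooth algebraic varieties over a field of characteristic zero
    (∀ (K : Type u) [Field K] [CharZero K]
      (X M₀ : AlgebraicGeometry.Scheme.{u}) (p : X ⟶ AlgebraicGeometry.Spec (.of K))
      (q : M₀ ⟶ AlgebraicGeometry.Spec (.of K))
      [AlgebraicGeometry.SmoothOfRelativeDimension n p]
      [AlgebraicGeometry.SmoothOfRelativeDimension N q]
      (σ : X ⟶ M₀) (_ : σ ≫ q = p)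
      (ι : Type w₅) (E : ι → Set X) (_ : HsiangPati.Algebraic.IsSNCDivisor p E)
      (_ : HsiangPati.Algebraic.criticalLocus p q σ n = ⋃ i, E i) (a : X) (_ : IsClosed {a}),
      (∀ j, 1 ≤ j → j ≤ k →
        HsiangPati.IsPrincipalMonomial
          (KaehlerDifferential.D K (HsiangPati.Algebraic.LocalRing p a))
          (HsiangPati.Algebraic.componentEqn p E a)
          (HsiangPati.logFittingIdeal
            (KaehlerDifferential.D K (HsiangPati.Algebraic.LocalRing p a))
            (HsiangPati.Algebraic.componentEqn p E a)
            (KaehlerDifferential.D K (HsiangPati.Algebraic.LocalRing q (σ a)))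
            (HsiangPati.Algebraic.pullback p q σ a) N n (n - j))) ↔
      -- the coordinates `(u, v)` are étale, i.e. defined on an étale neighbourhood `(U, b)` of `a`
      ∃ (U : AlgebraicGeometry.Scheme.{u}) (f : U ⟶ X) (_ : AlgebraicGeometry.Etale f) (b : U) (_ : f b = a),
        HsiangPati.HasHsiangPatiForm
          (KaehlerDifferential.D K (HsiangPati.Algebraic.LocalRing (f ≫ p) b))
          (HsiangPati.Algebraic.componentEqn (f ≫ p) (fun i => f ⁻¹' E i) b)
          (KaehlerDifferential.D K (HsiangPati.Algebraic.LocalRing q ((f ≫ σ) b)))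
          (HsiangPati.Algebraic.pullback (f ≫ p) q (f ≫ σ) b) N k) := by
  refine ⟨?_, ?_⟩
  · intro 𝕜 _ X _ _ _ M₀ _ _ _ σ hσ ι E _ _ a
    exact HsiangPati.Analytic.isPrincipalMonomial_iff_hasHsiangPatiForm hk hkn hσ E a
  · intro K _ _ X M₀ p q _ _ σ hσ ι E hE _ a ha
    have : AlgebraicGeometry.Smooth p := AlgebraicGeometry.SmoothOfRelativeDimension.smooth n p
    constructor
    · exact HsiangPati.Algebraic.exists_hasHsiangPatiForm hσ hE.isClosed hk hkn a
    · rintro ⟨U, f, _, b, rfl, h⟩ j _ hj'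
      exact HsiangPati.Algebraic.isPrincipalMonomial_of_hasHsiangPatiForm hσ hE.isClosed f b
        (hE.adapted _ ha) h hj' hkn
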